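/- All hypergraphs are finite. A multi-hypergraph $X$ on a vertex set $V(X)$ has labelled edges, each with a set of vertices as its ends, so parallel copies of an edge are different edges; $v(X)=|V(X)|$, and we write $X$ also for its edge set. It is $r$-uniform if every edge has exactly $r$ vertices; its multiplicity is then the maximum number of edges on a common $r$-set; and $\Delta(X)$ is the maximum, over $(r-1)$-subsets $S\subseteq V(X)$, of the number of edges containing $S$. A subgraph $H$ consists of a vertex set $V(H)$ and a set of edges whose ends lie in $V(H)$; it has $v(H)$ vertices and $e(H)$ edges. A (sub)graph $H$ is $K_q^r$-divisible if for every $S\subseteq V(H)$ with $|S|=i\le r-1$ the number of edges of $H$ containing $S$ is divisible by $\binom{q-i}{r-i}$. Let $M(q,r)=\mathrm{lcm}\left(\binom{q-i}{r-i}: 0\le i\le r-1\right)$. A multi-hypergraph $X$ is $i$-flat to $Y\subseteq V(X)$ if $|e\setminus Y|\le i$ for every edge $e$ of $X$. Let $X$ and $R$ be multi-hypergraphs with $V(R)=V(X)$, and let $X\cup R$ be their edge-disjoint union. Let $\mathcal H$ be a family of subgraphs of $X\cup R$. Consider the condition $(*)$ every $H\in\mathcal H$ has at most one edge in $X$, and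 for every $K_q^r$-divisible subgraph $L$ of $X$ there are pairwise edge-disjoint members of $\mathcal H$ the union of whose edge sets is the edge set of $L\cup R$. For $r$-uniform $X$ and $R$, $R$ is a $K_q^r$-multi-refiner of $X$ with refinement family $\mathcal H$ if every $H\in\mathcal H$ is $K_q^r$-divisible and $(*)$ holds. It is $C$-refined if every edge of $X\cup R$ lies in at most $C$ members of $\mathcal H$ and $\max\{v(H),e(H)\}\le C$ for every $H\in\mathcal H$. Let $\Delta(\mathcal H)=\max_{S}|\{H\in\mathcal H:S\subseteq V(H)\}|$ over $(r-1)$-subsets $S$ of $V(X)$. A multi-hypergraph $A$ is a $K_q^r$-multi-omni-absorber for $X$ with decomposition family $\mathcal H$ if every $H\in\mathcal H$ is isomorphic to the complete $r$-uniform hypergraph $K_q^r$ on $q$ vertices and $(*)$ holds with $R=A$; it is $C$-refined if every edge of $X\cup A$ lies in at most $C$ members of $\mathcal H$. For $r'\ge 1$ let $\mathrm{MOA}(r')$ be the following assertion. For every integer $q'>r'$ there is an integer $C'\ge 1$ such that for every $r'$-uniform multi-hypergraph $X$ of multiplicity at most $M(q',r')$ with $v(X)\ge C'$ and every $Y\subseteq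 V(X)$ with $|Y|\ge v(X)/3$, there is a $C'$-refined $K_{q'}^{r'}$-multi-omni-absorber $A$ for $X$ that is $(r'-1)$-flat to $Y$ and satisfies $\Delta(A)\le C'\cdot\max\left\{\Delta(X),\,v(X)^{1-\frac1{r'}}\log v(X)\right\}$. **Theorem (Multi-Refiner Theorem).** For all integers $q>r\ge 1$ there exists an integer $C\ge 1$ such that the following holds. Suppose that $\mathrm{MOA}(r')$ holds for all $r'\in\{1,\dots,r-1\}$. Let $X$ be an $r$-uniform multi-hypergraph of multiplicity at most $M(q,r)$ with $v(X)\ge C$, let $\Delta:=\max\left\{\Delta(X),\,v(X)^{1-\frac1r}\log v(X)\right\}$, and let $Y\subseteq V(X)$ with $|Y|\ge v(X)/3$. Then there exists a $C$-refined $K_q^r$-multi-refiner $R$ of $X$ with refinement family $\mathcal H$ such that 1. $\Delta(\mathcal H)\le C\cdot\Delta$, and 2. $R$ is $(r-1)$-flat to $Y$. -/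

import Mathlib

universe u v

/-- A finite multi-hypergraph on the vertex set `V`.  Its edges are labelled, so that parallel copies
of an edge are different elements of `Edge`; each edge spans a set of vertices (no repetitions). -/
structure MultiHypergraph (V : Type u) where
  Edge : Type v
  edgeFintype : Fintype Edge
  ends : Edge → Finset V

namespace MultiHypergraph

instance {V : Type u} (G : MultiHypergraph.{u, v} V) : Fintype G.Edge := G.edgeFintype

variable {V : Type u}

/-- Every edge has exactly `r` vertices. -/
def IsUniform (G : MultiHypergraph.{u, v} V) (r : ℕ) : Prop :=
  ∀ e : G.Edge, (G.ends e).card = r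

open scoped Classical in
/-- The number of edges containing `S`, i.e. the number of edges of the link of `S`. -/
noncomputable def degree (G : MultiHypergraph.{u, v} V) (S : Finset V) : ℕ :=
  (Finset.univ.filter fun e : G.Edge => S ⊆ G.ends e).card

/-- Every set of `r` vertices is contained in at most `m` edges; for an `r`-uniform multi-hypergraph
this says that its multiplicity is at most `m`. -/
def MultiplicityLE (G : MultiHypergraph.{u, v} V) (r m : ℕ) : Prop :=
  ∀ S : Finset V, S.card = r → G.degree S ≤ m

/-- The maximum over all `(r - 1)`-sets `S` of vertices of the number of edges containing `S`. -/
noncomputable def maxDegree [Fintype V] (G : MultiHypergraph.{u, v} V) (r : ℕ) : ℕ :=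
  (Finset.univ.powersetCard (r - 1)).sup G.degree

open scoped Classical in
/-- `G` is `i`-flat to `Y`: every edge has at most `i` vertices outside of `Y`. -/
def IsFlat (G : MultiHypergraph.{u, v} V) (i : ℕ) (Y : Finset V) : Prop :=
  ∀ e : G.Edge, (G.ends e \ Y).card ≤ i

/-- The edge-disjoint union of two multi-hypergraphs on the same vertex set. -/
def union (X R : MultiHypergraph.{u, v} V) : MultiHypergraph.{u, v} V where
  Edge := X.Edge ⊕ R.Edge
  edgeFintype := inferInstance
  ends := Sum.elim X.ends R.ends

/-- A subgraph: a set of edges together with a set of vertices containing all their ends. -/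
@[ext]
structure Subgraph (G : MultiHypergraph.{u, v} V) where
  verts : Finset V
  edges : Finset G.Edge
  ends_subset : ∀ e ∈ edges, G.ends e ⊆ verts

namespace Subgraph

variable {G : MultiHypergraph.{u, v} V}

open scoped Classical in
/-- The number of edges of the subgraph containing `S`. -/
noncomputable def degree (H : G.Subgraph) (S : Finset V) : ℕ :=
  (H.edges.filter fun e => S ⊆ G.ends e).card

/-- `K_q^r`-divisibility. -/
def IsDivisible (H : G.Subgraph) (q r : ℕ) : Prop :=
  ∀ S : Finset V, S ⊆ H.verts → S.card < r →
    (q - S.card).choose (r - S.card) ∣ H.degree S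

/-- The subgraph is isomorphic to `K_q^r`: it has `q` vertices, its edges have `r` vertices, and each
`r`-set of its vertices is the vertex set of exactly one of its edges. -/
def IsClique (H : G.Subgraph) (q r : ℕ) : Prop :=
  H.verts.card = q ∧ (∀ e ∈ H.edges, (G.ends e).card = r) ∧
    ∀ S : Finset V, S ⊆ H.verts → S.card = r → ∃! e, e ∈ H.edges ∧ G.ends e = S

end Subgraph

open scoped Classical in
/-- The number of members of the family containing the edge `e`. -/
noncomputable def edgeCount {G : MultiHypergraph.{u, v} V} (ℋ : Finset G.Subgraph) (e : G.Edge) : ℕ :=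
  (ℋ.filter fun H => e ∈ H.edges).card

open scoped Classical in
/-- The refinement degree of a vertex set `S`: the number of members whose vertex set contains `S`. -/
noncomputable def refinementDegree {G : MultiHypergraph.{u, v} V} (ℋ : Finset G.Subgraph)
    (S : Finset V) : ℕ :=
  (ℋ.filter fun H => S ⊆ H.verts).card

/-- The refinement degree of a family: the maximum refinement degree of an `(r - 1)`-set. -/
noncomputable def maxRefinementDegree [Fintype V] {G : MultiHypergraph.{u, v} V}
    (ℋ : Finset G.Subgraph) (r : ℕ) : ℕ :=
  (Finset.univ.powersetCard (r - 1)).sup (refinementDegree ℋ)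

/-- A `C`-refined family of subgraphs. -/
def IsRefinedFamily {G : MultiHypergraph.{u, v} V} (ℋ : Finset G.Subgraph) (C : ℝ) : Prop :=
  (∀ e : G.Edge, (edgeCount ℋ e : ℝ) ≤ C) ∧
    ∀ H ∈ ℋ, ((max H.verts.card H.edges.card : ℕ) : ℝ) ≤ C

/-- The members of `ℋ` have at most one edge in `X`, and for every `K_q^r`-divisible subgraph `L` of
`X` there are pairwise edge-disjoint members of `ℋ` whose union is `L ∪ R` (as sets of edges). -/
def Decomposes (q r : ℕ) (X R : MultiHypergraph.{u, v} V)
    (ℋ : Finset (X.union R).Subgraph) : Prop :=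
  (∀ H ∈ ℋ, (H.edges.filter fun e => Sum.isLeft e = true).card ≤ 1) ∧
    ∀ L : X.Subgraph, L.IsDivisible q r →
      ∃ Q : Finset (X.union R).Subgraph, Q ⊆ ℋ ∧
        (Q : Set (X.union R).Subgraph).PairwiseDisjoint Subgraph.edges ∧
        (∀ e : X.Edge, (∃ H ∈ Q, (Sum.inl e : X.Edge ⊕ R.Edge) ∈ H.edges) ↔ e ∈ L.edges) ∧
        ∀ e : R.Edge, ∃ H ∈ Q, (Sum.inr e : X.Edge ⊕ R.Edge) ∈ H.edges

/-- `R` is a `K_q^r`-multi-refiner of `X` with refinement family `ℋ`. -/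
structure IsMultiRefiner (q r : ℕ) (X R : MultiHypergraph.{u, v} V)
    (ℋ : Finset (X.union R).Subgraph) : Prop where
  uniform : R.IsUniform r
  divisible : ∀ H ∈ ℋ, H.IsDivisible q r
  decomposes : Decomposes q r X R ℋ

/-- `A` is a `K_q^r`-multi-omni-absorber for `X` with decomposition family `ℋ`. -/
structure IsMultiOmniAbsorber (q r : ℕ) (X A : MultiHypergraph.{u, v} V)
    (ℋ : Finset (X.union A).Subgraph) : Prop where
  clique : ∀ H ∈ ℋ, H.IsClique q r
  decomposes : Decomposes q r X A ℋ

/-- `M(q, r)`, the least common multiple of the numbers `(q - i).choose (r - i)` for `i < r`. -/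
def multiplicityBound (q r : ℕ) : ℕ :=
  (Finset.range r).lcm fun i => (q - i).choose (r - i)

/-- `Δ = max {Δ(X), v(X)^(1 - 1/r) * log v(X)}`. -/
noncomputable def degreeScale [Fintype V] (X : MultiHypergraph.{u, v} V) (r : ℕ) : ℝ :=
  max (X.maxDegree r : ℝ)
    ((Fintype.card V : ℝ) ^ (1 - 1 / (r : ℝ)) * Real.log (Fintype.card V))

end MultiHypergraph

open MultiHypergraph in
/-- The assertion of the Refined Multi-Omni-Absorber Theorem in uniformity `r` (for all `q > r`). -/
def RefinedMultiOmniAbsorberTheorem (r : ℕ) : Prop :=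
  ∀ q : ℕ, r < q → ∃ C : ℕ, 1 ≤ C ∧
    ∀ (V : Type u) [Fintype V] (X : MultiHypergraph.{u, v} V),
      X.IsUniform r → X.MultiplicityLE r (multiplicityBound q r) → C ≤ Fintype.card V →
      ∀ Y : Finset V, (Fintype.card V : ℝ) / 3 ≤ Y.card →
        ∃ (A : MultiHypergraph.{u, v} V) (ℋ : Finset (X.union A).Subgraph),
          IsMultiOmniAbsorber q r X A ℋ ∧ (∀ e, (edgeCount ℋ e : ℝ) ≤ C) ∧
          (A.maxDegree r : ℝ) ≤ C * X.degreeScale r ∧ A.IsFlat (r - 1) Y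

section

open Finset
set_option linter.unusedSectionVars false

/-! Edge sets are relaxed to integer-valued functions on finite sets (chains). It suffices to find a
sparse collection of divisible chains of bounded size whose sets all meet `Y` (gadgets) and, for
each edge `x` of `X`, a divisible chain `O` of bounded size with coefficient 1 at `x` and all its
other sets meeting `Y`, such that for every divisible `L` the sum of `x - O` over `L` is an integral
combination of gadgets. This is `Refinable`.

Return to multi-hypergraphs. Coefficients matter only modulo M = M(q,r), because M parallel copies
of an r-set form a divisible subgraph. For each chain and each set in its support, `R` receives 2M
copies of that set, in two pools. A multiple of a chain uses as many copies from the first pools as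
the residues of its coefficients demand. The coefficients at each fixed set add up to zero, so a
carry, passed along a cyclic order through the second pools, groups the remaining copies into
bundles of bounded size, each a multiple of M parallel edges (`exists_carry`,
`decomposes_refineFamily`).

Spanning. Call a chain of r-sets null if all its degrees at sets of fewer than r vertices vanish.
Null chains are spanned by octahedra, the products of r differences a - b (`mem_span_oct`), but
there are too many octahedra. Vertices are therefore labelled by vectors indexed by r rows of κ
coordinates over Z/N, where the number of labels is of order v(X). Inside `Y` there are c classes
(types) in which each label occurs exactly once. Up to bounded factors, an octahedron is determined
by r-1 vertices of a transversal together with its label sum and the label differences of its pairs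
(`load_le_of_sum`). Label sums vanishing on one of the r rows number only O(N^(κ(r-1))), of order
v(X)^(1-1/r); this is the source of the exponent. Null chains on sets with such label sums are
spanned by octahedra with O(N^(κ(r-1))) possible sums and differences (`mem_span_shift`,
`card_shapes_le`). Arbitrary edges are moved to such sets by sparse random octahedra
(`exists_moves`).

A divisible chain is made null one degree level at a time: its degrees at ρ-sets, divided by the
degree of a clique, form a null chain of ρ-sets, and an octahedron of ρ pairs times a clique on q -
ρ vertices realizes any prescribed octahedron of degrees (`exists_corrections`).

Sparsity must count vertex sets of gadgets, whereas the counting controls only (r-1)-sets inside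
transversals. So each octahedron is subdivided through random new vertices, after which each piece
has one old vertex per pair (`exists_gadgets`). Random choices are fixed by an exponential moment
and a union bound (`exists_choice`), which needs the log v(X) in the scale. -/

/-- Integer valued functions on the finite subsets of `V`. -/
abbrev Chain (V : Type*) := Finset V → ℤ

namespace Chain

/-! ### Chains, multiplication by vertices, and octahedra -/

section Basic

variable {V : Type*} [DecidableEq V]

/-- The submodule of chains that vanish outside of `E`. -/
def supp (E : Set (Finset V)) : Submodule ℤ (Chain V) where
  carrier := {φ | ∀ e, e ∉ E → φ e = 0}
  add_mem' := by
    intro a b ha hb e he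
    simp [ha e he, hb e he]
  zero_mem' := by intro e _; rfl
  smul_mem' := by
    intro c a ha e he
    simp [ha e he]

omit [DecidableEq V] in
theorem supp_mono {E E' : Set (Finset V)} (h : E ⊆ E') : supp E ≤ supp E' :=
  fun _ hφ e he => hφ e fun h' => he (h h')

/-- The chain of a single set. -/
def sing (e : Finset V) : Chain V := Pi.single e 1

theorem sing_apply (e f : Finset V) : sing e f = if f = e then 1 else 0 := by
  simp [sing, Pi.single_apply]

theorem sing_mem_supp {E : Set (Finset V)} {e : Finset V} (h : e ∈ E) : sing e ∈ supp E := by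
  intro f hf
  rw [sing_apply, if_neg]
  rintro rfl
  exact hf h

theorem eq_sum_sing [Fintype V] (φ : Chain V) : φ = ∑ e, φ e • sing e := by
  ext f
  simp [sing_apply, Finset.sum_apply]

/-- Adding the vertex `a` to all sets. -/
def join (a : V) : Chain V →ₗ[ℤ] Chain V where
  toFun φ e := if a ∈ e then φ (e.erase a) else 0
  map_add' φ ψ := by ext e; by_cases h : a ∈ e <;> simp [h]
  map_smul' c φ := by ext e; by_cases h : a ∈ e <;> simp [h]

theorem join_apply (a : V) (φ : Chain V) (e : Finset V) :
    join a φ e = if a ∈ e then φ (e.erase a) else 0 := rfl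

/-- The values of `φ` at sets already containing `a` are discarded, as if `a` squared to zero; hence
the condition `a ∉ f`. -/
theorem join_mem_supp {a : V} {φ : Chain V} {E : Set (Finset V)} (h : φ ∈ supp E) :
    join a φ ∈ supp {e | ∃ f ∈ E, a ∉ f ∧ e = insert a f} := by
  intro e he
  rw [join_apply]
  split_ifs with ha
  · apply h
    intro hE
    exact he ⟨_, hE, by simp, (Finset.insert_erase ha).symm⟩
  · rfl

theorem join_sing {a : V} {e : Finset V} (h : a ∉ e) : join a (sing e) = sing (insert a e) := by
  ext f
  rw [join_apply, sing_apply, sing_apply]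
  by_cases hf : a ∈ f
  · rw [if_pos hf]
    congr 1
    apply propext
    constructor
    · rintro rfl
      exact (Finset.insert_erase hf).symm
    · rintro rfl
      exact Finset.erase_insert h
  · rw [if_neg hf, if_neg]
    rintro rfl
    simp at hf

/-- Adding all vertices of a list to all sets. -/
def joins (l : List V) : Chain V →ₗ[ℤ] Chain V := l.foldr (fun a T => join a ∘ₗ T) LinearMap.id

@[simp] theorem joins_nil : joins ([] : List V) = LinearMap.id := rfl

@[simp] theorem joins_cons (a : V) (l : List V) (φ : Chain V) :
    joins (a :: l) φ = join a (joins l φ) := rfl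

theorem joins_apply {l : List V} (hl : l.Nodup) (φ : Chain V) (e : Finset V) :
    joins l φ e = if l.toFinset ⊆ e then φ (e \ l.toFinset) else 0 := by
  induction l generalizing e with
  | nil => simp
  | cons a l ih =>
    rw [List.nodup_cons] at hl
    rw [joins_cons, join_apply]
    by_cases ha : a ∈ e
    · rw [if_pos ha, ih hl.2]
      have h1 : (l.toFinset ⊆ e.erase a) ↔ ((a :: l).toFinset ⊆ e) := by
        rw [List.toFinset_cons, Finset.insert_subset_iff, Finset.subset_erase]
        simp [ha, hl.1]
      have h2 : e.erase a \ l.toFinset = e \ (a :: l).toFinset := by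
        ext x
        simp only [Finset.mem_sdiff, Finset.mem_erase, List.toFinset_cons, Finset.mem_insert]
        tauto
      simp only [h1, h2]
    · rw [if_neg ha, if_neg]
      intro h
      exact ha (h (by simp))

theorem joins_sing_empty {l : List V} (hl : l.Nodup) : joins l (sing ∅) = sing l.toFinset := by
  ext e
  rw [joins_apply hl, sing_apply, sing_apply]
  by_cases h : l.toFinset ⊆ e
  · rw [if_pos h]
    congr 1
    rw [Finset.sdiff_eq_empty_iff_subset]
    apply propext
    exact ⟨fun h' => h'.antisymm h, fun h' => h' ▸ subset_rfl⟩
  · rw [if_neg h, if_neg]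
    rintro rfl
    exact h subset_rfl

/-- The vertices of a list of pairs. -/
def pts (L : List (V × V)) : List V := L.flatMap fun p => [p.1, p.2]

omit [DecidableEq V] in
@[simp] theorem pts_nil : pts ([] : List (V × V)) = [] := rfl

omit [DecidableEq V] in
@[simp] theorem pts_cons (p : V × V) (L : List (V × V)) :
    pts (p :: L) = p.1 :: p.2 :: pts L := rfl

omit [DecidableEq V] in
theorem pts_append (L L' : List (V × V)) : pts (L ++ L') = pts L ++ pts L' := by
  simp [pts]

omit [DecidableEq V] in
theorem mem_pts {L : List (V × V)} {v : V} : v ∈ pts L ↔ ∃ p ∈ L, v = p.1 ∨ v = p.2 := by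
  simp [pts]

omit [DecidableEq V] in
theorem length_pts (L : List (V × V)) : (pts L).length = 2 * L.length := by
  induction L with
  | nil => rfl
  | cons p L ih => simp [ih]; ring

/-- Multiplication by all differences of the pairs in a list. -/
def octOn (L : List (V × V)) : Chain V →ₗ[ℤ] Chain V :=
  L.foldr (fun p T => (join p.1 - join p.2) ∘ₗ T) LinearMap.id

@[simp] theorem octOn_nil (ψ : Chain V) : octOn [] ψ = ψ := rfl

theorem octOn_cons (p : V × V) (L : List (V × V)) (ψ : Chain V) :
    octOn (p :: L) ψ = join p.1 (octOn L ψ) - join p.2 (octOn L ψ) := rfl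

theorem octOn_append (L L' : List (V × V)) (ψ : Chain V) :
    octOn (L ++ L') ψ = octOn L (octOn L' ψ) := by
  induction L with
  | nil => rfl
  | cons p L ih => simp [octOn_cons, ih]

/-- The octahedron on a list of pairs. -/
def oct (L : List (V × V)) : Chain V := octOn L (sing ∅)

theorem oct_cons (p : V × V) (L : List (V × V)) :
    oct (p :: L) = join p.1 (oct L) - join p.2 (oct L) := rfl

theorem oct_append (L L' : List (V × V)) : oct (L ++ L') = octOn L (oct L') := octOn_append _ _ _

/-- `Sel L n e`: the set `e` is a transversal of the pairs of `L`, and contains `n` second entries. -/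
inductive Sel : List (V × V) → ℕ → Finset V → Prop
  | nil : Sel [] 0 ∅
  | left {L n e} (a b : V) : Sel L n e → a ∉ e → Sel ((a, b) :: L) n (insert a e)
  | right {L n e} (a b : V) : Sel L n e → b ∉ e → Sel ((a, b) :: L) (n + 1) (insert b e)

theorem Sel.card {L : List (V × V)} {n : ℕ} {e : Finset V} (h : Sel L n e) : e.card = L.length := by
  induction h with
  | nil => rfl
  | left a b _ ha ih => simp [ha, ih]
  | right a b _ ha ih => simp [ha, ih]

theorem Sel.mem_pts {L : List (V × V)} {n : ℕ} {e : Finset V} (h : Sel L n e) {v : V} (hv : v ∈ e) :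
    v ∈ pts L := by
  induction h with
  | nil => simp at hv
  | left a b _ ha ih => rcases Finset.mem_insert.1 hv with rfl | h <;> simp_all
  | right a b _ ha ih => rcases Finset.mem_insert.1 hv with rfl | h <;> simp_all

theorem Sel.exists_mem {L : List (V × V)} {n : ℕ} {e : Finset V} (h : Sel L n e) {p : V × V}
    (hp : p ∈ L) : p.1 ∈ e ∨ p.2 ∈ e := by
  induction h with
  | nil => simp at hp
  | left a b _ ha ih =>
    rcases List.mem_cons.1 hp with rfl | h
    · simp
    · rcases ih h with h | h <;> simp [h]
  | right a b _ ha ih =>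
    rcases List.mem_cons.1 hp with rfl | h
    · simp
    · rcases ih h with h | h <;> simp [h]

/-- Transversals of a list of pairs indexed by a list. -/
theorem Sel.exists_of_map {ι : Type*} [DecidableEq ι] {l : List ι} {f : ι → V × V} {n : ℕ}
    {e : Finset V} (h : Sel (l.map f) n e) (hl : l.Nodup) :
    ∃ T ⊆ l.toFinset, T.card = n ∧
      e = (l.toFinset \ T).image (fun i => (f i).1) ∪ T.image (fun i => (f i).2) := by
  induction l generalizing n e with
  | nil =>
    cases h
    exact ⟨∅, by simp⟩
  | cons i l ih =>
    rw [List.nodup_cons] at hl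
    rw [List.map_cons] at h
    have hi : i ∉ l.toFinset := by simpa using hl.1
    generalize hf : f i = p at h
    cases h with
    | left a b h ha =>
      obtain ⟨T, hT, hc, rfl⟩ := ih h hl.2
      refine ⟨T, hT.trans (by simp), hc, ?_⟩
      rw [List.toFinset_cons, Finset.insert_sdiff_of_notMem _ (fun h => hi (hT h)),
        Finset.image_insert, hf, Finset.insert_union]
    | right a b h ha =>
      obtain ⟨T, hT, hc, rfl⟩ := ih h hl.2
      refine ⟨insert i T, ?_, ?_, ?_⟩
      · rw [List.toFinset_cons]
        exact Finset.insert_subset_insert _ hT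
      · rw [Finset.card_insert_of_notMem (fun h => hi (hT h)), hc]
      · rw [List.toFinset_cons, Finset.insert_sdiff_insert, Finset.image_insert, hf,
          Finset.union_insert, Finset.sdiff_insert_of_notMem hi]

theorem octOn_mem_supp (L : List (V × V)) {ψ : Chain V} {E : Set (Finset V)} (h : ψ ∈ supp E) :
    octOn L ψ ∈ supp {e | ∃ n e₁ e₀, Sel L n e₁ ∧ e₀ ∈ E ∧ Disjoint e₁ e₀ ∧ e = e₁ ∪ e₀} := by
  induction L with
  | nil =>
    refine supp_mono ?_ h
    intro e he
    exact ⟨0, ∅, e, .nil, he, by simp, by simp⟩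
  | cons p L ih =>
    obtain ⟨a, b⟩ := p
    rw [octOn_cons]
    refine Submodule.sub_mem _ (supp_mono ?_ (join_mem_supp ih)) (supp_mono ?_ (join_mem_supp ih))
    · rintro _ ⟨_, ⟨n, e₁, e₀, h1, h2, h3, rfl⟩, ha, rfl⟩
      simp only [Finset.mem_union, not_or] at ha
      refine ⟨n, insert a e₁, e₀, .left a b h1 ha.1, h2, ?_, by simp⟩
      rw [Finset.disjoint_insert_left]
      exact ⟨ha.2, h3⟩
    · rintro _ ⟨_, ⟨n, e₁, e₀, h1, h2, h3, rfl⟩, ha, rfl⟩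
      simp only [Finset.mem_union, not_or] at ha
      refine ⟨n + 1, insert b e₁, e₀, .right a b h1 ha.1, h2, ?_, by simp⟩
      rw [Finset.disjoint_insert_left]
      exact ⟨ha.2, h3⟩

/-- Expanding the product of differences, the term using only first entries is `joins`, and every
other term uses a second entry. Thus, modulo an octahedron, a set can be traded for sets containing
a new vertex. -/
theorem octOn_sub_joins_mem_supp (L : List (V × V)) {ψ : Chain V} {E : Set (Finset V)}
    (h : ψ ∈ supp E) :
    octOn L ψ - joins (L.map Prod.fst) ψ ∈
      supp {e | ∃ n e₁ e₀, Sel L n e₁ ∧ n ≠ 0 ∧ e₀ ∈ E ∧ Disjoint e₁ e₀ ∧ e = e₁ ∪ e₀} := by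
  induction L with
  | nil => simp
  | cons p L ih =>
    obtain ⟨a, b⟩ := p
    rw [octOn_cons, List.map_cons, joins_cons, sub_right_comm, ← map_sub]
    refine Submodule.sub_mem _ (supp_mono ?_ (join_mem_supp ih))
      (supp_mono ?_ (join_mem_supp (octOn_mem_supp L h)))
    · rintro _ ⟨_, ⟨n, e₁, e₀, h1, hn, h2, h3, rfl⟩, ha, rfl⟩
      simp only [Finset.mem_union, not_or] at ha
      refine ⟨n, insert a e₁, e₀, .left a b h1 ha.1, hn, h2, ?_, by simp⟩
      rw [Finset.disjoint_insert_left]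
      exact ⟨ha.2, h3⟩
    · rintro _ ⟨_, ⟨n, e₁, e₀, h1, h2, h3, rfl⟩, ha, rfl⟩
      simp only [Finset.mem_union, not_or] at ha
      refine ⟨n + 1, insert b e₁, e₀, .right a b h1 ha.1, by simp, h2, ?_, by simp⟩
      rw [Finset.disjoint_insert_left]
      exact ⟨ha.2, h3⟩

theorem oct_mem_supp (L : List (V × V)) : oct L ∈ supp {e | ∃ n, Sel L n e} := by
  refine supp_mono ?_ (octOn_mem_supp L (sing_mem_supp (E := {∅}) rfl))
  rintro _ ⟨n, e₁, e₀, h, rfl, -, rfl⟩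
  exact ⟨n, by simpa using h⟩

theorem oct_sub_sing_mem_supp {L : List (V × V)} (hL : (L.map Prod.fst).Nodup) :
    oct L - sing (L.map Prod.fst).toFinset ∈ supp {e | ∃ n, Sel L n e ∧ n ≠ 0} := by
  rw [← joins_sing_empty hL]
  refine supp_mono ?_ (octOn_sub_joins_mem_supp L (sing_mem_supp (E := {∅}) rfl))
  rintro _ ⟨n, e₁, e₀, h, hn, rfl, -, rfl⟩
  exact ⟨n, by simpa using h, hn⟩

end Basic

/-! ### Degrees, null chains, links, and the spanning theorem for octahedra -/

section Degree

variable {V : Type*} [DecidableEq V] [Fintype V]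

/-- The total weight of the sets containing `S`. -/
def deg (S : Finset V) : Chain V →ₗ[ℤ] ℤ where
  toFun φ := ∑ e, if S ⊆ e then φ e else 0
  map_add' φ ψ := by
    rw [← Finset.sum_add_distrib]
    refine Finset.sum_congr rfl fun e _ => ?_
    split_ifs <;> simp
  map_smul' c φ := by
    simp only [RingHom.id_apply, smul_eq_mul, Finset.mul_sum]
    refine Finset.sum_congr rfl fun e _ => ?_
    split_ifs <;> simp

theorem deg_apply (S : Finset V) (φ : Chain V) : deg S φ = ∑ e, if S ⊆ e then φ e else 0 := rfl

theorem deg_sing (S e : Finset V) : deg S (sing e) = if S ⊆ e then 1 else 0 := by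
  rw [deg_apply, Finset.sum_eq_single e]
  · simp [sing_apply]
  · intro f _ hf
    simp [sing_apply, hf]
  · simp

/-- No set of the chain contains `a`. -/
def Avoids (a : V) (φ : Chain V) : Prop := ∀ e, a ∈ e → φ e = 0

/-- For `a ∉ e`, `S ⊆ insert a e` is equivalent to `S.erase a ⊆ e`. -/
theorem deg_join {a : V} {φ : Chain V} (h : Avoids a φ) (S : Finset V) :
    deg S (join a φ) = deg (S.erase a) φ := by
  have key : φ = ∑ e ∈ univ.filter (fun e => a ∉ e), φ e • sing e := by
    conv_lhs => rw [eq_sum_sing φ]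
    rw [Finset.sum_filter]
    refine Finset.sum_congr rfl fun e _ => ?_
    split_ifs with h'
    · rw [h e h', zero_smul]
    · rfl
  rw [key]
  simp only [map_sum, map_smul]
  refine Finset.sum_congr rfl fun e he => ?_
  rw [join_sing (Finset.mem_filter.1 he).2, deg_sing, deg_sing]
  simp only [Finset.subset_insert_iff]

theorem deg_eq_zero_of_avoids {a : V} {φ : Chain V} (h : Avoids a φ) {S : Finset V} (ha : a ∈ S) :
    deg S φ = 0 := by
  rw [deg_apply]
  refine Finset.sum_eq_zero fun e _ => ?_
  split_ifs with hS
  · exact h e (hS ha)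
  · rfl

theorem deg_eq_zero_of_supp {E : Set (Finset V)} {φ : Chain V} (h : φ ∈ supp E) {S : Finset V}
    (hS : ∀ e ∈ E, ¬ S ⊆ e) : deg S φ = 0 := by
  rw [deg_apply]
  refine Finset.sum_eq_zero fun e _ => ?_
  split_ifs with hSe
  · exact h e fun he => hS e he hSe
  · rfl

omit [Fintype V] in
theorem Avoids.join {a b : V} {φ : Chain V} (h : Avoids a φ) (hab : a ≠ b) :
    Avoids a (join b φ) := by
  intro e he
  rw [join_apply]
  split_ifs
  · exact h _ (by simp [hab, he])
  · rfl

omit [Fintype V] in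
theorem Avoids.octOn {a : V} {φ : Chain V} (h : Avoids a φ) {L : List (V × V)} (ha : a ∉ pts L) :
    Avoids a (octOn L φ) := by
  induction L with
  | nil => exact h
  | cons p L ih =>
    simp only [pts_cons, List.mem_cons, not_or] at ha
    intro e he
    rw [octOn_cons]
    simp [(ih ha.2.2).join ha.1 e he, (ih ha.2.2).join ha.2.1 e he]

/-- If `S` misses a pair, the two terms of its difference cancel; if `S` contains both its vertices,
both terms vanish. So only sets with exactly one vertex in each pair survive, and removing these
vertices leaves a degree of `ψ` up to sign. -/
theorem deg_octOn_cases {L : List (V × V)} (hL : (pts L).Nodup) {ψ : Chain V}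
    (h : ∀ v ∈ pts L, Avoids v ψ) (S : Finset V) :
    deg S (octOn L ψ) = 0 ∨ ∃ S' ⊆ S, S'.card + L.length = S.card ∧
      (deg S (octOn L ψ) = deg S' ψ ∨ deg S (octOn L ψ) = - deg S' ψ) := by
  induction L generalizing S with
  | nil => exact Or.inr ⟨S, subset_rfl, by simp⟩
  | cons p L ih =>
    obtain ⟨a, b⟩ := p
    simp only [pts_cons, List.nodup_cons, List.mem_cons, not_or] at hL h
    obtain ⟨⟨hab, haL⟩, hbL, hL⟩ := hL
    have hA : Avoids a (octOn L ψ) := (h a (by simp)).octOn haL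
    have hB : Avoids b (octOn L ψ) := (h b (by simp)).octOn hbL
    rw [octOn_cons, map_sub, deg_join hA, deg_join hB]
    have ih' := fun S => ih hL (fun v hv => h v (by simp [hv])) S
    by_cases ha : a ∈ S
    · by_cases hb : b ∈ S
      · left
        rw [deg_eq_zero_of_avoids hB (by simp [hb, Ne.symm hab]),
          deg_eq_zero_of_avoids hA (by simp [ha, hab]), sub_zero]
      · rw [deg_eq_zero_of_avoids hA (S := S.erase b) (by simp [ha, hab]), sub_zero]
        rcases ih' (S.erase a) with h0 | ⟨S', h1, h2, h3⟩
        · exact Or.inl h0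
        · have := Finset.card_erase_add_one ha
          exact Or.inr ⟨S', h1.trans (Finset.erase_subset _ _), by simp; omega, h3⟩
    · by_cases hb : b ∈ S
      · rw [deg_eq_zero_of_avoids hB (S := S.erase a) (by simp [hb, Ne.symm hab]), zero_sub]
        rcases ih' (S.erase b) with h0 | ⟨S', h1, h2, h3⟩
        · exact Or.inl (by rw [h0, neg_zero])
        · have := Finset.card_erase_add_one hb
          refine Or.inr ⟨S', h1.trans (Finset.erase_subset _ _), by simp; omega, ?_⟩
          rcases h3 with h3 | h3 <;> simp [h3]
      · left
        rw [Finset.erase_eq_of_notMem ha, Finset.erase_eq_of_notMem hb, sub_self]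

theorem deg_octOn_of_card_lt {L : List (V × V)} (hL : (pts L).Nodup) {ψ : Chain V}
    (h : ∀ v ∈ pts L, Avoids v ψ) {S : Finset V} (hS : S.card < L.length) :
    deg S (octOn L ψ) = 0 := by
  rcases deg_octOn_cases hL h S with h | ⟨S', -, h, -⟩
  · exact h
  · omega

/-- When `S` has one vertex for each pair nothing of it remains for `ψ`, so the degree is the
coefficient of `S` in the octahedron times the total weight of `ψ`. This is how prescribed degrees
are realized later. -/
theorem deg_octOn_of_card_eq {L : List (V × V)} (hL : (pts L).Nodup) {ψ : Chain V}
    (h : ∀ v ∈ pts L, Avoids v ψ) {S : Finset V} (hS : S.card = L.length) :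
    deg S (octOn L ψ) = oct L S * deg ∅ ψ := by
  induction L generalizing S with
  | nil =>
    have : S = ∅ := by simpa using hS
    subst this
    simp [oct, sing_apply]
  | cons p L ih =>
    obtain ⟨a, b⟩ := p
    simp only [pts_cons, List.nodup_cons, List.mem_cons, not_or] at hL h
    obtain ⟨⟨hab, haL⟩, hbL, hL⟩ := hL
    have hA : Avoids a (octOn L ψ) := (h a (by simp)).octOn haL
    have hB : Avoids b (octOn L ψ) := (h b (by simp)).octOn hbL
    have hE : ∀ v : V, Avoids v (sing (∅ : Finset V)) := by
      intro v e he
      rw [sing_apply, if_neg]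
      rintro rfl
      simp at he
    have hA' : Avoids a (oct L) := (hE a).octOn haL
    have hB' : Avoids b (oct L) := (hE b).octOn hbL
    have ih' := fun S => ih (S := S) hL (fun v hv => h v (by simp [hv]))
    rw [octOn_cons, map_sub, deg_join hA, deg_join hB, oct_cons]
    simp only [Pi.sub_apply, join_apply]
    simp only [List.length_cons] at hS
    by_cases ha : a ∈ S
    · have h1 := Finset.card_erase_add_one ha
      rw [if_pos ha, ih' (S.erase a) (by omega),
        deg_eq_zero_of_avoids hA (S := S.erase b) (by simp [ha, hab]), hA' (S.erase b) (by simp [ha, hab])]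
      simp
    · by_cases hb : b ∈ S
      · have h1 := Finset.card_erase_add_one hb
        rw [if_neg ha, if_pos hb, ih' (S.erase b) (by omega),
          deg_eq_zero_of_avoids hB (S := S.erase a) (by simp [hb, Ne.symm hab])]
        simp
      · rw [if_neg ha, if_neg hb, Finset.erase_eq_of_notMem ha, Finset.erase_eq_of_notMem hb]
        simp

/-- The chains of `ρ`-sets all of whose degrees vanish. -/
def null (ρ : ℕ) : Submodule ℤ (Chain V) where
  carrier := {φ | φ ∈ supp {e | e.card = ρ} ∧ ∀ S : Finset V, S.card < ρ → deg S φ = 0}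
  add_mem' := by
    intro a b ha hb
    exact ⟨Submodule.add_mem _ ha.1 hb.1, fun S hS => by rw [map_add, ha.2 S hS, hb.2 S hS, add_zero]⟩
  zero_mem' := ⟨Submodule.zero_mem _, fun S _ => map_zero _⟩
  smul_mem' := by
    intro c a ha
    exact ⟨Submodule.smul_mem _ _ ha.1, fun S hS => by rw [map_smul, ha.2 S hS, smul_zero]⟩

omit [Fintype V] in
theorem avoids_sing_empty (v : V) : Avoids v (sing (∅ : Finset V)) := by
  intro e he
  rw [sing_apply, if_neg]
  rintro rfl
  simp at he

theorem oct_mem_null {L : List (V × V)} (hL : (pts L).Nodup) : oct L ∈ null L.length := by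
  refine ⟨supp_mono ?_ (oct_mem_supp L), fun S hS =>
    deg_octOn_of_card_lt hL (fun v _ => avoids_sing_empty v) hS⟩
  rintro e ⟨n, h⟩
  exact h.card

/-- The link of `σ`. -/
def link (σ : Finset V) : Chain V →ₗ[ℤ] Chain V where
  toFun φ e := if Disjoint σ e then φ (σ ∪ e) else 0
  map_add' φ ψ := by ext e; by_cases h : Disjoint σ e <;> simp [h]
  map_smul' c φ := by ext e; by_cases h : Disjoint σ e <;> simp [h]

omit [Fintype V] in
theorem link_apply (σ : Finset V) (φ : Chain V) (e : Finset V) :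
    link σ φ e = if Disjoint σ e then φ (σ ∪ e) else 0 := rfl

omit [Fintype V] in
theorem link_mem_supp {σ : Finset V} {φ : Chain V} {E : Set (Finset V)} (h : φ ∈ supp E) :
    link σ φ ∈ supp {e | Disjoint σ e ∧ σ ∪ e ∈ E} := by
  intro e he
  rw [link_apply]
  split_ifs with hd
  · exact h _ fun hE => he ⟨hd, hE⟩
  · rfl

theorem deg_link {σ S : Finset V} (φ : Chain V) (hS : Disjoint σ S) :
    deg S (link σ φ) = deg (σ ∪ S) φ := by
  rw [eq_sum_sing φ]
  simp only [map_sum, map_smul]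
  refine Finset.sum_congr rfl fun e _ => ?_
  congr 1
  rw [deg_sing, deg_apply, Finset.sum_eq_single (e \ σ)]
  · rw [link_apply, if_pos Finset.disjoint_sdiff, sing_apply]
    by_cases hσ : σ ⊆ e
    · rw [if_pos (Finset.union_sdiff_of_subset hσ)]
      congr 1
      apply propext
      rw [Finset.union_subset_iff, Finset.subset_sdiff]
      exact ⟨fun h => ⟨hσ, h.1⟩, fun h => ⟨h.2, hS.symm⟩⟩
    · rw [if_neg (c := σ ∪ S ⊆ e) (fun h => hσ (Finset.union_subset_left h)), if_neg (c := _ = e)]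
      · simp
      · intro h
        exact hσ (h ▸ Finset.subset_union_left)
  · intro f _ hf
    rw [link_apply, sing_apply]
    split_ifs with h1 h2 h3
    · exfalso
      apply hf
      rw [← h3, Finset.union_sdiff_cancel_left h2]
    all_goals rfl
  · simp

theorem link_mem_null {σ : Finset V} {φ : Chain V} {ρ : ℕ} (h : φ ∈ null ρ) :
    link σ φ ∈ null (ρ - σ.card) := by
  refine ⟨supp_mono ?_ (link_mem_supp h.1), fun S hS => ?_⟩
  · rintro e ⟨hd, he⟩
    simp only [Set.mem_ofPred_eq, Finset.card_union_of_disjoint hd] at he ⊢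
    omega
  · by_cases hd : Disjoint σ S
    · rw [deg_link _ hd]
      apply h.2
      rw [Finset.card_union_of_disjoint hd]
      omega
    · rw [deg_apply]
      refine Finset.sum_eq_zero fun e _ => ?_
      split_ifs with hSe
      · rw [link_apply, if_neg fun h => hd (h.mono_right hSe)]
      · rfl

omit [Fintype V] in
theorem joins_link (σ : Finset V) (φ : Chain V) (e : Finset V) :
    joins σ.toList (link σ φ) e = if σ ⊆ e then φ e else 0 := by
  rw [joins_apply (Finset.nodup_toList σ), Finset.toList_toFinset]
  split_ifs with h
  · rw [link_apply, if_pos Finset.disjoint_sdiff, Finset.union_sdiff_of_subset h]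
  · rfl

omit [Fintype V] in
/-- Subtracting the part of a chain at the sets containing some member of `Σ`. -/
theorem mem_sup_supp_of_link {φ : Chain V} {E E' : Set (Finset V)} (hφ : φ ∈ supp E)
    (𝓢 : Submodule ℤ (Chain V)) (P : Finset (Finset V))
    (hP : ∀ e ∈ E, e ∉ E' → ∃ σ ∈ P, σ ⊆ e ∧ ∀ τ ∈ P, τ ⊆ e → τ = σ)
    (h : ∀ σ ∈ P, joins σ.toList (link σ φ) ∈ 𝓢 ⊔ supp E') : φ ∈ 𝓢 ⊔ supp E' := by
  have h1 : φ - ∑ σ ∈ P, joins σ.toList (link σ φ) ∈ supp E' := by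
    intro e he
    simp only [Pi.sub_apply, Finset.sum_apply, joins_link]
    by_cases heE : e ∈ E
    · obtain ⟨σ, hσ, hσe, hu⟩ := hP e heE he
      rw [Finset.sum_eq_single σ, if_pos hσe, sub_self]
      · intro τ hτ hne
        rw [if_neg]
        exact fun h => hne (hu τ hτ h)
      · exact fun h => absurd hσ h
    · rw [hφ e heE]
      simp
  rw [← sub_add_cancel φ (∑ σ ∈ P, joins σ.toList (link σ φ))]
  exact Submodule.add_mem _ (Submodule.mem_sup_right h1) (Submodule.sum_mem _ h)

theorem supp_le_sup_supp {E E' : Set (Finset V)} (𝓢 : Submodule ℤ (Chain V))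
    (h : ∀ e ∈ E, sing e ∈ 𝓢 ⊔ supp E') : supp E ≤ 𝓢 ⊔ supp E' := by
  intro φ hφ
  rw [eq_sum_sing φ]
  refine Submodule.sum_mem _ fun e _ => ?_
  by_cases he : e ∈ E
  · exact Submodule.smul_mem _ _ (h e he)
  · rw [hφ e he, zero_smul]
    exact Submodule.zero_mem _

/-- The engine of the inductions on supports: removing a null part from a null chain leaves a null
chain, now on the smaller support `E'`, to which an induction hypothesis applies. -/
theorem mem_of_mem_sup_supp {ρ : ℕ} {E' : Set (Finset V)} {𝓢 𝓣 : Submodule ℤ (Chain V)}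
    {φ : Chain V} (hφ : φ ∈ null ρ) (h𝓢 : 𝓢 ≤ null ρ) (h𝓢' : 𝓢 ≤ 𝓣)
    (h : φ ∈ 𝓢 ⊔ supp E') (hE' : null ρ ⊓ supp E' ≤ 𝓣) : φ ∈ 𝓣 := by
  obtain ⟨s, hs, t, ht, rfl⟩ := Submodule.mem_sup.1 h
  refine Submodule.add_mem _ (h𝓢' hs) (hE' ⟨?_, ht⟩)
  have := Submodule.sub_mem _ hφ (h𝓢 hs)
  rwa [add_sub_cancel_left] at this

/-- By inclusion–exclusion over the subsets `S` of `W \ e`, the alternating sum of degrees counts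
only sets disjoint from `W \ e`, that is, `e` itself. Since `W \ e` has fewer than ρ vertices, every
degree in this sum is zero. -/
theorem eq_zero_of_mem_null {ρ : ℕ} {φ : Chain V} {W : Finset V} (hφ : φ ∈ null ρ)
    (hW : φ ∈ supp {e | e ⊆ W}) (h : W.card < 2 * ρ) : φ = 0 := by
  ext e
  by_cases he : e ⊆ W ∧ e.card = ρ
  · obtain ⟨heW, hc⟩ := he
    have hJ : (W \ e).card < ρ := by
      rw [Finset.card_sdiff_of_subset heW]
      omega
    have h1 : ∑ S ∈ (W \ e).powerset, (-1 : ℤ) ^ S.card * deg S φ = 0 := by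
      refine Finset.sum_eq_zero fun S hS => ?_
      rw [hφ.2 S ((Finset.card_le_card (Finset.mem_powerset.1 hS)).trans_lt hJ), mul_zero]
    have h2 : ∑ S ∈ (W \ e).powerset, (-1 : ℤ) ^ S.card * deg S φ = φ e := by
      simp only [deg_apply, Finset.mul_sum]
      rw [Finset.sum_comm, Finset.sum_eq_single e]
      · rw [Finset.sum_eq_single ∅]
        · simp
        · intro S hS hne
          rw [if_neg, mul_zero]
          intro hSe
          apply hne
          have := Finset.mem_powerset.1 hS
          rw [← Finset.subset_empty]
          intro x hx
          exact absurd (hSe hx) (Finset.mem_sdiff.1 (this hx)).2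
        · simp
      · intro f _ hf
        by_cases hfe : f ⊆ W ∧ f.card = ρ
        · have h3 : ∀ S ∈ (W \ e).powerset, (-1 : ℤ) ^ S.card * (if S ⊆ f then φ f else 0) =
              if S ∈ ((W \ e) ∩ f).powerset then (-1 : ℤ) ^ S.card * φ f else 0 := by
            intro S hS
            simp only [Finset.mem_powerset, Finset.subset_inter_iff] at hS ⊢
            by_cases hSf : S ⊆ f <;> simp [hS, hSf]
          rw [Finset.sum_congr rfl h3, ← Finset.sum_filter, Finset.filter_mem_eq_inter,
            Finset.inter_eq_right.2 (Finset.powerset_mono.2 Finset.inter_subset_left),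
            ← Finset.sum_mul, Finset.sum_powerset_neg_one_pow_card, if_neg, zero_mul]
          intro hemp
          apply hf
          apply Finset.eq_of_subset_of_card_le _ (by omega)
          intro x hx
          by_contra hxe
          have : x ∈ (W \ e) ∩ f := by simp [hfe.1 hx, hxe, hx]
          rw [hemp] at this
          simp at this
        · have : φ f = 0 := by
            by_cases h4 : f ⊆ W
            · exact hφ.1 f fun h5 => hfe ⟨h4, h5⟩
            · exact hW f h4
          simp [this]
      · simp
    rw [← h2, h1]
    rfl
  · by_cases h4 : e ⊆ W
    · exact hφ.1 e fun h5 => he ⟨h4, h5⟩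
    · exact hW e h4

/-- Null chains on the subsets of `W` are spanned by octahedra in `W`. -/
theorem mem_span_oct {ρ : ℕ} {φ : Chain V} {W : Finset V} (hφ : φ ∈ null ρ)
    (hW : φ ∈ supp {e | e ⊆ W}) :
    φ ∈ Submodule.span ℤ (oct '' {L | L.length = ρ ∧ (pts L).Nodup ∧ ∀ v ∈ pts L, v ∈ W}) := by
  induction ρ generalizing φ W with
  | zero =>
    have : φ = φ ∅ • oct [] := by
      ext e
      simp only [oct, octOn_nil, Pi.smul_apply, sing_apply, smul_eq_mul]
      by_cases he : e = ∅
      · simp [he]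
      · rw [if_neg he, mul_zero]
        exact hφ.1 e (by simpa using he)
    rw [this]
    exact Submodule.smul_mem _ _ (Submodule.subset_span ⟨[], by simp, rfl⟩)
  | succ ρ ih =>
    induction hn : W.card generalizing φ W with
    | zero =>
      rw [eq_zero_of_mem_null hφ hW (by omega)]
      exact Submodule.zero_mem _
    | succ n ihW =>
      by_cases hlt : W.card < 2 * (ρ + 1)
      · rw [eq_zero_of_mem_null hφ hW hlt]
        exact Submodule.zero_mem _
      obtain ⟨w, hw⟩ : W.Nonempty := Finset.card_pos.1 (by omega)
      set 𝓣 := Submodule.span ℤ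
        (oct '' {L : List (V × V) | L.length = ρ + 1 ∧ (pts L).Nodup ∧ ∀ v ∈ pts L, v ∈ W}) with h𝓣
      have h𝓣n : 𝓣 ≤ null (ρ + 1) := by
        rw [h𝓣, Submodule.span_le]
        rintro _ ⟨L, hL, rfl⟩
        rw [← hL.1]
        exact oct_mem_null hL.2.1
      have hlink := ih (φ := link {w} φ) (W := W.erase w)
        (by simpa using link_mem_null (σ := {w}) hφ) (by
          refine supp_mono ?_ (link_mem_supp hW)
          rintro e ⟨hd, he⟩
          rw [Set.mem_ofPred_eq, Finset.subset_erase]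
          exact ⟨Finset.union_subset_right he, by simpa using hd⟩)
      refine mem_of_mem_sup_supp hφ h𝓣n le_rfl (E' := {e | e ⊆ W.erase w}) ?_ ?_
      · refine mem_sup_supp_of_link hW 𝓣 {{w}} ?_ ?_
        · intro e he he'
          refine ⟨{w}, by simp, ?_, by simp⟩
          rw [Finset.singleton_subset_iff]
          by_contra hwe
          exact he' (Finset.subset_erase.2 ⟨he, hwe⟩)
        · intro σ hσ
          rw [Finset.mem_singleton.1 hσ, Finset.toList_singleton]
          change join w (link {w} φ) ∈ 𝓣 ⊔ supp {e | e ⊆ W.erase w}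
          refine Submodule.span_le (p := (𝓣 ⊔ supp {e | e ⊆ W.erase w}).comap (join w)).2 ?_ hlink
          rintro _ ⟨L, ⟨hL1, hL2, hL3⟩, rfl⟩
          change join w (oct L) ∈ 𝓣 ⊔ supp {e | e ⊆ W.erase w}
          -- `W.erase w` has at least 2ρ + 1 vertices and `L` at most 2ρ, so a vertex `w'` is free.
          -- Modulo the octahedron on `(w, w') :: L`, the vertex `w` is exchanged for `w'`, and the
          -- support shrinks to `W.erase w`.
          obtain ⟨w', hw', hw'L⟩ : ∃ w' ∈ W.erase w, w' ∉ (pts L).toFinset := by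
            by_contra hcon
            push Not at hcon
            have h1 := Finset.card_le_card (show W.erase w ⊆ (pts L).toFinset from hcon)
            have h2 := List.toFinset_card_le (pts L)
            rw [length_pts] at h2
            rw [Finset.card_erase_of_mem hw] at h1
            omega
          have : join w (oct L) = oct ((w, w') :: L) + join w' (oct L) := by
            rw [oct_cons]
            abel
          rw [this]
          refine Submodule.add_mem _ (Submodule.mem_sup_left (Submodule.subset_span
            ⟨_, ⟨by simp [hL1], ?_, ?_⟩, rfl⟩)) (Submodule.mem_sup_right ?_)
          · simp only [pts_cons, List.nodup_cons, List.mem_cons, not_or]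
            refine ⟨⟨fun h => ?_, fun h => ?_⟩, by simpa using hw'L, hL2⟩
            · simp [h] at hw'
            · simpa using hL3 w h
          · intro v hv
            simp only [pts_cons, List.mem_cons] at hv
            rcases hv with rfl | rfl | hv
            · exact hw
            · exact Finset.mem_of_mem_erase hw'
            · exact Finset.mem_of_mem_erase (hL3 v hv)
          · refine supp_mono ?_ (join_mem_supp (oct_mem_supp L))
            rintro _ ⟨f, ⟨n, hs⟩, -, rfl⟩
            refine Finset.insert_subset hw' fun v hv => hL3 v (hs.mem_pts hv)
      · rintro ψ ⟨hψ1, hψ2⟩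
        have := ihW hψ1 hψ2 (by rw [Finset.card_erase_of_mem hw]; omega)
        refine Submodule.span_mono ?_ this
        rintro _ ⟨L, ⟨h1, h2, h3⟩, rfl⟩
        exact ⟨L, ⟨h1, h2, fun v hv => Finset.mem_of_mem_erase (h3 v hv)⟩, rfl⟩

end Degree

/-! ### Weights of labels, and frames: types and labels of vertices -/

section Weight

variable {K A : Type*} [Fintype K] [AddCommGroup A] [DecidableEq A]

/-- The number of nonzero coordinates. -/
def wt (g : K → A) : ℕ := (univ.filter fun k => g k ≠ 0).card

@[simp] theorem wt_zero : wt (0 : K → A) = 0 := by simp [wt]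

theorem wt_le_of_support {g g' : K → A} (h : ∀ k, g k ≠ 0 → g' k ≠ 0) : wt g ≤ wt g' :=
  Finset.card_le_card fun k hk => by simpa using h k (by simpa using hk)

theorem wt_neg (g : K → A) : wt (-g) = wt g := by simp [wt]

theorem wt_add_le (g g' : K → A) : wt (g + g') ≤ wt g + wt g' := by
  classical
  refine (Finset.card_le_card ?_).trans (Finset.card_union_le _ _)
  intro k hk
  simp only [Finset.mem_filter, Finset.mem_univ, true_and, Pi.add_apply, Finset.mem_union] at hk ⊢
  by_contra h
  push Not at h
  exact hk (by rw [h.1, h.2, add_zero])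

theorem wt_sub_comm (g g' : K → A) : wt (g - g') = wt (g' - g) := by
  rw [← wt_neg, neg_sub]

theorem wt_le_update [DecidableEq K] (g : K → A) (k : K) (a : A) :
    wt g ≤ wt (Function.update g k a) + 1 := by
  refine (Finset.card_le_card (t := insert k (univ.filter fun j => Function.update g k a j ≠ 0))
    ?_).trans (Finset.card_insert_le _ _)
  intro j hj
  by_cases h : j = k
  · simp [h]
  · simpa [h] using hj

theorem wt_update_zero_le [DecidableEq K] (g : K → A) (k : K) : wt (Function.update g k 0) ≤ wt g := by
  refine wt_le_of_support fun j hj => ?_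
  by_cases h : j = k
  · simp [h] at hj
  · simpa [h] using hj

theorem wt_le_one [DecidableEq K] {g : K → A} {k : K} (h : ∀ j, j ≠ k → g j = 0) : wt g ≤ 1 := by
  refine (Finset.card_le_card (t := {k}) ?_).trans (by simp)
  intro j hj
  simp only [Finset.mem_filter, Finset.mem_univ, true_and] at hj
  by_contra hne
  exact hj (h j (by simpa using hne))

end Weight

/-- A partial parametrization of `V` by copies of the group `K → A`, together with a labelling of
all of `V`. -/
structure Frame (V : Type*) (c : ℕ) (K A : Type*) where
  vtx : Fin c → (K → A) → V
  typ : V → Option (Fin c)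
  lab : V → K → A
  typ_vtx : ∀ m g, typ (vtx m g) = some m
  lab_vtx : ∀ m g, lab (vtx m g) = g
  vtx_lab : ∀ m v, typ v = some m → vtx m (lab v) = v

namespace Frame

variable {V : Type*} [DecidableEq V] {c : ℕ} {K A : Type*} [AddCommGroup A]
  (F : Frame V c K A)

/-- The sum of the labels. -/
def slab (e : Finset V) : K → A := ∑ v ∈ e, F.lab v

theorem slab_apply (e : Finset V) (k : K) : F.slab e k = ∑ v ∈ e, F.lab v k := by
  simp [slab]

theorem slab_insert {e : Finset V} {v : V} (h : v ∉ e) : F.slab (insert v e) = F.lab v + F.slab e :=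
  Finset.sum_insert h

/-- The sum of the labels of the first entries. -/
def lsum (L : List (V × V)) : K → A := (L.map fun p => F.lab p.1).sum

@[simp] theorem lsum_nil : F.lsum [] = 0 := rfl

@[simp] theorem lsum_cons (p : V × V) (L : List (V × V)) : F.lsum (p :: L) = F.lab p.1 + F.lsum L := by
  simp [lsum]

theorem lsum_append (L L' : List (V × V)) : F.lsum (L ++ L') = F.lsum L + F.lsum L' := by
  simp [lsum]

/-- Each choice of a second entry instead of the first changes the label sum by a vector of weight
at most `d`, and there is one choice per pair. -/
theorem wt_slab_sub_lsum_le [Fintype K] [DecidableEq A] {L : List (V × V)} {d n : ℕ} {e : Finset V}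
    (hd : ∀ p ∈ L, wt (F.lab p.1 - F.lab p.2) ≤ d) (h : Sel L n e) :
    wt (F.slab e - F.lsum L) ≤ d * L.length := by
  induction h with
  | nil => simp [slab]
  | @left L n e a b _ ha ih =>
    rw [F.slab_insert ha, lsum_cons, add_sub_add_left_eq_sub]
    refine (ih fun p hp => hd p (by simp [hp])).trans ?_
    exact Nat.mul_le_mul_left _ (by simp)
  | @right L n e a b _ hb ih =>
    rw [F.slab_insert hb, lsum_cons, add_sub_add_comm]
    refine (wt_add_le _ _).trans ?_
    have h1 := ih fun p hp => hd p (by simp [hp])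
    have h2 := hd (a, b) (by simp)
    simp only [List.length_cons, mul_add, mul_one]
    rw [wt_sub_comm] at h2
    simp only at h2 ⊢
    omega

/-- All vertices have types in `Θ`, and these are different. -/
def Rain (Θ : Finset (Fin c)) (e : Finset V) : Prop :=
  ∀ v ∈ e, (∃ m ∈ Θ, F.typ v = some m) ∧ ∀ v' ∈ e, F.typ v' = F.typ v → v' = v

/-- Octahedra with typed vertices, with labels almost agreeing in pairs, and label sum close to `g`. -/
structure Loc [Fintype K] [DecidableEq A] (Θ : Finset (Fin c)) (ρ : ℕ) (g : K → A) (h : ℕ)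
    (L : List (V × V)) : Prop where
  length : L.length = ρ
  nodup : (pts L).Nodup
  typed : ∀ v ∈ pts L, ∃ m ∈ Θ, F.typ v = some m
  pair : L.Pairwise fun p p' => F.typ p.1 ≠ F.typ p'.1 ∧ F.typ p.1 ≠ F.typ p'.2 ∧
    F.typ p.2 ≠ F.typ p'.1 ∧ F.typ p.2 ≠ F.typ p'.2
  sum : wt (F.lsum L - g) ≤ h
  diff : ∀ p ∈ L, wt (F.lab p.1 - F.lab p.2) ≤ 1

theorem eq_vtx {v : V} {m : Fin c} {t : K → A} (h : F.typ v = some m) (ht : F.lab v = t) :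
    v = F.vtx m t := by
  rw [← ht, F.vtx_lab m v h]

theorem rain_of_sel {L : List (V × V)}
    (hL : L.Pairwise fun p p' => F.typ p.1 ≠ F.typ p'.1 ∧ F.typ p.1 ≠ F.typ p'.2 ∧
      F.typ p.2 ≠ F.typ p'.1 ∧ F.typ p.2 ≠ F.typ p'.2) {n : ℕ} {e : Finset V} (h : Sel L n e) :
    ∀ v ∈ e, ∀ v' ∈ e, F.typ v' = F.typ v → v' = v := by
  induction h with
  | nil => simp
  | @left L n e a b h ha ih =>
    rw [List.pairwise_cons] at hL
    have key : ∀ v ∈ e, F.typ v ≠ F.typ a := by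
      intro v hv hva
      obtain ⟨p, hp, hp'⟩ := Chain.mem_pts.1 (h.mem_pts hv)
      have := hL.1 p hp
      rcases hp' with rfl | rfl
      · exact this.1 hva.symm
      · exact this.2.1 hva.symm
    intro v hv v' hv' hvv
    rcases Finset.mem_insert.1 hv with rfl | hv2 <;> rcases Finset.mem_insert.1 hv' with rfl | hv2'
    · rfl
    · exact absurd hvv (key _ hv2')
    · exact absurd hvv.symm (key _ hv2)
    · exact ih hL.2 v hv2 v' hv2' hvv
  | @right L n e a b h hb ih =>
    rw [List.pairwise_cons] at hL
    have key : ∀ v ∈ e, F.typ v ≠ F.typ b := by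
      intro v hv hva
      obtain ⟨p, hp, hp'⟩ := Chain.mem_pts.1 (h.mem_pts hv)
      have := hL.1 p hp
      rcases hp' with rfl | rfl
      · exact this.2.2.1 hva.symm
      · exact this.2.2.2 hva.symm
    intro v hv v' hv' hvv
    rcases Finset.mem_insert.1 hv with rfl | hv2 <;> rcases Finset.mem_insert.1 hv' with rfl | hv2'
    · rfl
    · exact absurd hvv (key _ hv2')
    · exact absurd hvv.symm (key _ hv2)
    · exact ih hL.2 v hv2 v' hv2' hvv

end Frame

theorem supp_inf {V : Type*} {E E' : Set (Finset V)} {φ : Chain V} (h : φ ∈ supp E)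
    (h' : φ ∈ supp E') : φ ∈ supp {e | e ∈ E ∧ e ∈ E'} := by
  intro e he
  by_cases h1 : e ∈ E
  · exact h' e fun h2 => he ⟨h1, h2⟩
  · exact h e h1

/-! ### Null chains on transversals of types: local octahedra -/

namespace Frame

variable {V : Type*} [DecidableEq V] [Fintype V] {c : ℕ} {K A : Type*} [AddCommGroup A]
  [Fintype K] [DecidableEq K] [DecidableEq A] (F : Frame V c K A)

/-- Null chains on the transversals of the vertices with label `t`. -/
theorem mem_span_of_lab_eq {ρ h : ℕ} {Θ : Finset (Fin c)} {g t : K → A} {φ : Chain V}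
    (ht : ρ • t = g) (hφ : φ ∈ null ρ)
    (hE : φ ∈ supp {e | F.Rain Θ e ∧ ∀ v ∈ e, F.lab v = t}) :
    φ ∈ Submodule.span ℤ (oct '' {L | F.Loc Θ ρ g h L}) := by
  -- All vertices have the one label `t`, so a vertex is determined by its type. Every octahedron
  -- here has zero differences, label sum `ρ • t = g`, and distinct types throughout.
  have h1 := mem_span_oct (W := Θ.image fun m => F.vtx m t) hφ (by
    refine supp_mono ?_ hE
    rintro e ⟨he1, he2⟩ v hv
    obtain ⟨⟨m, hm, hvm⟩, -⟩ := he1 v hv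
    exact Finset.mem_image.2 ⟨m, hm, (F.eq_vtx hvm (he2 v hv)).symm⟩)
  refine Submodule.span_mono ?_ h1
  rintro _ ⟨L, ⟨hL1, hL2, hL3⟩, rfl⟩
  have hlab : ∀ v ∈ pts L, F.lab v = t := by
    intro v hv
    obtain ⟨m, -, rfl⟩ := Finset.mem_image.1 (hL3 v hv)
    exact F.lab_vtx m t
  have hm1 : ∀ p ∈ L, p.1 ∈ pts L := fun p hp => Chain.mem_pts.2 ⟨p, hp, by simp⟩
  have hm2 : ∀ p ∈ L, p.2 ∈ pts L := fun p hp => Chain.mem_pts.2 ⟨p, hp, by simp⟩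
  have htyp : ∀ v ∈ pts L, ∀ v' ∈ pts L, F.typ v = F.typ v' → v = v' := by
    intro v hv v' hv' hvv
    obtain ⟨m, -, rfl⟩ := Finset.mem_image.1 (hL3 v hv)
    obtain ⟨m', -, rfl⟩ := Finset.mem_image.1 (hL3 v' hv')
    rw [F.typ_vtx, F.typ_vtx, Option.some_inj] at hvv
    rw [hvv]
  refine ⟨L, ⟨hL1, hL2, ?_, ?_, ?_, ?_⟩, rfl⟩
  · intro v hv
    obtain ⟨m, hm, rfl⟩ := Finset.mem_image.1 (hL3 v hv)
    exact ⟨m, hm, F.typ_vtx m t⟩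
  · refine (List.nodup_flatMap.1 hL2).2.imp_of_mem ?_
    intro p p' hp hp' hd
    have hd' : ∀ x, x = p.1 ∨ x = p.2 → ∀ y, y = p'.1 ∨ y = p'.2 → x ≠ y := by
      rintro x hx y hy rfl
      exact hd (by simpa using hx) (by simpa using hy)
    refine ⟨fun h => ?_, fun h => ?_, fun h => ?_, fun h => ?_⟩
    · exact hd' _ (Or.inl rfl) _ (Or.inl rfl) (htyp _ (hm1 p hp) _ (hm1 p' hp') h)
    · exact hd' _ (Or.inl rfl) _ (Or.inr rfl) (htyp _ (hm1 p hp) _ (hm2 p' hp') h)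
    · exact hd' _ (Or.inr rfl) _ (Or.inl rfl) (htyp _ (hm2 p hp) _ (hm1 p' hp') h)
    · exact hd' _ (Or.inr rfl) _ (Or.inr rfl) (htyp _ (hm2 p hp) _ (hm2 p' hp') h)
  · have : F.lsum L = g := by
      rw [lsum, List.map_congr_left (g := fun _ => t) (fun p hp => hlab _ (hm1 p hp))]
      simp [hL1, ht]
    simp [this]
  · intro p hp
    simp [hlab _ (hm1 p hp), hlab _ (hm2 p hp)]

theorem Rain.erase {F : Frame V c K A} {Θ : Finset (Fin c)} {a : V} {f : Finset V} {m : Fin c}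
    (h : F.Rain Θ (insert a f)) (ha : a ∉ f) (hm : F.typ a = some m) : F.Rain (Θ.erase m) f := by
  intro v hv
  have hv' : v ∈ insert a f := by simp [hv]
  obtain ⟨⟨m', hm', hvm⟩, -⟩ := h v hv'
  refine ⟨⟨m', Finset.mem_erase.2 ⟨?_, hm'⟩, hvm⟩, fun v' hv2 => (h v hv').2 v' (by simp [hv2])⟩
  rintro rfl
  have := (h a (by simp)).2 v hv' (by rw [hvm, hm])
  exact ha (this ▸ hv)

/-- Null chains on typed transversals with label sum close to `g` are spanned by local octahedra. -/
theorem mem_span_loc {r : ℕ} (hdiv : ∀ n, 1 ≤ n → n ≤ r → ∀ a : A, ∃ t, n • t = a) (ρ : ℕ)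
    (hρ : ρ ≤ r) (Θ : Finset (Fin c)) (g : K → A) (h : ℕ) (φ : Chain V) (hφ : φ ∈ null ρ)
    (hE : φ ∈ supp {e | F.Rain Θ e ∧ wt (F.slab e - g) ≤ h}) :
    φ ∈ Submodule.span ℤ (oct '' {L | F.Loc Θ ρ g (h + ρ) L}) := by
  induction ρ generalizing Θ g h φ with
  | zero =>
    have h1 : φ = φ ∅ • oct [] := by
      ext e
      simp only [oct, octOn_nil, Pi.smul_apply, sing_apply, smul_eq_mul]
      by_cases he : e = ∅
      · simp [he]
      · rw [if_neg he, mul_zero]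
        exact hφ.1 e (by simpa using he)
    by_cases h0 : φ ∅ = 0
    · rw [h1, h0, zero_smul]
      exact Submodule.zero_mem _
    · have h2 : wt (F.slab ∅ - g) ≤ h := by
        by_contra hcon
        exact h0 (hE ∅ fun h' => hcon h'.2)
      rw [h1]
      refine Submodule.smul_mem _ _ (Submodule.subset_span ⟨[], ⟨rfl, by simp, by simp, by simp, ?_,
        by simp⟩, rfl⟩)
      simpa [slab] using h2
  | succ ρ ih =>
    -- `t` is the common label towards which all vertices are pushed: a set with all labels `t` has
    -- exactly the label sum `g`. This is where divisibility in `A` enters.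
    have hg : ∃ t : K → A, (ρ + 1) • t = g := by
      choose t ht using fun k => hdiv (ρ + 1) (by omega) hρ (g k)
      exact ⟨t, funext ht⟩
    obtain ⟨t, ht⟩ := hg
    have htk : ∀ k, (ρ + 1) • t k = g k := fun k => congrFun ht k
    set 𝓣 := Submodule.span ℤ (oct '' {L | F.Loc Θ (ρ + 1) g (h + (ρ + 1)) L}) with h𝓣
    have h𝓣n : 𝓣 ≤ null (ρ + 1) := by
      rw [h𝓣, Submodule.span_le]
      rintro _ ⟨L, hL, rfl⟩
      rw [← hL.length]
      exact oct_mem_null hL.nodup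
    -- Labels are corrected one coordinate at a time; `D` holds the coordinates in which they may
    -- still differ from `t`.
    have claim : ∀ (D : Finset K) (φ : Chain V), φ ∈ null (ρ + 1) →
        φ ∈ supp {e | F.Rain Θ e ∧ wt (F.slab e - g) ≤ h ∧ ∀ v ∈ e, ∀ k ∉ D, F.lab v k = t k} →
        φ ∈ 𝓣 := by
      intro D
      induction D using Finset.induction_on with
      | empty =>
        intro φ hφ hE
        refine F.mem_span_of_lab_eq ht hφ (supp_mono ?_ hE)
        rintro e ⟨h1, -, h2⟩
        exact ⟨h1, fun v hv => funext fun k => h2 v hv k (by simp)⟩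
      | insert k D hk ihD =>
        -- Within coordinate `k`, vertices are corrected one at a time; `Bad` holds those that may
        -- still be wrong. During this the `k`-th coordinate of the label sum is uncontrolled, so it
        -- is left out of the weight. At the end it is `(ρ + 1) • t k - g k = 0`, and the original
        -- bound `h` is recovered.
        set E : Finset V → Set (Finset V) := fun Bad => {e | F.Rain Θ e ∧
          (∀ v ∈ e, ∀ j ∉ insert k D, F.lab v j = t j) ∧
          wt (Function.update (F.slab e - g) k 0) ≤ h ∧ ∀ v ∈ e, F.lab v k = t k ∨ v ∈ Bad} with hEdef
        have inner : ∀ (Bad : Finset V) (φ : Chain V), φ ∈ null (ρ + 1) → φ ∈ supp (E Bad) →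
            φ ∈ 𝓣 := by
          intro Bad
          induction Bad using Finset.induction_on with
          | empty =>
            intro φ hφ hE
            refine ihD φ hφ (supp_mono ?_ (supp_inf hφ.1 hE))
            rintro e ⟨hc, h1, h2, h3, h4⟩
            have h4' : ∀ v ∈ e, F.lab v k = t k := fun v hv => by simpa using h4 v hv
            refine ⟨h1, ?_, ?_⟩
            · convert h3
              rw [eq_comm, Function.update_eq_self_iff]
              rw [Pi.sub_apply, slab_apply, Finset.sum_congr rfl h4', Finset.sum_const,
                show e.card = ρ + 1 from hc, htk, sub_self]
            · intro v hv j hj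
              by_cases hjk : j = k
              · rw [hjk, h4' v hv]
              · exact h2 v hv j (by simp [hjk, hj])
          | insert a Bad haB ihB =>
            intro φ hφ hE
            by_cases hgood : F.lab a k ≠ t k ∧ ∃ m ∈ Θ, F.typ a = some m
            · obtain ⟨hak, m, hm, ham⟩ := hgood
              -- The vertex of the same type as `a` with only coordinate `k` corrected, so the pair
              -- `(a, b)` differs in a single coordinate.
              set b := F.vtx m (Function.update (F.lab a) k (t k)) with hb
              have hbt : F.typ b = some m := F.typ_vtx _ _
              have hbl : F.lab b = Function.update (F.lab a) k (t k) := F.lab_vtx _ _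
              have hab : a ≠ b := by
                intro hab
                apply hak
                rw [hab, hbl]
                simp
              have hlinkE := link_mem_supp (σ := {a}) hE
              -- The `+ 1` pays for the coordinate `k` omitted from the weight. The bound `h + 1 +
              -- ρ` from the link is the `h + (ρ + 1)` needed here.
              have hlink := ih (by omega) (Θ.erase m) (g - F.lab a) (h + 1) (link {a} φ)
                (by simpa using link_mem_null (σ := {a}) hφ) (by
                  refine supp_mono ?_ hlinkE
                  rintro f ⟨hd, h1, h2, h3, h4⟩
                  rw [Finset.disjoint_singleton_left] at hd
                  change F.Rain Θ (insert a f) at h1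
                  change wt (Function.update (F.slab (insert a f) - g) k 0) ≤ h at h3
                  refine ⟨h1.erase hd ham, ?_⟩
                  rw [F.slab_insert hd] at h3
                  rw [sub_sub_eq_add_sub, add_comm]
                  exact (wt_le_update _ k 0).trans (by omega))
              refine mem_of_mem_sup_supp hφ h𝓣n le_rfl (E' := E Bad) ?_ fun ψ hψ => ihB ψ hψ.1 hψ.2
              refine mem_sup_supp_of_link hE 𝓣 {{a}} ?_ ?_
              · intro e he he'
                refine ⟨{a}, by simp, ?_, by simp⟩
                rw [Finset.singleton_subset_iff]
                by_contra hae
                refine he' ⟨he.1, he.2.1, he.2.2.1, fun v hv => ?_⟩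
                rcases he.2.2.2 v hv with h | h
                · exact Or.inl h
                · rcases Finset.mem_insert.1 h with rfl | h
                  · exact absurd hv hae
                  · exact Or.inr h
              · intro σ hσ
                rw [Finset.mem_singleton.1 hσ, Finset.toList_singleton]
                change join a (link {a} φ) ∈ 𝓣 ⊔ supp (E Bad)
                have : join a (link {a} φ) =
                    (join a - join b) (link {a} φ) + join b (link {a} φ) := by
                  simp
                rw [this]
                refine Submodule.add_mem _ (Submodule.mem_sup_left ?_)
                  (Submodule.mem_sup_right (supp_mono ?_ (join_mem_supp hlinkE)))
                · refine Submodule.span_le (p := 𝓣.comap (join a - join b)).2 ?_ hlink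
                  rintro _ ⟨L, hL, rfl⟩
                  change oct ((a, b) :: L) ∈ 𝓣
                  have hnt : ∀ v ∈ pts L, F.typ v ≠ some m := by
                    intro v hv hvm
                    obtain ⟨m', hm', h2⟩ := hL.typed v hv
                    rw [h2, Option.some_inj] at hvm
                    exact (Finset.mem_erase.1 hm').1 hvm
                  refine Submodule.subset_span ⟨_, ⟨by simp [hL.length], ?_, ?_, ?_, ?_, ?_⟩, rfl⟩
                  · simp only [pts_cons, List.nodup_cons, List.mem_cons, not_or]
                    exact ⟨⟨hab, fun h => hnt _ h ham⟩, fun h => hnt _ h hbt, hL.nodup⟩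
                  · intro v hv
                    simp only [pts_cons, List.mem_cons] at hv
                    rcases hv with rfl | rfl | hv
                    · exact ⟨m, hm, ham⟩
                    · exact ⟨m, hm, hbt⟩
                    · obtain ⟨m', hm', h2⟩ := hL.typed v hv
                      exact ⟨m', Finset.mem_of_mem_erase hm', h2⟩
                  · rw [List.pairwise_cons]
                    refine ⟨fun p hp => ?_, hL.pair⟩
                    have h1 := hnt p.1 (Chain.mem_pts.2 ⟨p, hp, by simp⟩)
                    have h2 := hnt p.2 (Chain.mem_pts.2 ⟨p, hp, by simp⟩)
                    simp only [ham, hbt]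
                    exact ⟨h1.symm, h2.symm, h1.symm, h2.symm⟩
                  · have := hL.sum
                    rw [sub_sub_eq_add_sub] at this
                    rw [lsum_cons, add_comm (F.lab _)]
                    exact this.trans (by omega)
                  · intro p hp
                    rcases List.mem_cons.1 hp with rfl | hp
                    · refine wt_le_one (k := k) fun j hj => ?_
                      simp [hbl, hj]
                    · exact hL.diff p hp
                · rintro _ ⟨f, ⟨hd, h1, h2, h3, h4⟩, hbf, rfl⟩
                  rw [Finset.disjoint_singleton_left] at hd
                  have hrw : {a} ∪ f = insert a f := rfl
                  rw [hrw] at h1 h2 h3 h4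
                  have hr := h1.erase hd ham
                  refine ⟨?_, ?_, ?_, ?_⟩
                  · have key : ∀ v ∈ f, F.typ v ≠ some m := by
                      intro v hv hvm
                      obtain ⟨⟨m', hm', hvm'⟩, -⟩ := hr v hv
                      rw [hvm', Option.some_inj] at hvm
                      exact (Finset.mem_erase.1 hm').1 hvm
                    intro v hv
                    rcases Finset.mem_insert.1 hv with rfl | hv
                    · refine ⟨⟨m, hm, hbt⟩, fun v' hv' hvv => ?_⟩
                      rcases Finset.mem_insert.1 hv' with rfl | hv'
                      · rfl
                      · exact absurd (hvv.trans hbt) (key v' hv')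
                    · obtain ⟨⟨m', hm', hvm'⟩, hu⟩ := hr v hv
                      refine ⟨⟨m', Finset.mem_of_mem_erase hm', hvm'⟩, fun v' hv' hvv => ?_⟩
                      rcases Finset.mem_insert.1 hv' with rfl | hv'
                      · exact absurd (hvv.symm.trans hbt) (key v hv)
                      · exact hu v' hv' hvv
                  · intro v hv j hj
                    rcases Finset.mem_insert.1 hv with rfl | hv
                    · have hjk : j ≠ k := fun h => hj (by simp [h])
                      rw [hbl, Function.update_of_ne hjk]
                      exact h2 a (by simp) j hj
                    · exact h2 v (by simp [hv]) j hj
                  · convert h3 using 2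
                    rw [F.slab_insert hd, F.slab_insert hbf, hbl]
                    ext j
                    by_cases hj : j = k
                    · simp [hj]
                    · simp [hj]
                  · intro v hv
                    rcases Finset.mem_insert.1 hv with rfl | hv
                    · left
                      simp [hbl]
                    · have hvf : v ∈ f := hv
                      rcases h4 v (by simp [hv]) with h | h
                      · exact Or.inl h
                      · rcases Finset.mem_insert.1 h with rfl | h
                        · exact absurd hvf hd
                        · exact Or.inr h
            · refine ihB φ hφ (supp_mono ?_ hE)
              rintro e ⟨h1, h2, h3, h4⟩
              refine ⟨h1, h2, h3, fun v hv => ?_⟩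
              rcases h4 v hv with h | h
              · exact Or.inl h
              · rcases Finset.mem_insert.1 h with rfl | h
                · left
                  by_contra hne
                  exact hgood ⟨hne, (h1 v hv).1⟩
                · exact Or.inr h
        intro φ hφ hE
        refine inner univ φ hφ (supp_mono ?_ hE)
        rintro e ⟨h1, h2, h3⟩
        exact ⟨h1, h3, (wt_update_zero_le _ _).trans h2, fun v _ => Or.inr (by simp)⟩
    refine claim univ φ hφ (supp_mono ?_ hE)
    rintro e ⟨h1, h2⟩
    exact ⟨h1, h2, fun v _ k hk => absurd (Finset.mem_univ k) hk⟩

end Frame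

theorem pts_map {V ι : Type*} (l : List ι) (a b : ι → V) (v : V) :
    v ∈ pts (l.map fun i => (a i, b i)) ↔ ∃ i ∈ l, v = a i ∨ v = b i := by
  simp [mem_pts]

theorem nodup_pts_map {V ι : Type*} {l : List ι} (hl : l.Nodup) {a b : ι → V}
    (ha : ∀ i ∈ l, ∀ j ∈ l, a i = a j → i = j) (hb : ∀ i ∈ l, ∀ j ∈ l, b i = b j → i = j)
    (hab : ∀ i ∈ l, ∀ j ∈ l, a i ≠ b j) : (pts (l.map fun i => (a i, b i))).Nodup := by
  induction l with
  | nil => simp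
  | cons i l ih =>
    rw [List.nodup_cons] at hl
    simp only [List.map_cons, pts_cons, List.nodup_cons, List.mem_cons, not_or, pts_map, not_exists,
      not_and]
    refine ⟨⟨hab i (by simp) i (by simp), fun j hj => ⟨fun h => ?_, hab i (by simp) j (by simp [hj])⟩⟩,
      fun j hj => ⟨(hab j (by simp [hj]) i (by simp)).symm, fun h => ?_⟩,
      ih hl.2 (fun i hi j hj => ha i (by simp [hi]) j (by simp [hj]))
        (fun i hi j hj => hb i (by simp [hi]) j (by simp [hj]))
        (fun i hi j hj => hab i (by simp [hi]) j (by simp [hj]))⟩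
    · exact hl.1 (ha i (by simp) j (by simp [hj]) h ▸ hj)
    · exact hl.1 (hb i (by simp) j (by simp [hj]) h ▸ hj)

/-! ### Arbitrary null chains: ambiguous vertices and weight reduction -/

namespace Frame

variable {V : Type*} [DecidableEq V] [Fintype V] {c : ℕ} {K A : Type*} [AddCommGroup A]
  [Fintype K] [DecidableEq K] [DecidableEq A] (F : Frame V c K A)

/-- Vertices with prescribed labels and new types. -/
theorem exists_fresh {ι : Type*} [DecidableEq ι] (s : Finset ι) (U : Finset V)
    (hc : s.card + U.card ≤ c) (h0 : 0 < c) :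
    ∃ m : ι → Fin c, (∀ i ∈ s, ∀ j ∈ s, m i = m j → i = j) ∧ ∀ i ∈ s, ∀ u ∈ U, F.typ u ≠ some (m i) := by
  classical
  set T : Finset (Fin c) := univ.filter fun m => ∀ u ∈ U, F.typ u ≠ some m with hT
  -- Each vertex of `U` blocks at most one type.
  have hTc : Tᶜ.card ≤ U.card := by
    rw [← Finset.card_image_of_injective Tᶜ (Option.some_injective _)]
    refine (Finset.card_le_card ?_).trans (Finset.card_image_le (s := U) (f := F.typ))
    intro x hx
    obtain ⟨m, hm, rfl⟩ := Finset.mem_image.1 hx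
    simpa [hT] using hm
  rw [Finset.card_compl, Fintype.card_fin] at hTc
  have : Fintype.card s ≤ Fintype.card T := by simp; omega
  obtain ⟨f⟩ := Function.Embedding.nonempty_of_card_le this
  refine ⟨fun i => if h : i ∈ s then f ⟨i, h⟩ else ⟨0, h0⟩, ?_, ?_⟩
  · intro i hi j hj h
    simp only [hi, hj, dif_pos] at h
    simpa using f.injective (Subtype.ext h)
  · intro i hi
    simp only [hi, dif_pos]
    have := (f ⟨i, hi⟩).2
    exact (Finset.mem_filter.1 this).2

/-- The vertices of `e` that are not typed, or not determined by their type. -/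
def amb (e : Finset V) : Finset V :=
  e.filter fun v => F.typ v = none ∨ ∃ v' ∈ e, v' ≠ v ∧ F.typ v' = F.typ v

theorem amb_subset (e : Finset V) : F.amb e ⊆ e := Finset.filter_subset _ _

/-- The witness for ambiguity, a second vertex of the same type, is itself ambiguous and therefore
also lies in `f`. It follows that among the sets that occur as ambiguous parts of maximal size, a
set `e` contains only its own. -/
theorem subset_amb {e f : Finset V} (h : F.amb e ⊆ f) : F.amb e ⊆ F.amb f := by
  intro v hv
  have hv' := Finset.mem_filter.1 hv
  refine Finset.mem_filter.2 ⟨h hv, hv'.2.imp_right ?_⟩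
  rintro ⟨v', h1, h2, h3⟩
  refine ⟨v', h (Finset.mem_filter.2 ⟨h1, Or.inr ⟨v, hv'.1, h2.symm, h3.symm⟩⟩), h2, h3⟩

theorem notMem_amb {e : Finset V} {v : V} (ht : F.typ v ≠ none)
    (hu : ∀ v' ∈ e, F.typ v' = F.typ v → v' = v) : v ∉ F.amb e := by
  intro h
  rcases (Finset.mem_filter.1 h).2 with h | ⟨v', h1, h2, h3⟩
  · exact ht h
  · exact h2 (hu v' h1 h3)

theorem typ_of_notMem_amb {e : Finset V} {v : V} (hv : v ∈ e) (h : v ∉ F.amb e) :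
    F.typ v ≠ none ∧ ∀ v' ∈ e, F.typ v' = F.typ v → v' = v := by
  refine ⟨fun h' => h (Finset.mem_filter.2 ⟨hv, Or.inl h'⟩), fun v' hv' hvv => ?_⟩
  by_contra hne
  exact h (Finset.mem_filter.2 ⟨hv, Or.inr ⟨v', hv', hne, hvv⟩⟩)

/-- Octahedra with labels almost agreeing in pairs, and small label sum. -/
structure Local (a ρ h : ℕ) (L : List (V × V)) : Prop where
  length : L.length = ρ
  nodup : (pts L).Nodup
  sum : wt (F.lsum L) ≤ h
  diff : ∀ p ∈ L, wt (F.lab p.1 - F.lab p.2) ≤ 1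
  typed : a < ρ → ∃ p ∈ L, F.typ p.1 ≠ none ∧ F.typ p.2 ≠ none

theorem span_oct_le_null {ρ : ℕ} {P : Set (List (V × V))}
    (h : ∀ L ∈ P, L.length = ρ ∧ (pts L).Nodup) : Submodule.span ℤ (oct '' P) ≤ null ρ := by
  rw [Submodule.span_le]
  rintro _ ⟨L, hL, rfl⟩
  rw [← (h L hL).1]
  exact oct_mem_null (h L hL).2

/-- Null chains with small label sums are spanned by local octahedra. -/
theorem mem_span_local {r : ℕ} (hdiv : ∀ n, 1 ≤ n → n ≤ r → ∀ a : A, ∃ t, n • t = a) {ρ : ℕ}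
    (hρ : ρ ≤ r) (hc : 4 * r < c) (a : ℕ) (ha : a ≤ ρ) (h : ℕ) (φ : Chain V) (hφ : φ ∈ null ρ)
    (hE : φ ∈ supp {e | (F.amb e).card ≤ a ∧ wt (F.slab e) ≤ h}) :
    φ ∈ Submodule.span ℤ (oct '' {L | F.Local a ρ (h + 2 * ρ * (a + 1)) L}) := by
  classical
  induction a generalizing h φ with
  | zero =>
    have := F.mem_span_loc hdiv ρ hρ univ 0 h φ hφ (by
      refine supp_mono ?_ hE
      rintro e ⟨h1, h2⟩
      have h1 : F.amb e = ∅ := by simpa using h1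
      refine ⟨fun v hv => ?_, by simpa using h2⟩
      obtain ⟨h3, h4⟩ := F.typ_of_notMem_amb hv (by simp [h1])
      obtain ⟨m, hm⟩ := Option.ne_none_iff_exists'.1 h3
      exact ⟨⟨m, by simp, hm⟩, h4⟩)
    refine Submodule.span_mono ?_ this
    rintro _ ⟨L, hL, rfl⟩
    refine ⟨L, ⟨hL.length, hL.nodup, ?_, hL.diff, fun h0 => ?_⟩, rfl⟩
    · have := hL.sum
      rw [sub_zero] at this
      refine this.trans ?_
      omega
    · obtain ⟨p, hp⟩ := List.exists_mem_of_length_pos (hL.length ▸ h0)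
      obtain ⟨m, -, hm⟩ := hL.typed p.1 (Chain.mem_pts.2 ⟨p, hp, by simp⟩)
      obtain ⟨m', -, hm'⟩ := hL.typed p.2 (Chain.mem_pts.2 ⟨p, hp, by simp⟩)
      exact ⟨p, hp, by simp [hm], by simp [hm']⟩
  | succ a ih =>
    set 𝓣 := Submodule.span ℤ (oct '' {L | F.Local (a + 1) ρ (h + 2 * ρ * (a + 1 + 1)) L}) with h𝓣
    set E : Set (Finset V) := {e | (F.amb e).card ≤ a + 1 ∧ wt (F.slab e) ≤ h} with hEdef
    set E' : Set (Finset V) := {e | (F.amb e).card ≤ a ∧ wt (F.slab e) ≤ h + 2 * ρ} with hE'def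
    refine mem_of_mem_sup_supp (𝓣 := 𝓣) hφ (span_oct_le_null fun L hL => ⟨hL.length, hL.nodup⟩) le_rfl
      (E' := E') ?_ ?_
    -- The chain is split according to the ambiguous parts `σ` of size `a + 1`. In the link of `σ`
    -- all sets are unambiguous, use types absent from `σ`, and have label sum near `-F.slab σ`, so
    -- `mem_span_loc` applies.
    · refine mem_sup_supp_of_link hE 𝓣
        (univ.filter fun σ => σ.card = a + 1 ∧ ∃ e ∈ E, F.amb e = σ) ?_ ?_
      · intro e he he'
        have h1 : (F.amb e).card = a + 1 := by
          refine le_antisymm he.1 ?_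
          by_contra hlt
          exact he' ⟨by omega, he.2.trans (by omega)⟩
        refine ⟨F.amb e, ?_, F.amb_subset e, ?_⟩
        · simp only [Finset.mem_filter, Finset.mem_univ, true_and]
          exact ⟨h1, e, he, rfl⟩
        · intro τ hτ hτe
          simp only [Finset.mem_filter, Finset.mem_univ, true_and] at hτ
          obtain ⟨h2, f, -, rfl⟩ := hτ
          exact Finset.eq_of_subset_of_card_le (F.subset_amb hτe) (by omega)
      · intro σ hσ
        simp only [Finset.mem_filter, Finset.mem_univ, true_and] at hσ
        obtain ⟨hσc, e', he', hσe⟩ := hσ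
        set Θ : Finset (Fin c) := univ.filter fun m => ∀ v ∈ σ, F.typ v ≠ some m with hΘ
        have hlink := F.mem_span_loc hdiv (ρ - σ.card) (by omega) Θ (-F.slab σ) h (link σ φ)
          (link_mem_null hφ) (by
            refine supp_mono ?_ (link_mem_supp hE)
            rintro f ⟨hd, h1, h2⟩
            have hs : F.amb (σ ∪ f) = σ := by
              refine (Finset.eq_of_subset_of_card_le ?_ (by omega)).symm
              rw [← hσe]
              exact F.subset_amb (by rw [hσe]; exact Finset.subset_union_left)
            refine ⟨fun v hv => ?_, ?_⟩
            · have hv' : v ∈ σ ∪ f := by simp [hv]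
              obtain ⟨h3, h4⟩ := F.typ_of_notMem_amb hv' (by
                rw [hs]
                exact fun h => Finset.disjoint_left.1 hd h hv)
              obtain ⟨m, hm⟩ := Option.ne_none_iff_exists'.1 h3
              refine ⟨⟨m, ?_, hm⟩, fun v' hv2 => h4 v' (by simp [hv2])⟩
              simp only [hΘ, Finset.mem_filter, Finset.mem_univ, true_and]
              intro w hw hwm
              have := h4 w (by simp [hw]) (hwm.trans hm.symm)
              subst this
              exact Finset.disjoint_left.1 hd hw hv
            · rw [sub_neg_eq_add, add_comm]
              rwa [slab, Finset.sum_union hd] at h2)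
        refine Submodule.span_le (p := (𝓣 ⊔ supp E').comap (joins σ.toList)).2 ?_ hlink
        rintro _ ⟨L, hL, rfl⟩
        change joins σ.toList (oct L) ∈ 𝓣 ⊔ supp E'
        have hnt : ∀ v ∈ pts L, ∀ w ∈ σ, F.typ w ≠ F.typ v := by
          intro v hv w hw h1
          obtain ⟨m, hm, h2⟩ := hL.typed v hv
          rw [hΘ, Finset.mem_filter] at hm
          exact hm.2 w hw (h1.trans h2)
        have hcardU : (σ ∪ (pts L).toFinset).card ≤ σ.card + 2 * (ρ - σ.card) := by
          refine (Finset.card_union_le _ _).trans ?_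
          have := List.toFinset_card_le (pts L)
          rw [length_pts, hL.length] at this
          omega
        obtain ⟨m, hm1, hm2⟩ := F.exists_fresh σ (σ ∪ (pts L).toFinset) (by omega) (by omega)
        -- A copy of `v` with the same label but a fresh type: replacing `v` by `y v` removes an
        -- ambiguity without changing any label.
        set y : V → V := fun v => F.vtx (m v) (F.lab v) with hy
        have hyt : ∀ v, F.typ (y v) = some (m v) := fun v => F.typ_vtx _ _
        have hyl : ∀ v, F.lab (y v) = F.lab v := fun v => F.lab_vtx _ _
        have hyσ : ∀ v ∈ σ, ∀ w ∈ σ, F.typ w ≠ F.typ (y v) := by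
          intro v hv w hw
          rw [hyt]
          exact hm2 v hv w (by simp [hw])
        have hyL : ∀ v ∈ σ, ∀ w ∈ pts L, F.typ w ≠ F.typ (y v) := by
          intro v hv w hw
          rw [hyt]
          exact hm2 v hv w (by simp [hw])
        have hyy : ∀ v ∈ σ, ∀ w ∈ σ, F.typ (y v) = F.typ (y w) → v = w := by
          intro v hv w hw h1
          rw [hyt, hyt, Option.some_inj] at h1
          exact hm1 v hv w hw h1
        set Lσ : List (V × V) := σ.toList.map fun v => (v, y v) with hLσ
        have hfst : Lσ.map Prod.fst = σ.toList := by
          rw [hLσ, List.map_map]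
          exact List.map_id _
        have hrw : joins σ.toList (oct L) =
            oct (Lσ ++ L) - (octOn Lσ (oct L) - joins (Lσ.map Prod.fst) (oct L)) := by
          rw [oct_append, hfst]
          abel
        have hσlen : Lσ.length = σ.card := by simp [hLσ]
        have hlsum : F.lsum Lσ = F.slab σ := by
          rw [lsum, hLσ, List.map_map, slab]
          exact Finset.sum_map_toList σ F.lab
        have hdiffσ : ∀ p ∈ Lσ, wt (F.lab p.1 - F.lab p.2) ≤ 0 := by
          intro p hp
          obtain ⟨v, -, rfl⟩ := List.mem_map.1 hp
          simp [hyl]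
        rw [hrw]
        refine Submodule.sub_mem _ (Submodule.mem_sup_left (Submodule.subset_span ⟨_, ?_, rfl⟩))
          (Submodule.mem_sup_right (supp_mono ?_ (octOn_sub_joins_mem_supp Lσ (oct_mem_supp L))))
        · refine ⟨by simp [hσlen, hL.length]; omega, ?_, ?_, ?_, ?_⟩
          · rw [pts_append]
            refine List.Nodup.append ?_ hL.nodup ?_
            · refine nodup_pts_map (Finset.nodup_toList σ) (fun i _ j _ h => h) ?_ ?_
              · intro i hi j hj h1
                exact hyy i (by simpa using hi) j (by simpa using hj) (by rw [h1])
              · intro i hi j hj h1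
                exact hyσ j (by simpa using hj) i (by simpa using hi) (by rw [← h1])
            · intro v hv hvL
              rw [hLσ, pts_map] at hv
              obtain ⟨w, hw, rfl | rfl⟩ := hv
              · exact hnt _ hvL _ (by simpa using hw) rfl
              · exact hyL w (by simpa using hw) _ hvL rfl
          · rw [lsum_append, hlsum, add_comm]
            have := hL.sum
            rw [sub_neg_eq_add] at this
            refine this.trans ?_
            have : ρ * 1 ≤ ρ * (a + 1 + 1) := Nat.mul_le_mul_left _ (by omega)
            rw [mul_assoc]
            omega
          · intro p hp
            rcases List.mem_append.1 hp with hp | hp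
            · exact (hdiffσ p hp).trans (by omega)
            · exact hL.diff p hp
          · intro hlt
            obtain ⟨p, hp⟩ := List.exists_mem_of_length_pos (l := L) (by rw [hL.length]; omega)
            obtain ⟨m, -, hm⟩ := hL.typed p.1 (Chain.mem_pts.2 ⟨p, hp, by simp⟩)
            obtain ⟨m', -, hm'⟩ := hL.typed p.2 (Chain.mem_pts.2 ⟨p, hp, by simp⟩)
            exact ⟨p, by simp [hp], by simp [hm], by simp [hm']⟩
        -- In the remaining terms at least one vertex of `σ` was replaced, so at most `a` vertices
        -- are ambiguous. Passing between the transversal of `L` and its first entries, and from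
        -- there to `-F.slab σ`, costs at most `ρ` in weight each, hence the loss of `2 * ρ` at each
        -- level of ambiguity.
        · rintro _ ⟨n, e₁, e₀, hs1, hn, ⟨n₀, hs0⟩, hd, rfl⟩
          obtain ⟨T, hT, hTn, he₁⟩ := hs1.exists_of_map (Finset.nodup_toList σ)
          rw [Finset.toList_toFinset] at hT he₁
          simp only [Finset.image_id'] at he₁
          have htyp0 : ∀ v ∈ e₀, F.typ v ≠ none := by
            intro v hv
            obtain ⟨m, -, hm⟩ := hL.typed v (hs0.mem_pts hv)
            simp [hm]
          constructor
          · have hsub : F.amb (e₁ ∪ e₀) ⊆ σ \ T := by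
              intro v hv
              have hve := F.amb_subset _ hv
              by_contra hvT
              rcases Finset.mem_union.1 hve with h1 | h1
              · rw [he₁, Finset.mem_union] at h1
                rcases h1 with h1 | h1
                · exact hvT h1
                · obtain ⟨w, hw, rfl⟩ := Finset.mem_image.1 h1
                  refine F.notMem_amb (by simp [hyt]) ?_ hv
                  intro v' hv' hvv
                  rcases Finset.mem_union.1 hv' with h2 | h2
                  · rw [he₁, Finset.mem_union] at h2
                    rcases h2 with h2 | h2
                    · exact absurd hvv (hyσ w (hT hw) v' (Finset.mem_sdiff.1 h2).1)
                    · obtain ⟨w', hw', rfl⟩ := Finset.mem_image.1 h2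
                      rw [hyy w' (hT hw') w (hT hw) hvv]
                  · exact absurd hvv (hyL w (hT hw) v' (hs0.mem_pts h2))
              · refine F.notMem_amb (htyp0 v h1) ?_ hv
                intro v' hv' hvv
                rcases Finset.mem_union.1 hv' with h2 | h2
                · rw [he₁, Finset.mem_union] at h2
                  rcases h2 with h2 | h2
                  · exact absurd hvv (hnt v (hs0.mem_pts h1) v' (Finset.mem_sdiff.1 h2).1)
                  · obtain ⟨w', hw', rfl⟩ := Finset.mem_image.1 h2
                    exact absurd hvv.symm (hyL w' (hT hw') v (hs0.mem_pts h1))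
                · exact F.rain_of_sel hL.pair hs0 v h1 v' h2 hvv
            have h1 := Finset.card_le_card hsub
            rw [Finset.card_sdiff_of_subset hT] at h1
            omega
          · have h1 := F.wt_slab_sub_lsum_le hdiffσ hs1
            have h2 := F.wt_slab_sub_lsum_le hL.diff hs0
            have h3 := hL.sum
            rw [hlsum] at h1
            rw [hL.length] at h2
            have h4 : F.slab (e₁ ∪ e₀) = (F.slab e₁ - F.slab σ) + (F.slab e₀ - F.lsum L) +
                (F.lsum L - -F.slab σ) := by
              rw [slab, Finset.sum_union hd]
              simp only [slab]
              abel
            rw [h4]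
            refine (wt_add_le _ _).trans ((Nat.add_le_add_right (wt_add_le _ _) _).trans ?_)
            omega
    · rintro ψ ⟨hψ1, hψ2⟩
      refine Submodule.span_mono (Set.image_mono ?_) (ih (by omega) (h + 2 * ρ) ψ hψ1 hψ2)
      intro L hL
      refine ⟨hL.length, hL.nodup, hL.sum.trans ?_, hL.diff, fun h => hL.typed (by omega)⟩
      ring_nf
      omega

/-- Octahedra replacing the vertices of a set by vertices with one label coordinate changed such that
the label sum vanishes at this coordinate. -/
structure Shift (Z : Set (K → A)) (a ρ : ℕ) (L : List (V × V)) : Prop where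
  length : L.length = ρ
  nodup : (pts L).Nodup
  sum : F.lsum L ∈ Z
  shift : ∀ p ∈ L, ∃ k, F.lab p.2 = F.lab p.1 - Pi.single k (F.lsum L k)
  typed : a < ρ → ∃ p ∈ L, F.typ p.1 ≠ none ∧ F.typ p.2 ≠ none

theorem wt_lt_of_zero {g g' : K → A} (h : ∀ k, g k ≠ 0 → g' k ≠ 0) {k : K} (hk : g k = 0)
    (hk' : g' k ≠ 0) : wt g < wt g' := by
  refine Finset.card_lt_card ⟨fun j hj => by simpa using h j (by simpa using hj), fun hss => ?_⟩
  have := hss (show k ∈ _ by simpa using hk')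
  simp [hk] at this

/-- Null chains are spanned by shifting octahedra and local octahedra. -/
theorem mem_span_shift {r : ℕ} (hdiv : ∀ n, 1 ≤ n → n ≤ r → ∀ a : A, ∃ t, n • t = a) {ρ : ℕ}
    (hρ : ρ ≤ r) (hc : 4 * r < c) {Z : Set (K → A)}
    (hZ : ∀ s ∈ Z, ∀ s', (∀ k, s' k = 0 ∨ s' k = s k) → s' ∈ Z) (a : ℕ) (ha : ρ ≤ a + 1)
    (ha' : a ≤ ρ)
    (φ : Chain V) (hφ : φ ∈ null ρ) (hE : φ ∈ supp {e | (F.amb e).card ≤ a ∧ F.slab e ∈ Z}) :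
    φ ∈ Submodule.span ℤ (oct '' {L | F.Shift Z a ρ L ∨ F.Local a ρ (ρ + 2 * ρ * (a + 1)) L}) := by
  classical
  set 𝓣 := Submodule.span ℤ
    (oct '' {L | F.Shift Z a ρ L ∨ F.Local a ρ (ρ + 2 * ρ * (a + 1)) L}) with h𝓣
  have h𝓣n : 𝓣 ≤ null ρ := span_oct_le_null fun L hL => by
    rcases hL with hL | hL
    exacts [⟨hL.length, hL.nodup⟩, ⟨hL.length, hL.nodup⟩]
  -- Induction on the excess of the label sum's weight over `ρ`; without excess, local octahedra
  -- suffice.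
  have claim : ∀ (n : ℕ) (φ : Chain V), φ ∈ null ρ →
      φ ∈ supp {e | (F.amb e).card ≤ a ∧ F.slab e ∈ Z ∧ wt (F.slab e) ≤ ρ + n} → φ ∈ 𝓣 := by
    intro n
    induction n with
    | zero =>
      intro φ hφ hE
      refine Submodule.span_mono (Set.image_mono fun L hL => Or.inr hL)
        (F.mem_span_local hdiv hρ hc a ha' ρ φ hφ (supp_mono ?_ hE))
      rintro e ⟨h1, -, h3⟩
      exact ⟨h1, h3⟩
    | succ n ih =>
      intro φ hφ hE
      refine mem_of_mem_sup_supp hφ h𝓣n le_rfl (E' := {e | (F.amb e).card ≤ a ∧ F.slab e ∈ Z ∧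
        wt (F.slab e) ≤ ρ + n}) ?_ fun ψ hψ => ih ψ hψ.1 hψ.2
      refine supp_le_sup_supp 𝓣 ?_ (supp_inf hφ.1 hE)
      rintro e ⟨hec, h1, h2, h3⟩
      replace hec : e.card = ρ := hec
      by_cases hle : wt (F.slab e) ≤ ρ + n
      · exact Submodule.mem_sup_right (sing_mem_supp ⟨h1, h2, hle⟩)
      -- The label sum has more than `ρ` nonzero coordinates, so each vertex of `e` can be given a
      -- private one.
      have hex : Fintype.card e ≤ Fintype.card {k // F.slab e k ≠ 0} := by
        rw [Fintype.card_coe, hec, Fintype.card_subtype]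
        change ρ ≤ wt (F.slab e)
        omega
      obtain ⟨f⟩ := Function.Embedding.nonempty_of_card_le hex
      have hK : Nonempty K := by
        by_contra hK
        rw [not_nonempty_iff] at hK
        have : wt (F.slab e) = 0 := by simp [wt]
        omega
      obtain ⟨k0⟩ := hK
      obtain ⟨k, hk⟩ : ∃ k : V → K, ∀ v (hv : v ∈ e), k v = f ⟨v, hv⟩ :=
        ⟨fun v => if h : v ∈ e then f ⟨v, h⟩ else k0, fun v hv => by simp [hv]⟩
      have hk0 : ∀ v ∈ e, F.slab e (k v) ≠ 0 := fun v hv => by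
        rw [hk v hv]
        exact (f ⟨v, hv⟩).2
      have hkinj : ∀ v ∈ e, ∀ w ∈ e, k v = k w → v = w := by
        intro v hv w hw h
        rw [hk v hv, hk w hw] at h
        simpa using f.injective (Subtype.ext h)
      obtain ⟨m, hm1, hm2⟩ := F.exists_fresh e e (by omega) (by omega)
      -- Replacing the vertices of a nonempty `T` by these makes the label sum vanish at their
      -- private coordinates and changes it nowhere else. So the weight drops, and membership in `Z`
      -- persists because `Z` is closed under setting coordinates to zero.
      set z : V → V := fun v => F.vtx (m v) (F.lab v - Pi.single (k v) (F.slab e (k v))) with hz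
      have hzt : ∀ v, F.typ (z v) = some (m v) := fun v => F.typ_vtx _ _
      have hzl : ∀ v, F.lab (z v) = F.lab v - Pi.single (k v) (F.slab e (k v)) :=
        fun v => F.lab_vtx _ _
      have hze : ∀ v ∈ e, ∀ w ∈ e, F.typ w ≠ F.typ (z v) := by
        intro v hv w hw
        rw [hzt]
        exact hm2 v hv w hw
      have hzz : ∀ v ∈ e, ∀ w ∈ e, F.typ (z v) = F.typ (z w) → v = w := by
        intro v hv w hw h1
        rw [hzt, hzt, Option.some_inj] at h1
        exact hm1 v hv w hw h1
      set L : List (V × V) := e.toList.map fun v => (v, z v) with hL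
      have hfst : L.map Prod.fst = e.toList := by
        rw [hL, List.map_map]
        exact List.map_id _
      have hlsum : F.lsum L = F.slab e := by
        rw [lsum, hL, List.map_map, slab]
        exact Finset.sum_map_toList e F.lab
      have hnd : (L.map Prod.fst).Nodup := by
        rw [hfst]
        exact Finset.nodup_toList e
      have hrw : sing e = oct L - (oct L - sing (L.map Prod.fst).toFinset) := by
        rw [hfst, Finset.toList_toFinset]
        abel
      rw [hrw]
      refine Submodule.sub_mem _ (Submodule.mem_sup_left (Submodule.subset_span ⟨L, Or.inl ?_, rfl⟩))
        (Submodule.mem_sup_right (supp_mono ?_ (oct_sub_sing_mem_supp hnd)))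
      · refine ⟨by simp [hL, hec], ?_, hlsum ▸ h2, ?_, ?_⟩
        · refine nodup_pts_map (Finset.nodup_toList e) (fun i _ j _ h => h) ?_ ?_
          · intro i hi j hj h1
            exact hzz i (by simpa using hi) j (by simpa using hj) (by rw [h1])
          · intro i hi j hj h1
            exact hze j (by simpa using hj) i (by simpa using hi) (by rw [← h1])
        · intro p hp
          obtain ⟨v, hv, rfl⟩ := List.mem_map.1 hp
          exact ⟨k v, by rw [hlsum]; exact hzl v⟩
        · intro hlt
          -- An unambiguous vertex is typed, and so is its replacement. Such a pair later forces
          -- every transversal to meet `Y`.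
          obtain ⟨v, hv, hva⟩ : ∃ v ∈ e, v ∉ F.amb e := by
            by_contra hcon
            push Not at hcon
            have := Finset.card_le_card (show e ⊆ F.amb e from hcon)
            omega
          exact ⟨(v, z v), List.mem_map.2 ⟨v, by simpa using hv, rfl⟩,
            (F.typ_of_notMem_amb hv hva).1, by simp [hzt]⟩
      · rintro e' ⟨n', hs, hn'⟩
        obtain ⟨T, hT, hTn, he'⟩ := hs.exists_of_map (Finset.nodup_toList e)
        rw [Finset.toList_toFinset] at hT he'
        simp only [Finset.image_id'] at he'
        obtain ⟨t, ht⟩ : T.Nonempty := Finset.card_pos.1 (by omega)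
        have hdisj : Disjoint (e \ T) (T.image z) := by
          rw [Finset.disjoint_left]
          intro v hv hv'
          obtain ⟨w, hw, rfl⟩ := Finset.mem_image.1 hv'
          exact hze w (hT hw) _ (Finset.mem_sdiff.1 hv).1 rfl
        have hinj : Set.InjOn z T := by
          intro v hv w hw h
          exact hzz v (hT hv) w (hT hw) (by rw [h])
        have hslab : ∀ j, F.slab e' j = 0 ∨ F.slab e' j = F.slab e j := by
          intro j
          have h5 : F.slab e' j = F.slab e j - ∑ v ∈ T, (Pi.single (k v) (F.slab e (k v)) : K → A) j := by
            rw [he', slab_apply, Finset.sum_union hdisj, Finset.sum_image hinj, slab_apply,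
              ← Finset.sum_sdiff hT]
            simp only [hzl, Pi.sub_apply, Finset.sum_sub_distrib]
            abel
          rw [h5]
          by_cases hj : ∃ v ∈ T, k v = j
          · obtain ⟨v, hv, rfl⟩ := hj
            left
            rw [Finset.sum_eq_single v]
            · simp
            · intro w hw hne
              rw [Pi.single_eq_of_ne]
              exact fun h => hne (hkinj v (hT hv) w (hT hw) h).symm
            · exact fun h => absurd hv h
          · right
            push Not at hj
            rw [Finset.sum_eq_zero, sub_zero]
            intro v hv
            rw [Pi.single_eq_of_ne (hj v hv).symm]
        have hslab0 : F.slab e' (k t) = 0 := by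
          rw [he', slab_apply, Finset.sum_union hdisj, Finset.sum_image hinj]
          simp only [hzl, Pi.sub_apply, Finset.sum_sub_distrib]
          rw [Finset.sum_eq_single (f := fun v => (Pi.single (k v) (F.slab e (k v)) : K → A) (k t)) t,
            Pi.single_eq_same, slab_apply, ← Finset.sum_sdiff hT]
          · abel
          · intro w hw hne
            rw [Pi.single_eq_of_ne]
            exact fun h => hne (hkinj t (hT ht) w (hT hw) h).symm
          · exact fun h => absurd ht h
        refine ⟨?_, hZ _ h2 _ hslab, ?_⟩
        · have hz' : z t ∈ e' := by
            rw [he']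
            exact Finset.mem_union_right _ (Finset.mem_image_of_mem z ht)
          have hcard : e'.card = ρ := by
            rw [hs.card, hL]
            simp [hec]
          have hna : z t ∉ F.amb e' := by
            refine F.notMem_amb (by simp [hzt]) ?_
            intro v' hv' hvv
            rw [he', Finset.mem_union] at hv'
            rcases hv' with hv' | hv'
            · exact absurd hvv (hze t (hT ht) v' (Finset.mem_sdiff.1 hv').1)
            · obtain ⟨w, hw, rfl⟩ := Finset.mem_image.1 hv'
              rw [hzz w (hT hw) t (hT ht) hvv]
          have h7 : (F.amb e').card < e'.card := Finset.card_lt_card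
            ⟨F.amb_subset e', fun h => hna (h hz')⟩
          omega
        · have : wt (F.slab e') < wt (F.slab e) := wt_lt_of_zero (k := k t) (fun j hj => by
            rcases hslab j with h | h
            · exact absurd h hj
            · rwa [← h]) hslab0 (hk0 t (hT ht))
          omega
  refine claim (Fintype.card K) φ hφ (supp_mono ?_ hE)
  rintro e ⟨h1, h2⟩
  refine ⟨h1, h2, (Finset.card_le_univ _).trans (by omega)⟩

end Frame

/-! ### Random choices by exponential moments -/

open scoped Classical in
/-- If the expected number of events is small for each test `S`, then the choices can be made such
that few events occur for each test. -/
theorem exists_choice {ι Ω σ : Type*} [Fintype ι] [Fintype Ω] [Nonempty Ω] (𝒮 : Finset σ)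
    (E : ι → Ω → σ → Prop) (L D : ℕ)
    (h : ∀ S ∈ 𝒮, ∑ i, (univ.filter fun ω => E i ω S).card ≤ L * Fintype.card Ω)
    (hD : Real.log 𝒮.card ≤ D) :
    ∃ f : ι → Ω, ∀ S ∈ 𝒮, (univ.filter fun i => E i (f i) S).card ≤ 2 * (L + D) := by
  rcases 𝒮.eq_empty_or_nonempty with rfl | hne
  · exact ⟨fun _ => Classical.arbitrary Ω, by simp⟩
  have hΩ : (0 : ℝ) < Fintype.card Ω := by exact_mod_cast Fintype.card_pos
  -- The product is 2 to the number of events for `S`. It factors over the independent choices, and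
  -- each factor 1 + p is at most exp p, so its mean is at most exp `L`. A choice with at most
  -- average total satisfies `2 ^ count ≤ 𝒮.card * exp L` for every test; the final factor 2 comes
  -- from log 2 > 1/2.
  have h1 : ∑ f : ι → Ω, ∑ S ∈ 𝒮, ∏ i, (if E i (f i) S then (2 : ℝ) else 1) ≤
      ∑ f : ι → Ω, (𝒮.card : ℝ) * Real.exp L := by
    rw [Finset.sum_comm]
    have h2 : ∀ S ∈ 𝒮, ∑ f : ι → Ω, ∏ i, (if E i (f i) S then (2 : ℝ) else 1) ≤
        (Fintype.card Ω : ℝ) ^ Fintype.card ι * Real.exp L := by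
      intro S hS
      have h3 := Finset.prod_univ_sum (fun _ : ι => (univ : Finset Ω))
        (fun i ω => if E i ω S then (2 : ℝ) else 1)
      rw [Fintype.piFinset_univ] at h3
      rw [← h3]
      have h4 : ∀ i, ∑ ω, (if E i ω S then (2 : ℝ) else 1) ≤ Fintype.card Ω *
          Real.exp ((univ.filter fun ω => E i ω S).card / Fintype.card Ω) := by
        intro i
        have h5 : ∑ ω, (if E i ω S then (2 : ℝ) else 1) =
            Fintype.card Ω + (univ.filter fun ω => E i ω S).card := by
          have : ∀ ω, (if E i ω S then (2 : ℝ) else 1) = 1 + if E i ω S then 1 else 0 := by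
            intro ω
            split_ifs <;> norm_num
          simp only [this, Finset.sum_add_distrib, Finset.sum_const, Finset.card_univ, nsmul_eq_mul,
            mul_one, Finset.sum_boole]
        rw [h5]
        have := Real.add_one_le_exp ((univ.filter fun ω => E i ω S).card / Fintype.card Ω : ℝ)
        calc (Fintype.card Ω : ℝ) + (univ.filter fun ω => E i ω S).card
            = Fintype.card Ω * ((univ.filter fun ω => E i ω S).card / Fintype.card Ω + 1) := by
              field_simp
              ring
          _ ≤ _ := by gcongr
      refine (Finset.prod_le_prod (fun i _ => Finset.sum_nonneg fun ω _ => by split_ifs <;> norm_num)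
        fun i _ => h4 i).trans ?_
      rw [Finset.prod_mul_distrib, Finset.prod_const, Finset.card_univ, ← Real.exp_sum]
      gcongr
      rw [← Finset.sum_div, div_le_iff₀ hΩ]
      exact_mod_cast h S hS
    refine (Finset.sum_le_sum h2).trans (le_of_eq ?_)
    simp only [Finset.sum_const, Finset.card_univ, Fintype.card_fun, nsmul_eq_mul]
    push_cast
    ring
  obtain ⟨f, -, hf⟩ := Finset.exists_le_of_sum_le Finset.univ_nonempty h1
  refine ⟨f, fun S hS => ?_⟩
  have h6 : (2 : ℝ) ^ (univ.filter fun i => E i (f i) S).card ≤ 𝒮.card * Real.exp L := by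
    refine le_trans (le_of_eq ?_) ((Finset.single_le_sum (f := fun S => ∏ i, (if E i (f i) S then (2 : ℝ)
      else 1)) (fun S _ => Finset.prod_nonneg fun i _ => by split_ifs <;> norm_num) hS).trans hf)
    rw [Finset.prod_ite]
    simp
  have hcard : (0 : ℝ) < 𝒮.card := by exact_mod_cast hne.card_pos
  have h7 := Real.log_le_log (by positivity) h6
  rw [Real.log_pow, Real.log_mul hcard.ne' (Real.exp_ne_zero _), Real.log_exp] at h7
  have h8 : (1 : ℝ) / 2 < Real.log 2 := by
    have := Real.log_two_gt_d9
    linarith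
  have h9 : ((univ.filter fun i => E i (f i) S).card : ℝ) ≤ 2 * (L + D) := by
    have : ((univ.filter fun i => E i (f i) S).card : ℝ) * (1 / 2) ≤
        (univ.filter fun i => E i (f i) S).card * Real.log 2 := by gcongr
    linarith
  exact_mod_cast h9

/-! ### Counting sets and transversals through given vertices -/

section Count

variable {V : Type*} [DecidableEq V] [Fintype V]

-- `S` is enlarged inside `W i` one vertex at a time up to size `k`; each enlargement costs a factor
-- `Fintype.card V`.
open scoped Classical in
theorem card_superset_le {ι : Type*} (s : Finset ι) (W : ι → Finset V) {k D : ℕ}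
    (hW : ∀ i ∈ s, k ≤ (W i).card)
    (hD : ∀ S : Finset V, S.card = k → (s.filter fun i => S ⊆ W i).card ≤ D) (j : ℕ) (S : Finset V)
    (hS : S.card + j = k) :
    (s.filter fun i => S ⊆ W i).card ≤ Fintype.card V ^ j * D := by
  induction j generalizing S with
  | zero => simpa using hD S (by simpa using hS)
  | succ j ih =>
    have h1 : (s.filter fun i => S ⊆ W i) ⊆
        Sᶜ.biUnion fun v => s.filter fun i => insert v S ⊆ W i := by
      intro i hi
      rw [Finset.mem_filter] at hi
      have hlt : S.card < (W i).card := by have := hW i hi.1; omega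
      obtain ⟨v, hv, hvS⟩ := Finset.exists_mem_notMem_of_card_lt_card hlt
      simp only [Finset.mem_biUnion, Finset.mem_compl, Finset.mem_filter]
      exact ⟨v, hvS, hi.1, Finset.insert_subset hv hi.2⟩
    refine (Finset.card_le_card h1).trans (Finset.card_biUnion_le.trans ?_)
    refine (Finset.sum_le_card_nsmul _ _ (Fintype.card V ^ j * D) fun v hv => ?_).trans ?_
    · refine ih _ ?_
      rw [Finset.card_insert_of_notMem (by simpa using hv)]
      omega
    · rw [smul_eq_mul, pow_succ', mul_assoc]
      exact Nat.mul_le_mul_right _ (Finset.card_le_univ Sᶜ)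

open scoped Classical in
theorem card_pi_agree {κ G : Type*} [Fintype κ] [DecidableEq κ] [Fintype G] (I : Finset κ) (t : κ → G) :
    (univ.filter fun ω : κ → G => ∀ i ∈ I, ω i = t i).card * Fintype.card G ^ I.card =
      Fintype.card G ^ Fintype.card κ := by
  have h1 : (univ.filter fun ω : κ → G => ∀ i ∈ I, ω i = t i) =
      Fintype.piFinset fun i => if i ∈ I then {t i} else univ := by
    ext ω
    simp only [Finset.mem_filter, Finset.mem_univ, true_and, Fintype.mem_piFinset]
    refine forall_congr' fun i => ?_
    by_cases hi : i ∈ I <;> simp [hi]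
  have h2 : ∀ i, (if i ∈ I then ({t i} : Finset G) else univ).card =
      if i ∈ I then 1 else Fintype.card G := by
    intro i
    split_ifs <;> simp
  rw [h1, Fintype.card_piFinset]
  simp only [h2]
  have h3 := Finset.card_filter_add_card_filter_not (s := (univ : Finset κ)) (fun i => i ∈ I)
  rw [Finset.filter_mem_eq_inter, Finset.univ_inter, Finset.card_univ] at h3
  rw [Finset.prod_ite, Finset.prod_const, Finset.prod_const, one_pow, one_mul, ← pow_add, ← h3,
    add_comm]

-- Union bound over the maps telling which index covers each vertex of `U`. Any realizable map is
-- injective, and it fixes one value of `ω` per vertex because each `z i` is injective.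
open scoped Classical in
theorem card_cover_le {κ G : Type*} [Fintype κ] [DecidableEq κ] [Fintype G] (z : κ → G → V)
    (hz : ∀ i, Function.Injective (z i)) (U : Finset V) :
    (univ.filter fun ω : κ → G => U ⊆ univ.image fun i => z i (ω i)).card * Fintype.card G ^ U.card ≤
      Fintype.card κ ^ U.card * Fintype.card G ^ Fintype.card κ := by
  have h1 : (univ.filter fun ω : κ → G => U ⊆ univ.image fun i => z i (ω i)) ⊆
      (univ : Finset (U → κ)).biUnion fun g => univ.filter fun ω => ∀ u : U, z (g u) (ω (g u)) = u := by
    intro ω hω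
    simp only [Finset.mem_filter, Finset.mem_univ, true_and, Finset.mem_biUnion] at hω ⊢
    have : ∀ u : U, ∃ i, z i (ω i) = u := by
      intro u
      simpa using hω u.2
    choose g hg using this
    exact ⟨g, hg⟩
  refine (Nat.mul_le_mul_right _ ((Finset.card_le_card h1).trans Finset.card_biUnion_le)).trans ?_
  rw [Finset.sum_mul]
  refine (Finset.sum_le_card_nsmul _ _ (Fintype.card G ^ Fintype.card κ) fun g _ => ?_).trans ?_
  · rcases (univ.filter fun ω : κ → G => ∀ u : U, z (g u) (ω (g u)) = u).eq_empty_or_nonempty with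
      h | ⟨ω₀, h₀⟩
    · rw [h, Finset.card_empty, zero_mul]
      exact Nat.zero_le _
    simp only [Finset.mem_filter, Finset.mem_univ, true_and] at h₀
    have hg : Function.Injective g := by
      intro u u' huu
      apply Subtype.ext
      rw [← h₀ u, ← h₀ u', huu]
    rw [← card_pi_agree (univ.image g) ω₀, Finset.card_image_of_injective _ hg, Finset.card_univ,
      Fintype.card_coe]
    refine Nat.mul_le_mul_right _ (Finset.card_le_card ?_)
    intro ω hω
    simp only [Finset.mem_filter, Finset.mem_univ, true_and] at hω ⊢
    intro i hi
    obtain ⟨u, -, rfl⟩ := Finset.mem_image.1 hi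
    exact hz _ ((hω u).trans (h₀ u).symm)
  · simp

open scoped Classical in
/-- The expected number of sets containing `S`, if vertices with random labels are added to the sets
of a family. -/
theorem sum_card_cover_le {ι κ G : Type*} [Fintype ι] [Fintype κ] [DecidableEq κ] [Fintype G] [Nonempty G]
    (x : ι → Finset V) (z : ι → κ → G → V) (hz : ∀ i l, Function.Injective (z i l)) {k s D C : ℕ}
    (hC : Fintype.card V ≤ C * Fintype.card G) (hx : ∀ i, k ≤ (x i).card) (hks : k ≤ s)
    (hk : ∀ i, k = s ∨ (x i).card ≤ k)
    (hD : ∀ S : Finset V, S.card = k → (univ.filter fun i => S ⊆ x i).card ≤ D) (S : Finset V)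
    (hS : S.card = s) :
    ∑ i, (univ.filter fun ω : κ → G => S ⊆ x i ∪ univ.image fun l => z i l (ω l)).card ≤
      (2 ^ s * (Fintype.card κ + 1) ^ s * (C + 1) ^ k * D) * Fintype.card (κ → G) := by
  have hG : 0 < Fintype.card G := Fintype.card_pos
  have h1 : ∀ i, (univ.filter fun ω : κ → G => S ⊆ x i ∪ univ.image fun l => z i l (ω l)).card ≤
      ∑ S₁ ∈ S.powerset, if S₁ ⊆ x i then (univ.filter fun ω : κ → G =>
        S \ S₁ ⊆ univ.image fun l => z i l (ω l)).card else 0 := by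
    intro i
    rw [← Finset.sum_filter]
    refine (Finset.card_le_card ?_).trans Finset.card_biUnion_le
    intro ω hω
    simp only [Finset.mem_filter, Finset.mem_univ, true_and, Finset.mem_biUnion,
      Finset.mem_powerset] at hω ⊢
    refine ⟨S ∩ x i, ⟨Finset.inter_subset_left, Finset.inter_subset_right⟩, ?_⟩
    intro v hv
    simp only [Finset.mem_sdiff, Finset.mem_inter, not_and] at hv
    exact (Finset.mem_union.1 (hω hv.1)).resolve_left (hv.2 hv.1)
  refine (Finset.sum_le_sum fun i _ => h1 i).trans ?_
  rw [Finset.sum_comm]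
  refine (Finset.sum_le_card_nsmul _ _ ((Fintype.card κ + 1) ^ s * (C + 1) ^ k * D *
    Fintype.card (κ → G)) fun S₁ hS₁ => ?_).trans (le_of_eq ?_)
  · rw [Finset.mem_powerset] at hS₁
    by_cases hS₁k : k < S₁.card
    · rw [Finset.sum_eq_zero]
      · exact Nat.zero_le _
      · intro i _
        rw [if_neg]
        intro h
        have h2 := Finset.card_le_card h
        have h3 := Finset.card_le_card hS₁
        rcases hk i with h4 | h4 <;> omega
    push Not at hS₁k
    obtain ⟨j, hj⟩ := Nat.exists_eq_add_of_le hS₁k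
    set u := (S \ S₁).card with hu
    have hu' : u = s - S₁.card := by rw [hu, Finset.card_sdiff_of_subset hS₁, hS]
    have hus : u ≤ s := by omega
    -- Here `S₁` is the part of `S` inside `x i`. Extending `S₁` to a `k`-set costs `Fintype.card V
    -- ^ j`, while covering the other `u` vertices at random saves `Fintype.card G ^ u`. As
    -- `Fintype.card V ≤ C * Fintype.card G`, the inequality `j ≤ u` makes the balance bounded.
    have hju : j ≤ u := by omega
    refine Nat.le_of_mul_le_mul_right (c := Fintype.card G ^ u) ?_ (pow_pos hG _)
    rw [Finset.sum_mul]
    have h2 : ∀ i, (if S₁ ⊆ x i then (univ.filter fun ω : κ → G =>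
        S \ S₁ ⊆ univ.image fun l => z i l (ω l)).card else 0) * Fintype.card G ^ u ≤
        if S₁ ⊆ x i then Fintype.card κ ^ u * Fintype.card G ^ Fintype.card κ else 0 := by
      intro i
      split_ifs
      · exact card_cover_le (z i) (hz i) _
      · simp
    refine (Finset.sum_le_sum fun i _ => h2 i).trans ?_
    rw [← Finset.sum_filter, Finset.sum_const, smul_eq_mul]
    have h3 := card_superset_le univ x (fun i _ => hx i) hD j S₁ (by omega)
    have hjk : j ≤ k := by omega
    calc (univ.filter fun i => S₁ ⊆ x i).card * (Fintype.card κ ^ u * Fintype.card G ^ Fintype.card κ)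
        ≤ ((C * Fintype.card G) ^ j * D) *
          ((Fintype.card κ + 1) ^ s * Fintype.card G ^ Fintype.card κ) := by
          have h4 : Fintype.card κ ^ u ≤ (Fintype.card κ + 1) ^ s :=
            (Nat.pow_le_pow_left (Nat.le_succ _) _).trans (Nat.pow_le_pow_right (by omega) hus)
          have h5 : (univ.filter fun i => S₁ ⊆ x i).card ≤ (C * Fintype.card G) ^ j * D :=
            h3.trans (Nat.mul_le_mul_right _ (Nat.pow_le_pow_left hC _))
          exact Nat.mul_le_mul h5 (Nat.mul_le_mul_right _ h4)
      _ ≤ ((C + 1) ^ k * Fintype.card G ^ u * D) *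
          ((Fintype.card κ + 1) ^ s * Fintype.card G ^ Fintype.card κ) := by
          have h4 : C ^ j ≤ (C + 1) ^ k :=
            (Nat.pow_le_pow_left (Nat.le_succ _) _).trans (Nat.pow_le_pow_right (by omega) hjk)
          rw [mul_pow]
          exact Nat.mul_le_mul_right _ (Nat.mul_le_mul_right _
            (Nat.mul_le_mul h4 (Nat.pow_le_pow_right hG hju)))
      _ = _ := by
          rw [Fintype.card_fun]
          ring
  · rw [Finset.card_powerset, hS, smul_eq_mul]
    ring

/-- The transversal of the pairs `p i` given by the second entries at the positions in `T`. -/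
def sel {ρ : ℕ} (p : Fin ρ → V × V) (T : Finset (Fin ρ)) (i : Fin ρ) : V :=
  if i ∈ T then (p i).2 else (p i).1

/-- The number of transversals containing `S`. -/
def load {ρ : ℕ} (P : Finset (Fin ρ → V × V)) (S : Finset V) : ℕ :=
  ((P ×ˢ univ).filter fun x : (Fin ρ → V × V) × Finset (Fin ρ) => S ⊆ univ.image (sel x.1 x.2)).card

-- Union bound over the transversal `T` and the positions `g` at which it meets the vertices of `S`;
-- only injective `g` are realizable.
open scoped Classical in
theorem load_le {ρ : ℕ} (P : Finset (Fin ρ → V × V)) (S : Finset V) (B : ℕ)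
    (h : ∀ (T : Finset (Fin ρ)) (g : S → Fin ρ), Function.Injective g →
      (P.filter fun p => ∀ u : S, sel p T (g u) = (u : V)).card ≤ B) :
    load P S ≤ 2 ^ ρ * ρ ^ S.card * B := by
  have h1 : ((P ×ˢ univ).filter fun x : (Fin ρ → V × V) × Finset (Fin ρ) =>
      S ⊆ univ.image (sel x.1 x.2)) ⊆ (univ : Finset (Finset (Fin ρ) × (S → Fin ρ))).biUnion
      fun y => (P.filter fun p => ∀ u : S, sel p y.1 (y.2 u) = (u : V)).image fun p => (p, y.1) := by
    rintro ⟨p, T⟩ hp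
    simp only [Finset.mem_filter, Finset.mem_product, Finset.mem_univ, and_true] at hp
    have : ∀ u : S, ∃ i, sel p T i = u := by
      intro u
      simpa using hp.2 u.2
    choose g hg using this
    simp only [Finset.mem_biUnion, Finset.mem_univ, true_and, Finset.mem_image, Finset.mem_filter]
    exact ⟨(T, g), p, ⟨hp.1, hg⟩, rfl⟩
  refine (Finset.card_le_card h1).trans (Finset.card_biUnion_le.trans ?_)
  refine (Finset.sum_le_card_nsmul _ _ B fun y _ => Finset.card_image_le.trans ?_).trans ?_
  · by_cases hy : Function.Injective y.2
    · exact h y.1 y.2 hy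
    · rw [Finset.filter_false_of_mem, Finset.card_empty]
      · exact Nat.zero_le _
      · intro p _ hp
        apply hy
        intro u u' huu
        apply Subtype.ext
        rw [← hp u, ← hp u', huu]
  · simp

theorem load_union_le {ρ : ℕ} (P Q : Finset (Fin ρ → V × V)) (S : Finset V) :
    load (P ∪ Q) S ≤ load P S + load Q S := by
  rw [load, Finset.union_product, Finset.filter_union]
  exact Finset.card_union_le _ _

end Count

theorem exists_ofFn {α : Type*} {ρ : ℕ} {L : List α} (h : L.length = ρ) :
    ∃ p : Fin ρ → α, List.ofFn p = L := by
  subst h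
  exact ⟨L.get, List.ofFn_get L⟩

namespace Frame

variable {V : Type*} [DecidableEq V] [Fintype V] {c : ℕ} {K A : Type*} [AddCommGroup A]
  [Fintype K] [DecidableEq K] [DecidableEq A] [Fintype A] (F : Frame V c K A)

/-- Every label occurs at most `C` times. -/
def FibreLE (C : ℕ) : Prop := ∀ g, (univ.filter fun v => F.lab v = g).card ≤ C

theorem lsum_ofFn {ρ : ℕ} (p : Fin ρ → V × V) : F.lsum (List.ofFn p) = ∑ i, F.lab (p i).1 := by
  rw [lsum, List.map_ofFn, List.sum_ofFn]
  rfl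

/-- The labels determine each of the 2ρ vertices up to `C` possibilities, so it is enough to count
label patterns. -/
theorem card_le_of_lab {C : ℕ} (hC : F.FibreLE C) {ρ : ℕ} {δ : Type*} [DecidableEq δ]
    (Q : Finset (Fin ρ → V × V))
    (𝒟 : Finset δ) (Φ : δ → Fin ρ → (K → A) × (K → A))
    (h : ∀ p ∈ Q, ∃ d ∈ 𝒟, ∀ i, F.lab (p i).1 = (Φ d i).1 ∧ F.lab (p i).2 = (Φ d i).2) :
    Q.card ≤ C ^ (2 * ρ) * 𝒟.card := by
  have h1 : Q ⊆ 𝒟.biUnion fun d => Fintype.piFinset fun i =>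
      (univ.filter fun v => F.lab v = (Φ d i).1) ×ˢ (univ.filter fun v => F.lab v = (Φ d i).2) := by
    intro p hp
    obtain ⟨d, hd, hdp⟩ := h p hp
    simp only [Finset.mem_biUnion, Fintype.mem_piFinset, Finset.mem_product, Finset.mem_filter,
      Finset.mem_univ, true_and]
    exact ⟨d, hd, hdp⟩
  refine (Finset.card_le_card h1).trans (Finset.card_biUnion_le.trans ?_)
  refine (Finset.sum_le_card_nsmul _ _ (C ^ (2 * ρ)) fun d _ => ?_).trans ?_
  · rw [Fintype.card_piFinset]
    refine (Finset.prod_le_prod' (g := fun _ => C * C) fun i _ => ?_).trans ?_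
    · rw [Finset.card_product]
      exact Nat.mul_le_mul (hC _) (hC _)
    · rw [Finset.prod_const, Finset.card_univ, Fintype.card_fin, pow_mul, pow_two]
  · rw [smul_eq_mul, mul_comm]

/-- A set of `ρ` vertices fixes one label in every pair, and the difference gives the other. -/
theorem load_le_of_diff {C : ℕ} (hC : F.FibreLE C) {ρ : ℕ} {P : Finset (Fin ρ → V × V)}
    {B : Finset (K → A)} (hP : ∀ p ∈ P, ∀ i, F.lab (p i).1 - F.lab (p i).2 ∈ B) {S : Finset V}
    (hS : S.card = ρ) : load P S ≤ 2 ^ ρ * ρ ^ ρ * (C ^ (2 * ρ) * B.card ^ ρ) := by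
  classical
  refine (load_le P S (C ^ (2 * ρ) * B.card ^ ρ) fun T g hg => ?_).trans (by rw [hS])
  have hbij : Function.Surjective g :=
    ((Fintype.bijective_iff_injective_and_card g).2 ⟨hg, by simp [hS]⟩).2
  choose u hu using hbij
  have := F.card_le_of_lab hC (P.filter fun p => ∀ u : S, sel p T (g u) = (u : V))
    (Fintype.piFinset fun _ : Fin ρ => B)
    (fun d i => if i ∈ T then (F.lab (u i) + d i, F.lab (u i)) else (F.lab (u i), F.lab (u i) - d i))
    (by
      intro p hp
      rw [Finset.mem_filter] at hp
      refine ⟨fun i => F.lab (p i).1 - F.lab (p i).2, ?_, fun i => ?_⟩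
      · rw [Fintype.mem_piFinset]
        exact hP p hp.1
      · have h1 := hp.2 (u i)
        rw [hu] at h1
        by_cases hi : i ∈ T
        · rw [sel, if_pos hi] at h1
          rw [← h1]
          simp [hi]
        · rw [sel, if_neg hi] at h1
          rw [← h1]
          simp [hi])
  simpa using this

/-- Prescribing all but one vertex of a transversal prescribes all but one label. -/
theorem exists_labels {r : ℕ} {S : Finset V} (hS : S.card + 1 = r) {g : S → Fin r}
    (hg : Function.Injective g) : ∃ (j : Fin r) (t : Fin r → K → A), ∀ x : Fin r → V,
      (∀ u : S, x (g u) = u) → ∀ i, i ≠ j → F.lab (x i) = t i := by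
  classical
  have h1 : (univ.image g).card + 1 = r := by
    rw [Finset.card_image_of_injective _ hg]
    simpa using hS
  have h2 : (univ.image g)ᶜ.card = 1 := by
    rw [Finset.card_compl, Fintype.card_fin]
    omega
  obtain ⟨j, hj⟩ := Finset.card_eq_one.1 h2
  refine ⟨j, fun i => if h : ∃ u, g u = i then F.lab h.choose else 0, fun x hx i hi => ?_⟩
  have h : ∃ u, g u = i := by
    by_contra hcon
    have : i ∈ (univ.image g)ᶜ := by
      simp only [Finset.mem_compl, Finset.mem_image, Finset.mem_univ, true_and]
      exact hcon
    rw [hj, Finset.mem_singleton] at this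
    exact hi this
  simp only [dif_pos h]
  rw [← hx, h.choose_spec]

/-- A set of `r - 1` vertices fixes one label in all pairs but one. With the differences this gives
the first labels there; the label sum then yields the missing first label, and the differences yield
all second labels. So the load is governed by the number of admissible sums and differences. -/
theorem load_le_of_sum {C : ℕ} (hC : F.FibreLE C) {r : ℕ} {P : Finset (Fin r → V × V)}
    {𝒟 : Finset ((K → A) × (Fin r → K → A))}
    (hP : ∀ p ∈ P, (∑ i, F.lab (p i).1, fun i => F.lab (p i).1 - F.lab (p i).2) ∈ 𝒟) {S : Finset V}
    (hS : S.card + 1 = r) : load P S ≤ 2 ^ r * r ^ r * (C ^ (2 * r) * 𝒟.card) := by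
  classical
  refine (load_le P S (C ^ (2 * r) * 𝒟.card) fun T g hg => ?_).trans ?_
  swap
  · gcongr <;> omega
  obtain ⟨j, t, ht⟩ := F.exists_labels hS hg
  set fst : (K → A) × (Fin r → K → A) → Fin r → K → A :=
    fun d i => if i ∈ T then t i + d.2 i else t i with hfst
  set fst' : (K → A) × (Fin r → K → A) → Fin r → K → A :=
    fun d => Function.update (fst d) j (d.1 - ∑ i ∈ univ.erase j, fst d i) with hfst'
  refine F.card_le_of_lab hC _ 𝒟 (fun d i => (fst' d i, fst' d i - d.2 i)) ?_
  intro p hp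
  rw [Finset.mem_filter] at hp
  refine ⟨_, hP p hp.1, ?_⟩
  set d : (K → A) × (Fin r → K → A) :=
    (∑ i, F.lab (p i).1, fun i => F.lab (p i).1 - F.lab (p i).2) with hd
  have h1 : ∀ i, i ≠ j → F.lab (p i).1 = fst d i := by
    intro i hi
    have := ht (sel p T) hp.2 i hi
    by_cases hiT : i ∈ T
    · rw [sel, if_pos hiT] at this
      simp [hfst, hiT, ← this, hd]
    · rw [sel, if_neg hiT] at this
      simp [hfst, hiT, ← this]
  have h2 : ∀ i, F.lab (p i).1 = fst' d i := by
    intro i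
    by_cases hi : i = j
    · subst hi
      rw [hfst']
      simp only [Function.update_self]
      rw [← Finset.sum_congr rfl fun k hk => h1 k (Finset.ne_of_mem_erase hk), hd,
        ← Finset.add_sum_erase univ _ (Finset.mem_univ i)]
      simp
    · rw [hfst']
      simp only [Function.update_of_ne hi]
      exact h1 i hi
  intro i
  refine ⟨h2 i, ?_⟩
  change _ = fst' d i - d.2 i
  rw [← h2 i, hd]
  exact (sub_sub_cancel _ _).symm

end Frame

/-! ### The number of label vectors of small weight, or with a zero row -/

section Balls

variable {K A : Type*} [Fintype K] [DecidableEq K] [AddCommGroup A] [DecidableEq A] [Fintype A]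

open scoped Classical in
theorem card_ball_le (h : ℕ) :
    (univ.filter fun g : K → A => wt g ≤ h).card ≤ 2 ^ Fintype.card K * Fintype.card A ^ h := by
  have h1 : (univ.filter fun g : K → A => wt g ≤ h) ⊆
      ((univ : Finset (Finset K)).filter fun J => J.card ≤ h).biUnion fun J =>
        Fintype.piFinset fun k => if k ∈ J then univ else {0} := by
    intro g hg
    simp only [Finset.mem_filter, Finset.mem_univ, true_and, Finset.mem_biUnion,
      Fintype.mem_piFinset] at hg ⊢
    refine ⟨univ.filter fun k => g k ≠ 0, hg, fun k => ?_⟩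
    by_cases hk : g k = 0 <;> simp [hk]
  refine (Finset.card_le_card h1).trans (Finset.card_biUnion_le.trans ?_)
  refine (Finset.sum_le_card_nsmul _ _ (Fintype.card A ^ h) fun J hJ => ?_).trans ?_
  · have h2 : ∀ k, (if k ∈ J then (univ : Finset A) else {0}).card =
        if k ∈ J then Fintype.card A else 1 := by
      intro k
      split_ifs <;> simp
    rw [Fintype.card_piFinset]
    simp only [h2]
    rw [Finset.prod_ite, Finset.prod_const, Finset.prod_const, one_pow, mul_one,
      Finset.filter_mem_eq_inter, Finset.univ_inter]
    exact Nat.pow_le_pow_right Fintype.card_pos (Finset.mem_filter.1 hJ).2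
  · rw [smul_eq_mul]
    refine Nat.mul_le_mul_right _ ((Finset.card_filter_le _ _).trans ?_)
    simp

/-- The vectors that vanish on one of the rows. -/
def zeroRow (m κ : ℕ) (A : Type*) [Zero A] : Set (Fin m × Fin κ → A) := {s | ∃ l, ∀ k, s (l, k) = 0}

-- A zero row removes κ of the mκ coordinates. For m = r this leaves the (1 - 1/r)-th power of the
-- number of all labels.
open scoped Classical in
theorem card_zeroRow_le (m κ : ℕ) :
    (univ.filter fun s : Fin m × Fin κ → A => s ∈ zeroRow m κ A).card ≤
      m * Fintype.card A ^ (κ * (m - 1)) := by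
  have h1 : (univ.filter fun s : Fin m × Fin κ → A => s ∈ zeroRow m κ A) ⊆
      (univ : Finset (Fin m)).biUnion fun l => univ.filter fun s =>
        ∀ i ∈ ({l} : Finset (Fin m)) ×ˢ (univ : Finset (Fin κ)), s i = 0 := by
    intro s hs
    simp only [Finset.mem_filter, Finset.mem_univ, true_and, Finset.mem_biUnion] at hs ⊢
    obtain ⟨l, hl⟩ := hs
    refine ⟨l, ?_⟩
    rintro ⟨l', k⟩ hi
    simp only [Finset.mem_product, Finset.mem_singleton, Finset.mem_univ, and_true] at hi
    rw [hi, hl]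
  refine (Finset.card_le_card h1).trans (Finset.card_biUnion_le.trans ?_)
  refine (Finset.sum_le_card_nsmul _ _ (Fintype.card A ^ (κ * (m - 1))) fun l _ => ?_).trans (by simp)
  have h2 := card_pi_agree (({l} : Finset (Fin m)) ×ˢ (univ : Finset (Fin κ))) (fun _ => (0 : A))
  have hpos : 0 < Fintype.card A ^ κ := pow_pos Fintype.card_pos _
  have hm : 1 ≤ m := Nat.lt_of_le_of_lt (Nat.zero_le _) l.2
  refine Nat.le_of_mul_le_mul_right (c := Fintype.card A ^ κ) (le_of_eq ?_) hpos
  simp only [Finset.card_product, Finset.card_singleton, one_mul, Finset.card_univ, Fintype.card_fin,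
    Fintype.card_prod] at h2
  have h3 : Fintype.card A ^ (m * κ) = Fintype.card A ^ (κ * (m - 1)) * Fintype.card A ^ κ := by
    rw [← pow_add]
    congr 1
    obtain ⟨m', rfl⟩ := Nat.exists_eq_add_of_le hm
    rw [Nat.add_sub_cancel_left]
    ring
  rw [← h3]
  convert h2

end Balls

/-! ### Gadgets: octahedra times cliques, and subdivision of pairs -/

section Gadgets

variable {V : Type*} [DecidableEq V] [Fintype V]

/-- `K_q^r`-divisible chains. -/
def divis (q r : ℕ) : Submodule ℤ (Chain V) where
  carrier := {φ | φ ∈ supp {e | e.card = r} ∧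
    ∀ S : Finset V, S.card < r → ((q - S.card).choose (r - S.card) : ℤ) ∣ deg S φ}
  add_mem' := by
    intro a b ha hb
    refine ⟨Submodule.add_mem _ ha.1 hb.1, fun S hS => ?_⟩
    rw [map_add]
    exact dvd_add (ha.2 S hS) (hb.2 S hS)
  zero_mem' := ⟨Submodule.zero_mem _, fun S _ => by simp⟩
  smul_mem' := by
    intro c a ha
    refine ⟨Submodule.smul_mem _ _ ha.1, fun S hS => ?_⟩
    rw [map_smul, smul_eq_mul]
    exact (ha.2 S hS).mul_left _

theorem null_le_divis (q r : ℕ) : null r ≤ (divis q r : Submodule ℤ (Chain V)) :=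
  fun φ hφ => ⟨hφ.1, fun S hS => by rw [hφ.2 S hS]; exact dvd_zero _⟩

/-- A divisible chain of bounded size all of whose sets meet `Y`. -/
structure Gadget (q r : ℕ) (Y : Finset V) (C : ℕ) (γ : Chain V × Finset V) : Prop where
  supp : γ.1 ∈ supp {e | e ⊆ γ.2}
  divis : γ.1 ∈ divis q r
  card : γ.2.card ≤ C
  flat : ∀ e, γ.1 e ≠ 0 → (e ∩ Y).Nonempty

theorem Gadget.mono {q r : ℕ} {Y : Finset V} {C C' : ℕ} {γ : Chain V × Finset V}
    (h : Gadget q r Y C γ) (hC : C ≤ C') : Gadget q r Y C' γ :=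
  ⟨h.supp, h.divis, h.card.trans hC, h.flat⟩

/-- The complete `j`-uniform hypergraph on `B`. -/
def clique (B : Finset V) (j : ℕ) : Chain V := fun e => if e ⊆ B ∧ e.card = j then 1 else 0

theorem clique_mem_supp (B : Finset V) (j : ℕ) : clique B j ∈ supp {e | e ⊆ B ∧ e.card = j} := by
  intro e he
  exact if_neg he

theorem clique_zero (B : Finset V) : clique B 0 = sing ∅ := by
  ext e
  rw [clique, sing_apply]
  congr 1
  simp only [Finset.card_eq_zero, eq_iff_iff, and_iff_right_iff_imp]
  rintro rfl
  simp

theorem deg_clique (B : Finset V) (j : ℕ) {S : Finset V} (hS : S.card ≤ j) :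
    deg S (clique B j) = if S ⊆ B then ((B.card - S.card).choose (j - S.card) : ℤ) else 0 := by
  split_ifs with hSB
  · rw [← Finset.card_filter_powersetCard_subset S B j hSB hS, deg_apply, Finset.card_filter]
    push_cast
    rw [← Finset.sum_subset (Finset.subset_univ (B.powersetCard j))]
    · refine Finset.sum_congr rfl fun e he => ?_
      rw [Finset.mem_powersetCard] at he
      simp [clique, he]
    · intro e _ he
      rw [Finset.mem_powersetCard] at he
      simp [clique, he]
  · refine deg_eq_zero_of_supp (clique_mem_supp B j) ?_
    rintro e ⟨he, -⟩ h
    exact hSB (h.trans he)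

theorem avoids_clique {B : Finset V} {j : ℕ} {v : V} (hv : v ∉ B) : Avoids v (clique B j) := by
  intro e he
  exact if_neg fun h => hv (h.1 he)

/-- A set `S` with nonzero degree uses exactly ρ vertices on the pairs, and the rest lies in a
clique on q - ρ vertices. That rest has degree `(q - |S|).choose (r - |S|)`, exactly the required
divisor. -/
theorem octOn_clique_mem_divis {q r ρ : ℕ} (hρ : ρ ≤ r) (hrq : r ≤ q) {L : List (V × V)}
    (hlen : L.length = ρ) (hL : (pts L).Nodup) {B : Finset V} (hB : B.card = q - ρ)
    (hd : ∀ v ∈ pts L, v ∉ B) : octOn L (clique B (r - ρ)) ∈ divis q r := by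
  refine ⟨supp_mono ?_ (octOn_mem_supp L (clique_mem_supp B (r - ρ))), fun S hS => ?_⟩
  · rintro _ ⟨n, e₁, e₀, h1, ⟨-, h2⟩, h3, rfl⟩
    have := h1.card
    simp only [Set.mem_ofPred_eq, Finset.card_union_of_disjoint h3]
    omega
  · rcases deg_octOn_cases hL (fun v hv => avoids_clique (j := r - ρ) (hd v hv)) S with
      h | ⟨S', h1, h2, h3⟩
    · simp [h]
    · have h4 : ((q - S.card).choose (r - S.card) : ℤ) ∣ deg S' (clique B (r - ρ)) := by
        rw [deg_clique _ _ (by omega)]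
        split_ifs
        · rw [show B.card - S'.card = q - S.card by omega,
            show r - ρ - S'.card = r - S.card by omega]
        · simp
      rcases h3 with h3 | h3
      · rwa [h3]
      · rwa [h3, dvd_neg]

theorem deg_octOn_clique {q r ρ : ℕ} {L : List (V × V)}
    (hlen : L.length = ρ) (hL : (pts L).Nodup) {B : Finset V} (hB : B.card = q - ρ)
    (hd : ∀ v ∈ pts L, v ∉ B) {S : Finset V} (hS : S.card = ρ) :
    deg S (octOn L (clique B (r - ρ))) = oct L S * (q - ρ).choose (r - ρ) := by
  rw [deg_octOn_of_card_eq hL (fun v hv => avoids_clique (hd v hv)) (hS.trans hlen.symm),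
    deg_clique _ _ (by simp)]
  simp [hB]

theorem pts_ofFn_mem {ρ : ℕ} (p : Fin ρ → V × V) (v : V) :
    v ∈ pts (List.ofFn p) ↔ ∃ i, v = (p i).1 ∨ v = (p i).2 := by
  rw [List.ofFn_eq_map]
  change v ∈ pts ((List.finRange ρ).map fun i => ((p i).1, (p i).2)) ↔ _
  rw [pts_map]
  simp

theorem nodup_pts_ofFn {ρ : ℕ} {p : Fin ρ → V × V} : (pts (List.ofFn p)).Nodup ↔
    (∀ i j, (p i).1 = (p j).1 → i = j) ∧ (∀ i j, (p i).2 = (p j).2 → i = j) ∧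
      ∀ i j, (p i).1 ≠ (p j).2 := by
  constructor
  · intro h
    obtain ⟨h1, h2⟩ := List.nodup_flatMap.1 h
    rw [List.pairwise_ofFn] at h2
    have h3 : ∀ i j, i ≠ j → (p i).1 ≠ (p j).1 ∧ (p i).1 ≠ (p j).2 ∧ (p i).2 ≠ (p j).1 ∧
        (p i).2 ≠ (p j).2 := by
      have h4 : ∀ i j, i < j → (p i).1 ≠ (p j).1 ∧ (p i).1 ≠ (p j).2 ∧ (p i).2 ≠ (p j).1 ∧
          (p i).2 ≠ (p j).2 := by
        intro i j hij
        have := h2 hij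
        simp only [Function.onFun, List.disjoint_cons_left, List.mem_cons, List.not_mem_nil,
          or_false, not_or] at this
        exact ⟨this.1.1, this.1.2, this.2.1.1, this.2.1.2⟩
      intro i j hij
      rcases lt_or_gt_of_ne hij with h | h
      · exact h4 i j h
      · obtain ⟨a, b, c, d⟩ := h4 j i h
        exact ⟨a.symm, c.symm, b.symm, d.symm⟩
    refine ⟨fun i j hij => ?_, fun i j hij => ?_, fun i j => ?_⟩
    · by_contra hne
      exact (h3 i j hne).1 hij
    · by_contra hne
      exact (h3 i j hne).2.2.2 hij
    · by_cases hij : i = j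
      · subst hij
        have := h1 (p i) (by simp)
        simpa using this
      · exact (h3 i j hij).2.1
  · rintro ⟨h1, h2, h3⟩
    rw [List.ofFn_eq_map]
    exact nodup_pts_map (List.nodup_finRange ρ) (fun i _ j _ => h1 i j) (fun i _ j _ => h2 i j)
      (fun i _ j _ => h3 i j)

theorem sel_injective {ρ : ℕ} {p : Fin ρ → V × V} (hp : (pts (List.ofFn p)).Nodup)
    (T : Finset (Fin ρ)) : Function.Injective (sel p T) := by
  obtain ⟨h1, h2, h3⟩ := nodup_pts_ofFn.1 hp
  intro i j hij
  by_cases hi : i ∈ T <;> by_cases hj : j ∈ T <;> simp only [sel, hi, hj, if_true, if_false] at hij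
  · exact h2 i j hij
  · exact absurd hij.symm (h3 j i)
  · exact absurd hij (h3 i j)
  · exact h1 i j hij

/-- Subdivision of the pairs of `p` by the vertices `f`. -/
def split {ρ : ℕ} (p : Fin ρ → V × V) (f : Fin ρ → V) (T : Finset (Fin ρ)) (i : Fin ρ) : V × V :=
  if i ∈ T then (f i, (p i).2) else ((p i).1, f i)

/-- In each factor, a - b = (a - f) + (f - b); expand the product. Each piece retains one old vertex
of every pair, so its old vertices form a transversal. -/
theorem octOn_mem_of_split {ρ : ℕ} (p : Fin ρ → V × V) (f : Fin ρ → V) (ψ : Chain V)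
    (𝓣 : Submodule ℤ (Chain V)) (h : ∀ T, octOn (List.ofFn (split p f T)) ψ ∈ 𝓣) :
    octOn (List.ofFn p) ψ ∈ 𝓣 := by
  induction ρ generalizing 𝓣 with
  | zero => simpa using h ∅
  | succ ρ ih =>
    have h1 : octOn (List.ofFn p) ψ =
        (join (p 0).1 - join (f 0)) (octOn (List.ofFn fun i => p i.succ) ψ) +
          (join (f 0) - join (p 0).2) (octOn (List.ofFn fun i => p i.succ) ψ) := by
      rw [List.ofFn_succ, octOn_cons]
      simp
    rw [h1]
    refine Submodule.add_mem _ (ih (fun i => p i.succ) (fun i => f i.succ)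
      (𝓣.comap (join (p 0).1 - join (f 0))) fun T => ?_)
      (ih (fun i => p i.succ) (fun i => f i.succ)
      (𝓣.comap (join (f 0) - join (p 0).2)) fun T => ?_)
    · have h2 := h (T.map (Fin.succEmb ρ))
      rw [List.ofFn_succ] at h2
      have h3 : split p f (T.map (Fin.succEmb ρ)) 0 = ((p 0).1, f 0) := by
        rw [split, if_neg]
        simp
      have h4 : (fun i : Fin ρ => split p f (T.map (Fin.succEmb ρ)) i.succ) =
          split (fun i => p i.succ) (fun i => f i.succ) T := by
        funext i
        simp [split]
      rw [h3, h4] at h2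
      exact h2
    · have h2 := h (insert 0 (T.map (Fin.succEmb ρ)))
      rw [List.ofFn_succ] at h2
      have h3 : split p f (insert 0 (T.map (Fin.succEmb ρ))) 0 = (f 0, (p 0).2) := by
        rw [split, if_pos]
        simp
      have h4 : (fun i : Fin ρ => split p f (insert 0 (T.map (Fin.succEmb ρ))) i.succ) =
          split (fun i => p i.succ) (fun i => f i.succ) T := by
        funext i
        simp [split]
      rw [h3, h4] at h2
      exact h2

theorem log_card_powersetCard_le {r D : ℕ} (hD : Real.log (Fintype.card V) ≤ D) :
    Real.log ((univ : Finset V).powersetCard (r - 1)).card ≤ (r * D : ℕ) := by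
  rw [Finset.card_powersetCard, Finset.card_univ]
  rcases Nat.eq_zero_or_pos ((Fintype.card V).choose (r - 1)) with h | h
  · rw [h]
    simp only [Nat.cast_zero, Real.log_zero]
    positivity
  · have h1 : ((Fintype.card V).choose (r - 1) : ℝ) ≤ (Fintype.card V : ℝ) ^ (r - 1) := by
      exact_mod_cast Nat.choose_le_pow _ _
    refine (Real.log_le_log (by exact_mod_cast h) h1).trans ?_
    rw [Real.log_pow]
    push_cast
    have h2 : ((r - 1 : ℕ) : ℝ) ≤ r := by exact_mod_cast Nat.sub_le _ _
    calc ((r - 1 : ℕ) : ℝ) * Real.log (Fintype.card V) ≤ ((r - 1 : ℕ) : ℝ) * D := by gcongr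
      _ ≤ _ := by gcongr

end Gadgets

/-! ### Sparse gadgets by random subdivision -/

namespace Frame

variable {V : Type*} [DecidableEq V] [Fintype V] {c : ℕ} {K A : Type*} [AddCommGroup A]
  [Fintype K] [DecidableEq K] [DecidableEq A] [Fintype A] (F : Frame V c K A)

theorem mem_of_typ_ne_none {Y : Finset V} (hY : ∀ m g, F.vtx m g ∈ Y) {v : V}
    (hv : F.typ v ≠ none) : v ∈ Y := by
  obtain ⟨m, hm⟩ := Option.ne_none_iff_exists'.1 hv
  rw [← F.vtx_lab m v hm]
  exact hY _ _

theorem vtx_injective (m : Fin c) : Function.Injective (F.vtx m) := by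
  intro g g' h
  rw [← F.lab_vtx m g, h, F.lab_vtx]

open scoped Classical in
/-- The octahedra of a family are spanned by sparse gadgets, after subdivision by new vertices. -/
theorem exists_gadgets {q r ρ : ℕ} (hr : 1 ≤ r) (hρ : ρ ≤ r) (hrq : r < q) (hc : 2 * r + q ≤ c)
    {Y : Finset V} (hY : ∀ m g, F.vtx m g ∈ Y) {C D : ℕ}
    (hC : Fintype.card V ≤ C * Fintype.card (K → A)) (hD : Real.log (Fintype.card V) ≤ D)
    (P : Finset (Fin ρ → V × V)) (hnd : ∀ p ∈ P, (pts (List.ofFn p)).Nodup)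
    (hload : ∀ S : Finset V, S.card = min ρ (r - 1) → load P S ≤ D)
    (htyp : ρ = r → ∀ p ∈ P, ∃ i, F.typ (p i).1 ≠ none ∧ F.typ (p i).2 ≠ none) :
    ∃ 𝒢 : Finset (Chain V × Finset V), (∀ γ ∈ 𝒢, Gadget q r Y (r + q) γ) ∧
      (∀ S : Finset V, S.card = r - 1 → (𝒢.filter fun γ => S ⊆ γ.2).card ≤
        2 ^ r * (2 * (2 ^ r * (q + 1) ^ r * (C + 1) ^ r + r)) * D) ∧
      ∀ p ∈ P, ∃ B : Finset V, B.card = q - ρ ∧ (∀ v ∈ pts (List.ofFn p), v ∉ B) ∧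
        octOn (List.ofFn p) (clique B (r - ρ)) ∈
          Submodule.span ℤ ((fun γ => γ.1) '' (𝒢 : Set (Chain V × Finset V))) := by
  have hfresh : ∀ p : Fin ρ → V × V, ∃ m : Fin q → Fin c, Function.Injective m ∧
      ∀ l, ∀ v ∈ pts (List.ofFn p), F.typ v ≠ some (m l) := by
    intro p
    have h1 := List.toFinset_card_le (pts (List.ofFn p))
    rw [length_pts, List.length_ofFn] at h1
    obtain ⟨m, hm1, hm2⟩ := F.exists_fresh (univ : Finset (Fin q)) (pts (List.ofFn p)).toFinset
      (by rw [Finset.card_univ, Fintype.card_fin]; omega) (by omega)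
    exact ⟨m, fun i j h => hm1 i (by simp) j (by simp) h,
      fun l v hv => hm2 l (by simp) v (by simpa using hv)⟩
  choose m hm1 hm2 using hfresh
  set z : (Fin ρ → V × V) → Fin q → (K → A) → V := fun p l => F.vtx (m p l) with hz
  have hzt : ∀ p l g, F.typ (z p l g) = some (m p l) := fun p l g => F.typ_vtx _ _
  set W : (Fin ρ → V × V) → Finset (Fin ρ) → (Fin q → K → A) → Finset V :=
    fun p T ω => univ.image (sel p T) ∪ univ.image fun l => z p l (ω l) with hW
  -- The event is that `S` lies in the vertex set of some piece of `p`. All `2 ^ ρ` pieces of `p`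
  -- share the same random vertices.
  obtain ⟨E, hE⟩ : ∃ E : P → (Fin q → K → A) → Finset V → Prop, ∀ p ω S,
      E p ω S ↔ ∃ T, S ⊆ W p T ω := ⟨_, fun _ _ _ => Iff.rfl⟩
  have hexp : ∀ S ∈ (univ : Finset V).powersetCard (r - 1), ∑ p : P,
      (univ.filter fun ω => E p ω S).card ≤
        (2 ^ r * (q + 1) ^ r * (C + 1) ^ r * D) * Fintype.card (Fin q → K → A) := by
    intro S hS
    have hS := (Finset.mem_powersetCard.1 hS).2
    have h1 := sum_card_cover_le (ι := P × Finset (Fin ρ)) (κ := Fin q) (G := K → A)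
      (fun i => univ.image (sel i.1.1 i.2)) (fun i => z i.1.1) (fun i l => F.vtx_injective _)
      (k := min ρ (r - 1)) (s := r - 1) (D := D) (C := C) hC (by
        intro i
        rw [Finset.card_image_of_injective _ (sel_injective (hnd _ i.1.2) _), Finset.card_univ,
          Fintype.card_fin]
        exact min_le_left _ _) (min_le_right _ _) (by
        intro i
        rw [Finset.card_image_of_injective _ (sel_injective (hnd _ i.1.2) _), Finset.card_univ,
          Fintype.card_fin]
        rcases le_total ρ (r - 1) with h | h
        · right
          rw [min_eq_left h]
        · left
          rw [min_eq_right h]) (by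
        intro S' hS'
        refine le_trans ?_ (hload S' hS')
        refine Finset.card_le_card_of_injOn (fun x => (x.1.1, x.2)) ?_ ?_
        · intro x hx
          simpa using hx
        · rintro ⟨⟨a, ha⟩, b⟩ _ ⟨⟨a', ha'⟩, b'⟩ _ h
          simpa using h) S hS
    have h2 : 2 ^ (r - 1) * (Fintype.card (Fin q) + 1) ^ (r - 1) * (C + 1) ^ min ρ (r - 1) ≤
        2 ^ r * (q + 1) ^ r * (C + 1) ^ r := by
      rw [Fintype.card_fin]
      refine Nat.mul_le_mul (Nat.mul_le_mul (Nat.pow_le_pow_right (by omega) (by omega))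
        (Nat.pow_le_pow_right (by omega) (by omega))) (Nat.pow_le_pow_right (by omega) (by omega))
    refine le_trans ?_ (h1.trans (Nat.mul_le_mul (Nat.mul_le_mul h2 le_rfl) le_rfl))
    rw [Fintype.sum_prod_type]
    refine Finset.sum_le_sum fun p _ => ?_
    refine (Finset.card_le_card ?_).trans Finset.card_biUnion_le
    intro ω hω
    simpa [hE] using hω
  obtain ⟨ω, hω⟩ := exists_choice ((univ : Finset V).powersetCard (r - 1)) E _ (r * D) hexp (log_card_powersetCard_le hD)
  -- Of the `q` random new vertices, the first `ρ` subdivide the pairs and the other `q - ρ` form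
  -- the clique `B`.
  set f : P → Fin ρ → V := fun p l => z p (Fin.castLE (hρ.trans hrq.le) l) (ω p (Fin.castLE _ l)) with hf
  set B : P → Finset V := fun p => (univ.filter fun l : Fin q => ρ ≤ l.1).image fun l => z p l (ω p l)
    with hB
  have hzinj : ∀ p : P, Function.Injective fun l => z p l (ω p l) := by
    intro p l l' h
    have := congrArg F.typ h
    rw [hzt, hzt, Option.some_inj] at this
    exact hm1 _ this
  have hBcard : ∀ p, (B p).card = q - ρ := by
    intro p
    rw [hB, Finset.card_image_of_injective _ (hzinj p)]
    have h1 := Finset.card_filter_add_card_filter_not (s := (univ : Finset (Fin q))) (fun l => ρ ≤ l.1)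
    rw [Finset.card_univ, Fintype.card_fin] at h1
    have h2 : (univ.filter fun l : Fin q => ¬ ρ ≤ l.1).card = ρ := by
      have : (univ.filter fun l : Fin q => ¬ ρ ≤ l.1) = univ.image (Fin.castLE (hρ.trans hrq.le)) := by
        ext l
        simp only [Finset.mem_filter, Finset.mem_univ, true_and, not_le, Finset.mem_image]
        constructor
        · intro h
          exact ⟨⟨l.1, h⟩, rfl⟩
        · rintro ⟨i, rfl⟩
          exact i.2
      rw [this, Finset.card_image_of_injective _ (Fin.castLE_injective _), Finset.card_univ,
        Fintype.card_fin]
    omega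
  have hBtyp : ∀ p, ∀ v ∈ B p, F.typ v ≠ none := by
    intro p v hv
    obtain ⟨l, -, rfl⟩ := Finset.mem_image.1 hv
    simp [hzt]
  have hptsB : ∀ p : P, ∀ v ∈ pts (List.ofFn p.1), v ∉ B p := by
    intro p v hv hvB
    obtain ⟨l, -, rfl⟩ := Finset.mem_image.1 hvB
    exact hm2 _ l _ hv (hzt _ _ _)
  have hfpts : ∀ p : P, ∀ i, f p i ∉ pts (List.ofFn p.1) := by
    intro p i h
    exact hm2 _ _ _ h (hzt _ _ _)
  have hfB : ∀ p : P, ∀ i, f p i ∉ B p := by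
    intro p i h
    obtain ⟨l, hl, hl'⟩ := Finset.mem_image.1 h
    have := hzinj p hl'
    rw [Finset.mem_filter, this] at hl
    simp only [Fin.val_castLE] at hl
    have := i.2
    omega
  have hfinj : ∀ p : P, Function.Injective (f p) := fun p i j h =>
    Fin.castLE_injective _ (hzinj p h)
  have hmem1 : ∀ (p : Fin ρ → V × V) i, (p i).1 ∈ pts (List.ofFn p) :=
    fun p i => (pts_ofFn_mem p _).2 ⟨i, Or.inl rfl⟩
  have hmem2 : ∀ (p : Fin ρ → V × V) i, (p i).2 ∈ pts (List.ofFn p) :=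
    fun p i => (pts_ofFn_mem p _).2 ⟨i, Or.inr rfl⟩
  have hsnd : ∀ (p : P) T, (pts (List.ofFn (split p.1 (f p) T))).Nodup := by
    intro p T
    obtain ⟨h1, h2, h3⟩ := nodup_pts_ofFn.1 (hnd _ p.2)
    have hf1 : ∀ i j, f p i ≠ (p.1 j).1 := fun i j h => hfpts p i (h ▸ hmem1 _ _)
    have hf2 : ∀ i j, f p i ≠ (p.1 j).2 := fun i j h => hfpts p i (h ▸ hmem2 _ _)
    rw [nodup_pts_ofFn]
    refine ⟨fun i j => ?_, fun i j => ?_, fun i j => ?_⟩ <;>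
      by_cases hi : i ∈ T <;> by_cases hj : j ∈ T <;>
      simp only [split, hi, hj, if_true, if_false]
    · exact fun h => hfinj p h
    · exact fun h => absurd h (hf1 _ _)
    · exact fun h => absurd h.symm (hf1 _ _)
    · exact h1 i j
    · exact h2 i j
    · exact fun h => absurd h.symm (hf2 _ _)
    · exact fun h => absurd h (hf2 _ _)
    · exact fun h => hfinj p h
    · exact hf2 _ _
    · exact fun h => hj (hfinj p h ▸ hi)
    · exact h3 i j
    · exact (hf1 j i).symm
  have hspts : ∀ (p : P) T, ∀ v ∈ pts (List.ofFn (split p.1 (f p) T)),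
      v ∈ univ.image (sel p.1 T) ∨ ∃ i, v = f p i := by
    intro p T v hv
    obtain ⟨i, hi⟩ := (pts_ofFn_mem _ _).1 hv
    by_cases hiT : i ∈ T
    · simp only [split, hiT, if_true] at hi
      rcases hi with rfl | rfl
      · exact Or.inr ⟨i, rfl⟩
      · exact Or.inl (Finset.mem_image.2 ⟨i, by simp, by simp [sel, hiT]⟩)
    · simp only [split, hiT, if_false] at hi
      rcases hi with rfl | rfl
      · exact Or.inl (Finset.mem_image.2 ⟨i, by simp, by simp [sel, hiT]⟩)
      · exact Or.inr ⟨i, rfl⟩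
  have hselpts : ∀ (p : P) T, ∀ v ∈ univ.image (sel p.1 T), v ∈ pts (List.ofFn p.1) := by
    intro p T v hv
    obtain ⟨i, -, rfl⟩ := Finset.mem_image.1 hv
    by_cases hiT : i ∈ T
    · rw [sel, if_pos hiT]
      exact hmem2 _ _
    · rw [sel, if_neg hiT]
      exact hmem1 _ _
  have hsB : ∀ (p : P) T, ∀ v ∈ pts (List.ofFn (split p.1 (f p) T)), v ∉ B p := by
    intro p T v hv
    rcases hspts p T v hv with h | ⟨i, rfl⟩
    · exact hptsB p v (hselpts p T v h)
    · exact hfB p i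
  set gad : P × Finset (Fin ρ) → Chain V × Finset V := fun x =>
    (octOn (List.ofFn (split x.1.1 (f x.1) x.2)) (clique (B x.1) (r - ρ)), W x.1 x.2 (ω x.1)) with hgad
  refine ⟨univ.image gad, ?_, ?_, ?_⟩
  · intro γ hγ
    obtain ⟨⟨p, T⟩, -, rfl⟩ := Finset.mem_image.1 hγ
    refine ⟨supp_mono ?_ (octOn_mem_supp _ (clique_mem_supp _ _)),
      octOn_clique_mem_divis hρ hrq.le (by simp) (hsnd p T) (hBcard p) (hsB p T), ?_, ?_⟩
    · rintro _ ⟨n, e₁, e₀, h1, ⟨h2, -⟩, -, rfl⟩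
      refine Finset.union_subset (fun v hv => ?_) (fun v hv => ?_)
      · rcases hspts p T v (h1.mem_pts hv) with h | ⟨i, rfl⟩
        · exact Finset.mem_union_left _ h
        · exact Finset.mem_union_right _ (Finset.mem_image.2 ⟨_, by simp, rfl⟩)
      · obtain ⟨l, -, rfl⟩ := Finset.mem_image.1 (h2 hv)
        exact Finset.mem_union_right _ (Finset.mem_image.2 ⟨l, by simp, rfl⟩)
    · refine (Finset.card_union_le _ _).trans (Nat.add_le_add
        (Finset.card_image_le.trans ?_) (Finset.card_image_le.trans ?_)) <;> simp [hρ]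
    · intro e he
      have hmem : ∃ n e₁ e₀, Sel (List.ofFn (split p.1 (f p) T)) n e₁ ∧
          (e₀ ⊆ B p ∧ e₀.card = r - ρ) ∧ Disjoint e₁ e₀ ∧ e = e₁ ∪ e₀ := by
        by_contra hcon
        exact he (octOn_mem_supp _ (clique_mem_supp _ _) e hcon)
      obtain ⟨n, e₁, e₀, h1, ⟨h2, h3⟩, -, rfl⟩ := hmem
      -- For `ρ < r` every set contains a vertex of the clique, which lies in `Y`. For `ρ = r` the
      -- clique part is empty, and the typed pair is needed: after subdivision both its entries are
      -- typed, and each transversal contains one of them.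
      rcases Nat.lt_or_ge ρ r with hlt | hge
      · obtain ⟨v, hv⟩ : e₀.Nonempty := Finset.card_pos.1 (by omega)
        exact ⟨v, Finset.mem_inter.2 ⟨Finset.mem_union_right _ hv,
          F.mem_of_typ_ne_none hY (hBtyp p v (h2 hv))⟩⟩
      · obtain ⟨i, hi1, hi2⟩ := htyp (by omega) p.1 p.2
        have hft : F.typ (f p i) ≠ none := by simp [hf, hzt]
        have h4 := h1.exists_mem (p := split p.1 (f p) T i) (by simp)
        have h5 : F.typ (split p.1 (f p) T i).1 ≠ none ∧ F.typ (split p.1 (f p) T i).2 ≠ none := by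
          by_cases hiT : i ∈ T <;> simp [split, hiT, hi1, hi2, hft]
        rcases h4 with h4 | h4
        · exact ⟨_, Finset.mem_inter.2 ⟨Finset.mem_union_left _ h4, F.mem_of_typ_ne_none hY h5.1⟩⟩
        · exact ⟨_, Finset.mem_inter.2 ⟨Finset.mem_union_left _ h4, F.mem_of_typ_ne_none hY h5.2⟩⟩
  · intro S hS
    have h1 := hω S (Finset.mem_powersetCard.2 ⟨Finset.subset_univ _, hS⟩)
    rw [Finset.filter_image]
    refine Finset.card_image_le.trans ?_
    have h2 : (univ.filter fun x => S ⊆ (gad x).2) ⊆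
        (univ.filter fun p : P => E p (ω p) S) ×ˢ (univ : Finset (Finset (Fin ρ))) := by
      rintro ⟨p, T⟩ hx
      simp only [Finset.mem_filter, Finset.mem_univ, true_and, Finset.mem_product, and_true] at hx ⊢
      exact (hE _ _ _).2 ⟨T, hx⟩
    refine (Finset.card_le_card h2).trans ?_
    rw [Finset.card_product, Finset.card_univ, Fintype.card_finset, Fintype.card_fin, mul_comm]
    refine (Nat.mul_le_mul (Nat.pow_le_pow_right (by omega) hρ) h1).trans (le_of_eq ?_)
    ring
  · intro p hp
    refine ⟨B ⟨p, hp⟩, hBcard _, hptsB ⟨p, hp⟩, octOn_mem_of_split p (f ⟨p, hp⟩) _ _ fun T => ?_⟩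
    refine Submodule.subset_span ⟨gad (⟨p, hp⟩, T), ?_, rfl⟩
    simp

end Frame

theorem Sel.exists_sel {V : Type*} [DecidableEq V] {ρ : ℕ} {p : Fin ρ → V × V} {n : ℕ} {e : Finset V}
    (h : Sel (List.ofFn p) n e) : ∃ T : Finset (Fin ρ), T.card = n ∧ e = univ.image (sel p T) := by
  rw [List.ofFn_eq_map] at h
  obtain ⟨T, -, hT, rfl⟩ := h.exists_of_map (List.nodup_finRange ρ)
  refine ⟨T, hT, ?_⟩
  ext v
  simp only [Finset.mem_union, Finset.mem_image, Finset.mem_sdiff, List.mem_toFinset,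
    List.mem_finRange, true_and, Finset.mem_univ, sel]
  constructor
  · rintro (⟨i, hi, rfl⟩ | ⟨i, hi, rfl⟩) <;> exact ⟨i, by simp [hi]⟩
  · rintro ⟨i, rfl⟩
    by_cases hi : i ∈ T
    · exact Or.inr ⟨i, hi, by simp [hi]⟩
    · exact Or.inl ⟨i, hi, by simp [hi]⟩

theorem sum_card_filter {ι Ω : Type*} [Fintype ι] [Fintype Ω] (P : ι → Ω → Prop)
    [∀ i, DecidablePred (P i)] [DecidablePred fun x : ι × Ω => P x.1 x.2] :
    ∑ i, (univ.filter fun ω => P i ω).card = (univ.filter fun x : ι × Ω => P x.1 x.2).card := by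
  simp only [Finset.card_filter, Fintype.sum_prod_type]
  exact Finset.sum_congr rfl fun _ _ => Finset.sum_congr rfl fun _ _ => by congr

/-! ### Moving sets to label sums with a vanishing row -/

namespace Frame

variable {V : Type*} [DecidableEq V] [Fintype V] {c : ℕ}

section Labels

variable {K A : Type*} [AddCommGroup A]
  [Fintype K] [DecidableEq K] [DecidableEq A] [Fintype A] (F : Frame V c K A)

-- Write n for the number of labels. The prescribed labels outside `T` fix those vertices up to
-- fibres, leaving O(n^(|T| - 1) D) sets of the family; prescribing `ω` on `T` leaves n^(r - |T|)
-- choices. Together this is O(D n^(r - 1)), one power of n below the total number of choices.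
-- Nonemptiness of `T` provides this saving.
open scoped Classical in
theorem card_labels_le {ι : Type*} [Fintype ι] {r C C' D : ℕ} (a : ι → Fin r → V)
    (ha : ∀ ε, Function.Injective (a ε))
    (hD : ∀ S : Finset V, S.card = r - 1 → (univ.filter fun ε => S ⊆ univ.image (a ε)).card ≤ D)
    (hC : Fintype.card V ≤ C * Fintype.card (K → A)) (hfib : F.FibreLE C') (hC' : 1 ≤ C')
    {T : Finset (Fin r)} (hT : T.Nonempty) (τ : Fin r → K → A) :
    (univ.filter fun x : ι × (Fin r → K → A) => ∀ l, (l ∉ T → F.lab (a x.1 l) = τ l) ∧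
        (l ∈ T → x.2 l = τ l)).card * Fintype.card (K → A) ≤
      C' ^ r * (C + 1) ^ r * D * Fintype.card (K → A) ^ r := by
  have htr : T.card ≤ r := by simpa using Finset.card_le_univ T
  obtain ⟨t, ht⟩ := Nat.exists_eq_succ_of_ne_zero hT.card_pos.ne'
  set X := univ.filter fun ε : ι => ∀ l, l ∉ T → F.lab (a ε l) = τ l with hX
  have h1 : X.card ≤ C' ^ r * (Fintype.card V ^ t * D) := by
    rcases X.eq_empty_or_nonempty with h | ⟨ε₀, -⟩
    · simp [h]
    obtain ⟨v0⟩ : Nonempty V := ⟨a ε₀ hT.choose⟩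
    set H : Finset (Fin r → V) := Fintype.piFinset fun l =>
      if l ∈ T then {v0} else univ.filter fun v => F.lab v = τ l with hH
    have hHc : H.card ≤ C' ^ r := by
      rw [hH, Fintype.card_piFinset]
      refine (Finset.prod_le_prod' (g := fun _ => C') fun l _ => ?_).trans (by simp)
      split_ifs
      · simpa using hC'
      · exact hfib _
    have h2 := Finset.card_le_mul_card_image_of_maps_to (s := X) (t := H)
      (f := fun ε l => if l ∈ T then v0 else a ε l) (by
        intro ε hε
        rw [hX, Finset.mem_filter] at hε
        rw [hH, Fintype.mem_piFinset]
        intro l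
        by_cases hl : l ∈ T
        · simp [hl]
        · simpa [hl] using hε.2 l hl) (Fintype.card V ^ t * D) (by
        intro h _
        rcases (X.filter fun ε => (fun l => if l ∈ T then v0 else a ε l) = h).eq_empty_or_nonempty with
          h3 | ⟨ε₁, hε₁⟩
        · rw [h3]
          simp
        have hε₁ := (Finset.mem_filter.1 hε₁).2
        have hcard : (Tᶜ.image h).card = r - (t + 1) := by
          rw [Finset.card_image_of_injOn, Finset.card_compl, Fintype.card_fin, ht]
          intro l hl l' hl' hll
          have hl1 : l ∉ T := by simpa using hl
          have hl2 : l' ∉ T := by simpa using hl'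
          rw [← hε₁] at hll
          simp only [hl1, hl2, if_false] at hll
          exact ha _ hll
        refine (Finset.card_le_card ?_).trans (card_superset_le univ (fun ε => univ.image (a ε))
          (k := r - 1) (fun ε _ => ?_) hD t (Tᶜ.image h) (by omega))
        · intro ε hε
          have hε := (Finset.mem_filter.1 hε).2
          simp only [Finset.mem_filter, Finset.mem_univ, true_and]
          intro v hv
          obtain ⟨l, hl, rfl⟩ := Finset.mem_image.1 hv
          rw [Finset.mem_compl] at hl
          rw [← hε]
          simp [hl]
        · rw [Finset.card_image_of_injective _ (ha ε)]
          simp)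
    refine h2.trans ?_
    rw [mul_comm]
    exact Nat.mul_le_mul_right _ hHc
  have h2 : (univ.filter fun x : ι × (Fin r → K → A) => ∀ l, (l ∉ T → F.lab (a x.1 l) = τ l) ∧
        (l ∈ T → x.2 l = τ l)) ⊆ X ×ˢ (univ.filter fun ω : Fin r → K → A => ∀ l ∈ T, ω l = τ l) := by
    rintro ⟨ε, ω⟩ hx
    simp only [hX, Finset.mem_filter, Finset.mem_univ, true_and, Finset.mem_product] at hx ⊢
    exact ⟨fun l => (hx l).1, fun l => (hx l).2⟩
  have h3 := card_pi_agree (G := K → A) T τ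
  rw [Fintype.card_fin, ht] at h3
  set n₀ := Fintype.card (K → A) with hn₀
  set N := (univ.filter fun ω : Fin r → K → A => ∀ l ∈ T, ω l = τ l).card with hN
  have h4 : N * n₀ ^ (t + 1) = n₀ ^ r := by
    rw [← h3, hN]
    congr
  calc _ ≤ (X.card * N) * n₀ := by
        rw [← Finset.card_product]
        exact Nat.mul_le_mul_right _ (Finset.card_le_card h2)
    _ ≤ (C' ^ r * ((C * n₀) ^ t * D)) * N * n₀ :=
        Nat.mul_le_mul_right _ (Nat.mul_le_mul_right _ (h1.trans (Nat.mul_le_mul_left _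
          (Nat.mul_le_mul_right _ (Nat.pow_le_pow_left hC _)))))
    _ = C' ^ r * C ^ t * D * (N * n₀ ^ (t + 1)) := by ring
    _ = C' ^ r * C ^ t * D * n₀ ^ r := by rw [h4]
    _ ≤ _ := by
        refine Nat.mul_le_mul_right _ (Nat.mul_le_mul_right _ (Nat.mul_le_mul_left _ ?_))
        exact (Nat.pow_le_pow_left (Nat.le_succ _) _).trans (Nat.pow_le_pow_right (by omega) (by omega))

end Labels

variable {A : Type*} [AddCommGroup A] [DecidableEq A] [Fintype A] {r κ : ℕ}
  (F : Frame V c (Fin r × Fin κ) A)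

/-- The part of a vector in one row. -/
def row (l : Fin r) (s : Fin r × Fin κ → A) : Fin r × Fin κ → A := fun i => if i.1 = l then s i else 0

/-- Replacement of the entries of `x` by vertices of types `m`, such that one row of the label sum
vanishes after any replacement. -/
def clear (m : Fin r → Fin c) (x : Fin r → V) (l : Fin r) : V × V :=
  (x l, F.vtx (m l) (F.lab (x l) - row l (∑ i, F.lab (x i))))

theorem lab_sel_clear (m : Fin r → Fin c) (x : Fin r → V) (U : Finset (Fin r)) (i : Fin r) :
    F.lab (sel (F.clear m x) U i) = F.lab (x i) - if i ∈ U then row i (∑ i, F.lab (x i)) else 0 := by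
  by_cases hi : i ∈ U <;> simp [sel, clear, hi, F.lab_vtx]

/-- The replacement at position `l` subtracts row `l` of the total, and replacements elsewhere do
not touch this row. So every position in `U` makes its own row of the sum vanish. -/
theorem sum_lab_sel_clear_mem (m : Fin r → Fin c) (x : Fin r → V) {U : Finset (Fin r)}
    (hU : U.Nonempty) : ∑ i, F.lab (sel (F.clear m x) U i) ∈ zeroRow r κ A := by
  obtain ⟨l, hl⟩ := hU
  refine ⟨l, fun k => ?_⟩
  simp only [lab_sel_clear, Finset.sum_sub_distrib, Pi.sub_apply, Finset.sum_apply]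
  rw [Finset.sum_eq_single (f := fun i => (if i ∈ U then row i (∑ i, F.lab (x i)) else 0) (l, k)) l]
  · simp [hl, row]
  · intro i _ hi
    by_cases hiU : i ∈ U <;> simp [hiU, row, hi.symm]
  · simp

-- Guess the label sum `s` of the set before clearing. Since clearing changes labels only by rows of
-- `s`, the `r - 1` vertices of `S` then determine all labels but one, and `s` determines the last.
-- The number of guesses is exactly compensated by the power saved in `card_labels_le`.
open scoped Classical in
theorem sum_card_clear_le {ι : Type*} [Fintype ι] {C C' D : ℕ} (a : ι → Fin r → V)
    (ha : ∀ ε, Function.Injective (a ε))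
    (hD : ∀ S : Finset V, S.card = r - 1 → (univ.filter fun ε => S ⊆ univ.image (a ε)).card ≤ D)
    (hC : Fintype.card V ≤ C * Fintype.card (Fin r × Fin κ → A)) (hfib : F.FibreLE C') (hC' : 1 ≤ C')
    (m m' : ι → Fin r → Fin c) {T : Finset (Fin r)} (hT : T.Nonempty) (U : Finset (Fin r))
    {S : Finset V} (hS : S.card + 1 = r) :
    ∑ ε, (univ.filter fun ω : Fin r → Fin r × Fin κ → A => S ⊆ univ.image (sel (F.clear (m' ε)
        (sel (fun l => (a ε l, F.vtx (m ε l) (ω l))) T)) U)).card ≤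
      r ^ r * (C' ^ r * (C + 1) ^ r * D) * Fintype.card (Fin r × Fin κ → A) ^ r := by
  set y : ι → (Fin r → Fin r × Fin κ → A) → Fin r → V := fun ε ω =>
    sel (fun l => (a ε l, F.vtx (m ε l) (ω l))) T with hy
  rw [sum_card_filter]
  have h1 : (univ.filter fun x : ι × (Fin r → Fin r × Fin κ → A) =>
      S ⊆ univ.image (sel (F.clear (m' x.1) (y x.1 x.2)) U)) ⊆
      (univ : Finset (S → Fin r)).biUnion fun g => univ.filter fun x =>
        ∀ u : S, sel (F.clear (m' x.1) (y x.1 x.2)) U (g u) = (u : V) := by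
    rintro x hx
    simp only [Finset.mem_filter, Finset.mem_univ, true_and, Finset.mem_biUnion] at hx ⊢
    have : ∀ u : S, ∃ i, sel (F.clear (m' x.1) (y x.1 x.2)) U i = (u : V) := by
      intro u
      simpa using hx u.2
    choose g hg using this
    exact ⟨g, hg⟩
  refine (Finset.card_le_card h1).trans (Finset.card_biUnion_le.trans ?_)
  set n₀ := Fintype.card (Fin r × Fin κ → A) with hn₀
  have hn₀pos : 0 < n₀ := Fintype.card_pos
  refine (Finset.sum_le_card_nsmul _ _ ((C' ^ r * (C + 1) ^ r * D) * n₀ ^ r) fun g _ => ?_).trans ?_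
  swap
  · rw [Finset.card_univ, Fintype.card_fun, Fintype.card_fin, Fintype.card_coe, smul_eq_mul,
      mul_assoc (r ^ r)]
    refine Nat.mul_le_mul_right _ (Nat.pow_le_pow_right (by omega) (by omega))
  by_cases hg : Function.Injective g
  swap
  · rw [Finset.filter_false_of_mem, Finset.card_empty]
    · exact Nat.zero_le _
    · intro x _ hx
      apply hg
      intro u u' huu
      apply Subtype.ext
      rw [← hx u, ← hx u', huu]
  obtain ⟨j, t, ht⟩ := F.exists_labels hS hg
  set τ' : (Fin r × Fin κ → A) → Fin r → Fin r × Fin κ → A := fun s i =>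
    t i + if i ∈ U then row i s else 0 with hτ'
  set τ : (Fin r × Fin κ → A) → Fin r → Fin r × Fin κ → A := fun s =>
    Function.update (τ' s) j (s - ∑ i ∈ univ.erase j, τ' s i) with hτ
  have h2 : (univ.filter fun x : ι × (Fin r → Fin r × Fin κ → A) =>
      ∀ u : S, sel (F.clear (m' x.1) (y x.1 x.2)) U (g u) = (u : V)) ⊆
      (univ : Finset (Fin r × Fin κ → A)).biUnion fun s => univ.filter fun x =>
        ∀ l, (l ∉ T → F.lab (a x.1 l) = τ s l) ∧ (l ∈ T → x.2 l = τ s l) := by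
    intro x hx
    simp only [Finset.mem_filter, Finset.mem_univ, true_and, Finset.mem_biUnion] at hx ⊢
    set s := ∑ i, F.lab (y x.1 x.2 i) with hs
    have h3 : ∀ i, i ≠ j → F.lab (y x.1 x.2 i) = τ' s i := by
      intro i hi
      have := ht _ hx i hi
      rw [lab_sel_clear] at this
      rw [hτ']
      simp only
      rw [← this]
      abel
    have h4 : ∀ i, F.lab (y x.1 x.2 i) = τ s i := by
      intro i
      by_cases hi : i = j
      · subst hi
        rw [hτ]
        simp only [Function.update_self]
        rw [← Finset.sum_congr rfl fun k hk => h3 k (Finset.ne_of_mem_erase hk), hs,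
          ← Finset.add_sum_erase univ _ (Finset.mem_univ i)]
        simp
      · rw [hτ]
        simp only [Function.update_of_ne hi]
        exact h3 i hi
    refine ⟨s, fun l => ⟨fun hl => ?_, fun hl => ?_⟩⟩
    · rw [← h4, hy]
      simp [sel, hl]
    · rw [← h4, hy]
      simp [sel, hl, F.lab_vtx]
  refine Nat.le_of_mul_le_mul_right (c := n₀) ?_ hn₀pos
  refine (Nat.mul_le_mul_right _ ((Finset.card_le_card h2).trans Finset.card_biUnion_le)).trans ?_
  rw [Finset.sum_mul]
  refine (Finset.sum_le_card_nsmul _ _ ((C' ^ r * (C + 1) ^ r * D) * n₀ ^ r) fun s _ => ?_).trans ?_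
  · exact F.card_labels_le a ha hD hC hfib hC' hT (τ s)
  · rw [Finset.card_univ, smul_eq_mul, mul_comm]

end Frame

theorem ofFn_map_fst {V : Type*} {ρ : ℕ} (p : Fin ρ → V × V) :
    (List.ofFn p).map Prod.fst = List.ofFn fun i => (p i).1 := by
  rw [List.map_ofFn]
  rfl

theorem toFinset_ofFn {V : Type*} [DecidableEq V] {ρ : ℕ} (a : Fin ρ → V) :
    (List.ofFn a).toFinset = univ.image a := by
  ext v
  simp

/-- Changing a set by an octahedron starting at it. -/
theorem oct_sub_sing_mem {V : Type*} [DecidableEq V] {ρ : ℕ} {p : Fin ρ → V × V}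
    (hp : Function.Injective fun i => (p i).1) :
    oct (List.ofFn p) - sing (univ.image fun i => (p i).1) ∈
      supp {e | ∃ T : Finset (Fin ρ), T.Nonempty ∧ e = univ.image (sel p T)} := by
  rw [← toFinset_ofFn, ← ofFn_map_fst]
  refine supp_mono ?_ (oct_sub_sing_mem_supp ?_)
  · rintro e ⟨n, h, hn⟩
    obtain ⟨T, hT, rfl⟩ := h.exists_sel
    exact ⟨T, Finset.card_pos.1 (by omega), rfl⟩
  · rw [ofFn_map_fst]
    exact List.nodup_ofFn_ofInjective hp

namespace Frame

variable {V : Type*} [DecidableEq V] [Fintype V] {c : ℕ}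
variable {A : Type*} [AddCommGroup A] [DecidableEq A] [Fintype A] {r κ : ℕ}
  (F : Frame V c (Fin r × Fin κ) A)

theorem sel_typ_cases {a y : Fin r → V} (T : Finset (Fin r)) (i : Fin r) :
    sel (fun l => (a l, y l)) T i = a i ∨ sel (fun l => (a l, y l)) T i = y i := by
  by_cases hi : i ∈ T <;> simp [sel, hi]

/-- After clearing, all new sets contain a vertex determined by its type. -/
theorem clear_mem {m' : Fin r → Fin c} {x : Fin r → V} (hx : Function.Injective x)
    (hm' : Function.Injective m') (hxm : ∀ i l, F.typ (x i) ≠ some (m' l)) :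
    (pts (List.ofFn (F.clear m' x))).Nodup ∧
    oct (List.ofFn (F.clear m' x)) - sing (univ.image x) ∈
      supp {e | (F.amb e).card ≤ r - 1 ∧ F.slab e ∈ zeroRow r κ A} := by
  have hnd : (pts (List.ofFn (F.clear m' x))).Nodup := by
    rw [nodup_pts_ofFn]
    refine ⟨fun i j h => hx h, fun i j h => ?_, fun i j h => ?_⟩
    · have := congrArg F.typ h
      simp only [clear, F.typ_vtx, Option.some_inj] at this
      exact hm' this
    · have := congrArg F.typ h
      simp only [clear, F.typ_vtx] at this
      exact hxm _ _ this
  refine ⟨hnd, supp_mono ?_ (oct_sub_sing_mem (p := F.clear m' x) hx)⟩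
  rintro _ ⟨U, ⟨l, hl⟩, rfl⟩
  have hinj := sel_injective hnd U
  refine ⟨?_, ?_⟩
  · have hz : sel (F.clear m' x) U l ∉ F.amb (univ.image (sel (F.clear m' x) U)) := by
      have hlt : F.typ (sel (F.clear m' x) U l) = some (m' l) := by
        simp [sel, hl, clear, F.typ_vtx]
      refine F.notMem_amb (by simp [hlt]) ?_
      intro v' hv' hvv
      obtain ⟨i, -, rfl⟩ := Finset.mem_image.1 hv'
      rw [hlt] at hvv
      by_cases hi : i ∈ U
      · simp only [sel, hi, if_true, clear, F.typ_vtx, Option.some_inj] at hvv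
        rw [hm' hvv]
      · simp only [sel, hi, if_false, clear] at hvv
        exact absurd hvv (hxm _ _)
    have h1 : (F.amb (univ.image (sel (F.clear m' x) U))).card <
        (univ.image (sel (F.clear m' x) U)).card :=
      Finset.card_lt_card ⟨F.amb_subset _, fun h => hz (h (Finset.mem_image_of_mem _ (by simp)))⟩
    rw [Finset.card_image_of_injective _ hinj, Finset.card_univ, Fintype.card_fin] at h1
    omega
  · rw [slab, Finset.sum_image fun i _ j _ h => hinj h]
    exact F.sum_lab_sel_clear_mem m' x ⟨l, hl⟩

open scoped Classical in
/-- The sets of a sparse family can be moved by sparse octahedra to sets with label sum vanishing in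
a row. -/
theorem exists_moves {ι : Type*} [Fintype ι] {C C' D : ℕ} (hr : 1 ≤ r) (hc : 3 * r < c) {Y : Finset V}
    (hY : ∀ m g, F.vtx m g ∈ Y) (x : ι → Finset V) (hx : ∀ ε, (x ε).card = r)
    (hdeg : ∀ S : Finset V, S.card = r - 1 → (univ.filter fun ε => S ⊆ x ε).card ≤ D)
    (hC : Fintype.card V ≤ C * Fintype.card (Fin r × Fin κ → A)) (hfib : F.FibreLE C') (hC' : 1 ≤ C')
    (hD : Real.log (Fintype.card V) ≤ D) :
    ∃ (O : ι → Chain V) (W : ι → Finset V) (P : Finset (Fin r → V × V)),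
      (∀ ε, O ε ∈ null r ∧ O ε ∈ supp {e | e ⊆ W ε} ∧ (W ε).card ≤ 2 * r ∧
        O ε - sing (x ε) ∈ supp {e | (e ∩ Y).Nonempty ∧ e ≠ x ε} ∧
        sing (x ε) - O ε ∈ Submodule.span ℤ ((fun p => oct (List.ofFn p)) '' (P : Set (Fin r → V × V)))
          ⊔ supp {e | (F.amb e).card ≤ r - 1 ∧ F.slab e ∈ zeroRow r κ A}) ∧
      (∀ p ∈ P, (pts (List.ofFn p)).Nodup ∧ ∃ i, F.typ (p i).1 ≠ none ∧ F.typ (p i).2 ≠ none) ∧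
      ∀ S : Finset V, S.card = r - 1 →
        (univ.filter fun ε => S ⊆ W ε).card ≤ 2 ^ r * 2 ^ r * (2 * (2 ^ r * (r + 1) ^ r * (C + 1) ^ r +
          2 ^ r * 2 ^ r * (r ^ r * (C' ^ r * (C + 1) ^ r)) + r)) * D ∧
        load P S ≤ 2 ^ r * 2 ^ r * (2 * (2 ^ r * (r + 1) ^ r * (C + 1) ^ r +
          2 ^ r * 2 ^ r * (r ^ r * (C' ^ r * (C + 1) ^ r)) + r)) * D := by
  have henum : ∀ ε, ∃ a : Fin r → V, Function.Injective a ∧ univ.image a = x ε := by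
    intro ε
    refine ⟨fun i => ((x ε).equivFinOfCardEq (hx ε)).symm i, fun i j h => ?_, ?_⟩
    · simpa using Subtype.ext h
    · ext v
      simp only [Finset.mem_image, Finset.mem_univ, true_and]
      constructor
      · rintro ⟨i, rfl⟩
        exact Subtype.prop _
      · intro hv
        exact ⟨(x ε).equivFinOfCardEq (hx ε) ⟨v, hv⟩, by simp⟩
  choose a ha hax using henum
  -- Twice `r` new types: those with `false` for the random move of `x ε`, those with `true` for the
  -- subsequent clearing.
  have hfresh : ∀ ε, ∃ m : Fin r × Bool → Fin c, Function.Injective m ∧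
      ∀ i, ∀ v ∈ x ε, F.typ v ≠ some (m i) := by
    intro ε
    obtain ⟨m, hm1, hm2⟩ := F.exists_fresh (univ : Finset (Fin r × Bool)) (x ε)
      (by rw [Finset.card_univ, hx]; simp; omega) (by omega)
    exact ⟨m, fun i j h => hm1 i (by simp) j (by simp) h, fun l v hv => hm2 l (by simp) v hv⟩
  choose m hm1 hm2 using hfresh
  have hax' : ∀ ε l, a ε l ∈ x ε := by
    intro ε l
    rw [← hax]
    exact Finset.mem_image_of_mem _ (by simp)
  set y : ι → (Fin r → Fin r × Fin κ → A) → Fin r → V := fun ε ω l => F.vtx (m ε (l, false)) (ω l)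
    with hy
  have hyt : ∀ ε ω l, F.typ (y ε ω l) = some (m ε (l, false)) := fun ε ω l => F.typ_vtx _ _
  set p₁ : ι → (Fin r → Fin r × Fin κ → A) → Fin r → V × V := fun ε ω l => (a ε l, y ε ω l) with hp₁
  set p₂ : ι → (Fin r → Fin r × Fin κ → A) → Finset (Fin r) → Fin r → V × V := fun ε ω T =>
    F.clear (fun l => m ε (l, true)) (sel (p₁ ε ω) T) with hp₂
  have hnd₁ : ∀ ε ω, (pts (List.ofFn (p₁ ε ω))).Nodup := by
    intro ε ω
    rw [nodup_pts_ofFn]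
    refine ⟨fun i j h => ha ε h, fun i j h => ?_, fun i j h => ?_⟩
    · have h1 := congrArg F.typ h
      simp only [hp₁, hyt, Option.some_inj] at h1
      exact (Prod.ext_iff.1 (hm1 ε h1)).1
    · have h1 := congrArg F.typ h
      simp only [hp₁, hyt] at h1
      exact hm2 ε _ _ (hax' ε i) h1
  have hsel₁ : ∀ ε ω T i l, F.typ (sel (p₁ ε ω) T i) ≠ some (m ε (l, true)) := by
    intro ε ω T i l h
    rcases sel_typ_cases (a := a ε) (y := y ε ω) T i with h1 | h1
    · rw [hp₁, h1] at h
      exact hm2 ε _ _ (hax' ε i) h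
    · rw [hp₁, h1, hyt, Option.some_inj] at h
      simpa using hm1 ε h
  have hclear := fun ε ω T => F.clear_mem (sel_injective (hnd₁ ε ω) T)
    (m' := fun l => m ε (l, true)) (fun i j h => (Prod.ext_iff.1 (hm1 ε h)).1) (hsel₁ ε ω T)
  -- Of the moving octahedron the whole vertex set is tracked, because it becomes a member of the
  -- family. Of the clearing octahedra only transversals are tracked, because they will be
  -- subdivided.
  obtain ⟨E, hE⟩ : ∃ E : ι → (Fin r → Fin r × Fin κ → A) → Finset V → Prop, ∀ ε ω S,
      E ε ω S ↔ (S ⊆ x ε ∪ univ.image (y ε ω) ∨ ∃ TU : Finset (Fin r) × Finset (Fin r),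
        TU.1.Nonempty ∧ S ⊆ univ.image (sel (p₂ ε ω TU.1) TU.2)) := ⟨_, fun _ _ _ => Iff.rfl⟩
  have hexp : ∀ S ∈ (univ : Finset V).powersetCard (r - 1), ∑ ε,
      (univ.filter fun ω => E ε ω S).card ≤ ((2 ^ r * (r + 1) ^ r * (C + 1) ^ r +
          2 ^ r * 2 ^ r * (r ^ r * (C' ^ r * (C + 1) ^ r))) * D) *
          Fintype.card (Fin r → Fin r × Fin κ → A) := by
    intro S hS
    have hS := (Finset.mem_powersetCard.1 hS).2
    have h1 := sum_card_cover_le (ι := ι) (κ := Fin r) (G := Fin r × Fin κ → A) x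
      (fun ε l => F.vtx (m ε (l, false))) (fun ε l => F.vtx_injective _)
      (k := r - 1) (s := r - 1) (D := D) (C := C) hC (fun ε => by rw [hx]; omega) le_rfl
      (fun _ => Or.inl rfl) hdeg S hS
    have h2 : 2 ^ (r - 1) * (Fintype.card (Fin r) + 1) ^ (r - 1) * (C + 1) ^ (r - 1) ≤
        2 ^ r * (r + 1) ^ r * (C + 1) ^ r := by
      rw [Fintype.card_fin]
      refine Nat.mul_le_mul (Nat.mul_le_mul (Nat.pow_le_pow_right (by omega) (by omega))
        (Nat.pow_le_pow_right (by omega) (by omega))) (Nat.pow_le_pow_right (by omega) (by omega))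
    replace h1 := h1.trans (Nat.mul_le_mul (Nat.mul_le_mul h2 le_rfl) le_rfl)
    have h3 : ∀ TU ∈ (univ : Finset (Finset (Fin r) × Finset (Fin r))).filter fun TU => TU.1.Nonempty,
        ∑ ε, (univ.filter fun ω => S ⊆ univ.image (sel (p₂ ε ω TU.1) TU.2)).card ≤
        r ^ r * (C' ^ r * (C + 1) ^ r * D) * Fintype.card (Fin r × Fin κ → A) ^ r := by
      intro TU hTU
      exact F.sum_card_clear_le a ha (fun S hS => by simpa only [hax] using hdeg S hS) hC hfib hC'
        (fun ε l => m ε (l, false)) (fun ε l => m ε (l, true)) (Finset.mem_filter.1 hTU).2 TU.2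
        (by omega)
    have h4 : ∀ ε, (univ.filter fun ω => E ε ω S).card ≤
        (univ.filter fun ω : Fin r → Fin r × Fin κ → A =>
          S ⊆ x ε ∪ univ.image fun l => F.vtx (m ε (l, false)) (ω l)).card +
        ∑ TU ∈ (univ : Finset (Finset (Fin r) × Finset (Fin r))).filter fun TU => TU.1.Nonempty,
          (univ.filter fun ω => S ⊆ univ.image (sel (p₂ ε ω TU.1) TU.2)).card := by
      intro ε
      refine (Finset.card_le_card ?_).trans ((Finset.card_union_le _ _).trans
        (Nat.add_le_add_left Finset.card_biUnion_le _))
      intro ω hω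
      simp only [Finset.mem_filter, Finset.mem_univ, true_and, Finset.mem_union,
        Finset.mem_biUnion] at hω ⊢
      exact (hE _ _ _).1 hω
    refine (Finset.sum_le_sum fun ε _ => h4 ε).trans ?_
    rw [Finset.sum_add_distrib, Finset.sum_comm]
    refine (Nat.add_le_add h1 ((Finset.sum_le_card_nsmul _ _ _ h3).trans
      (Nat.mul_le_mul_right _ (Finset.card_filter_le _ _)))).trans (le_of_eq ?_)
    rw [Finset.card_univ, Fintype.card_prod, Fintype.card_finset, Fintype.card_fin, Fintype.card_fun,
      Fintype.card_fin]
    ring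
  obtain ⟨ω, hω⟩ := exists_choice ((univ : Finset V).powersetCard (r - 1)) E _ (r * D) hexp
    (log_card_powersetCard_le hD)
  set P : Finset (Fin r → V × V) :=
    (univ ×ˢ (univ.filter fun T : Finset (Fin r) => T.Nonempty)).image fun x : ι × Finset (Fin r) =>
      p₂ x.1 (ω x.1) x.2 with hP
  have hyY : ∀ ε ω l, y ε ω l ∈ Y := fun ε ω l => hY _ _
  refine ⟨fun ε => oct (List.ofFn (p₁ ε (ω ε))), fun ε => x ε ∪ univ.image (y ε (ω ε)), P, ?_, ?_, ?_⟩
  · intro ε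
    have hsub := oct_sub_sing_mem (p := p₁ ε (ω ε)) (ha ε)
    have himg : (univ.image fun i => (p₁ ε (ω ε) i).1) = x ε := hax ε
    rw [himg] at hsub
    refine ⟨?_, ?_, ?_, supp_mono ?_ hsub, ?_⟩
    · simpa using oct_mem_null (hnd₁ ε (ω ε))
    · refine supp_mono ?_ (oct_mem_supp _)
      rintro e ⟨n, h⟩
      obtain ⟨T, -, rfl⟩ := h.exists_sel
      intro v hv
      obtain ⟨i, -, rfl⟩ := Finset.mem_image.1 hv
      rcases sel_typ_cases (a := a ε) (y := y ε (ω ε)) T i with h1 | h1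
      · rw [hp₁, h1]
        exact Finset.mem_union_left _ (hax' ε i)
      · rw [hp₁, h1]
        exact Finset.mem_union_right _ (Finset.mem_image_of_mem _ (by simp))
    · refine (Finset.card_union_le _ _).trans ?_
      have : (univ.image (y ε (ω ε))).card ≤ r := Finset.card_image_le.trans (by simp)
      rw [hx]
      omega
    · rintro _ ⟨T, ⟨l, hl⟩, rfl⟩
      have h1 : y ε (ω ε) l ∈ univ.image (sel (p₁ ε (ω ε)) T) :=
        Finset.mem_image.2 ⟨l, by simp, by simp [sel, hl, hp₁]⟩
      refine ⟨⟨y ε (ω ε) l, Finset.mem_inter.2 ⟨h1, hyY _ _ _⟩⟩, ?_⟩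
      intro h
      rw [h] at h1
      exact hm2 ε _ _ h1 (hyt _ _ _)
    · have hrw : sing (x ε) - oct (List.ofFn (p₁ ε (ω ε))) =
          -(oct (List.ofFn (p₁ ε (ω ε))) - sing (x ε)) := by abel
      rw [hrw]
      -- Every other transversal of the moving octahedron contains a random vertex, and is cleared
      -- by its own octahedron `p₂`, which turns it into sets with a zero row.
      refine Submodule.neg_mem _ ((supp_le_sup_supp _ ?_) hsub)
      rintro _ ⟨T, hT, rfl⟩
      have hrw2 : sing (univ.image (sel (p₁ ε (ω ε)) T)) = oct (List.ofFn (p₂ ε (ω ε) T)) -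
          (oct (List.ofFn (p₂ ε (ω ε) T)) - sing (univ.image (sel (p₁ ε (ω ε)) T))) := by abel
      rw [hrw2]
      refine Submodule.sub_mem _ (Submodule.mem_sup_left (Submodule.subset_span ⟨_, ?_, rfl⟩))
        (Submodule.mem_sup_right (hclear ε (ω ε) T).2)
      rw [hP]
      simp only [Finset.coe_image, Set.mem_image, Finset.mem_coe, Finset.mem_product,
        Finset.mem_univ, Finset.mem_filter, true_and]
      exact ⟨(ε, T), hT, rfl⟩
  · intro p hp
    obtain ⟨⟨ε, T⟩, hT, rfl⟩ := Finset.mem_image.1 hp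
    simp only [Finset.mem_product, Finset.mem_univ, Finset.mem_filter, true_and] at hT
    refine ⟨(hclear ε (ω ε) T).1, ?_⟩
    obtain ⟨l, hl⟩ := hT
    refine ⟨l, ?_, ?_⟩
    · simp [hp₂, clear, sel, hl, hp₁, hyt]
    · simp [hp₂, clear, F.typ_vtx]
  · intro S hS
    have h1 := hω S (Finset.mem_powersetCard.2 ⟨Finset.subset_univ _, hS⟩)
    have h2 : (univ.filter fun ε => E ε (ω ε) S).card ≤
        2 * (2 ^ r * (r + 1) ^ r * (C + 1) ^ r +
          2 ^ r * 2 ^ r * (r ^ r * (C' ^ r * (C + 1) ^ r)) + r) * D := h1.trans (le_of_eq (by ring))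
    have hpow : 1 ≤ 2 ^ r * 2 ^ r := Nat.mul_pos (by positivity) (by positivity)
    constructor
    · refine (Finset.card_le_card ?_).trans (h2.trans ?_)
      · intro ε hε
        simp only [Finset.mem_filter, Finset.mem_univ, true_and] at hε ⊢
        exact (hE _ _ _).2 (Or.inl hε)
      · refine Nat.mul_le_mul_right _ ?_
        exact Nat.le_mul_of_pos_left _ hpow
    · have h3 : ((P ×ˢ univ).filter fun x : (Fin r → V × V) × Finset (Fin r) =>
          S ⊆ univ.image (sel x.1 x.2)) ⊆ ((univ.filter fun ε => E ε (ω ε) S) ×ˢ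
          (univ : Finset (Finset (Fin r) × Finset (Fin r)))).image fun x =>
            (p₂ x.1 (ω x.1) x.2.1, x.2.2) := by
        rintro ⟨p, U⟩ hx
        simp only [Finset.mem_filter, Finset.mem_product, Finset.mem_univ, and_true] at hx
        obtain ⟨hp, hSU⟩ := hx
        obtain ⟨⟨ε, T⟩, hT, rfl⟩ := Finset.mem_image.1 hp
        simp only [Finset.mem_product, Finset.mem_univ, Finset.mem_filter, true_and] at hT
        refine Finset.mem_image.2 ⟨(ε, T, U), ?_, rfl⟩
        simp only [Finset.mem_product, Finset.mem_univ, Finset.mem_filter, true_and, and_true]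
        exact (hE _ _ _).2 (Or.inr ⟨(T, U), hT, hSU⟩)
      refine (Finset.card_le_card h3).trans (Finset.card_image_le.trans ?_)
      rw [Finset.card_product, Finset.card_univ, Fintype.card_prod, Fintype.card_finset,
        Fintype.card_fin, mul_comm, mul_assoc (2 ^ r * 2 ^ r)]
      exact Nat.mul_le_mul_left _ h2

end Frame

/-- The sparsity constant for the gadgets of a sparse family of octahedra. -/
def gadgetConst (q r C : ℕ) : ℕ := 2 ^ r * (2 * (2 ^ r * (q + 1) ^ r * (C + 1) ^ r + r))

/-! ### Correcting degrees: from divisible chains to null chains -/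

section Correction

variable {V : Type*} [DecidableEq V] [Fintype V]

/-- Double counting: an `r`-set containing `S` has `(r - |S|).choose (ρ - |S|)` intermediate
`ρ`-sets. -/
theorem sum_deg_superset {r ρ : ℕ} {φ : Chain V} (hφ : φ ∈ supp {e | e.card = r})
    {S : Finset V} (hS : S.card ≤ ρ) :
    (∑ T : Finset V, if S ⊆ T ∧ T.card = ρ then deg T φ else 0) =
      (r - S.card).choose (ρ - S.card) * deg S φ := by
  simp only [deg_apply, Finset.mul_sum]
  have h1 : ∀ T : Finset V, (if S ⊆ T ∧ T.card = ρ then ∑ e, (if T ⊆ e then φ e else 0) else 0) =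
      ∑ e, if (S ⊆ T ∧ T.card = ρ) ∧ T ⊆ e then φ e else 0 := by
    intro T
    by_cases h : S ⊆ T ∧ T.card = ρ <;> simp [h]
  rw [Finset.sum_congr rfl fun T _ => h1 T, Finset.sum_comm]
  refine Finset.sum_congr rfl fun e _ => ?_
  by_cases he : e.card = r
  · rw [← Finset.sum_filter, Finset.sum_const, nsmul_eq_mul]
    by_cases hSe : S ⊆ e
    · rw [if_pos hSe, ← he, ← Finset.card_filter_powersetCard_subset S e ρ hSe hS]
      congr 2
      congr 1
      ext T
      simp only [Finset.mem_filter, Finset.mem_univ, true_and, Finset.mem_powersetCard]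
      tauto
    · rw [if_neg hSe, mul_zero, Finset.filter_false_of_mem]
      · simp
      · rintro T - ⟨⟨h1, -⟩, h2⟩
        exact hSe (h1.trans h2)
  · rw [hφ e he]
    simp

/-- The degrees of a divisible chain, divided by the degrees of a clique, form a null chain. -/
theorem exists_null_of_divis {q r ρ : ℕ} (hρ : ρ < r) (hrq : r ≤ q) {φ : Chain V}
    (hφ : φ ∈ divis q r) (h0 : ∀ S : Finset V, S.card < ρ → deg S φ = 0) :
    ∃ ψ ∈ (null ρ : Submodule ℤ (Chain V)), ∀ S : Finset V, S.card = ρ →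
      deg S φ = ψ S * (q - ρ).choose (r - ρ) := by
  have hb : ((q - ρ).choose (r - ρ) : ℤ) ≠ 0 := by
    have := Nat.choose_pos (n := q - ρ) (k := r - ρ) (by omega)
    omega
  refine ⟨fun S => if S.card = ρ then deg S φ / (q - ρ).choose (r - ρ) else 0,
    ⟨fun e he => if_neg he, fun S hS => ?_⟩, fun S hS => ?_⟩
  · have h1 := sum_deg_superset hφ.1 hS.le
    rw [h0 S hS, mul_zero] at h1
    have h2 : deg S (fun S => if S.card = ρ then deg S φ / (q - ρ).choose (r - ρ) else 0) *
        (q - ρ).choose (r - ρ) = 0 := by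
      refine Eq.trans ?_ h1
      rw [deg_apply, Finset.sum_mul]
      refine Finset.sum_congr rfl fun T _ => ?_
      by_cases hT : S ⊆ T <;> by_cases hc : T.card = ρ <;> simp only [hT, hc, if_true, if_false,
        zero_mul, and_true, and_false, and_self]
      refine Int.ediv_mul_cancel ?_
      have := hφ.2 T (by omega)
      rwa [hc] at this
    exact (mul_eq_zero.1 h2).resolve_right hb
  · simp only [hS, if_true]
    refine (Int.ediv_mul_cancel ?_).symm
    have := hφ.2 S (by omega)
    rwa [hS] at this

theorem span_gadgets_le {q r : ℕ} {Y : Finset V} {C : ℕ} {𝒢 : Finset (Chain V × Finset V)}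
    (h : ∀ γ ∈ 𝒢, Gadget q r Y C γ) :
    Submodule.span ℤ ((fun γ => γ.1) '' (𝒢 : Set (Chain V × Finset V))) ≤ divis q r := by
  rw [Submodule.span_le]
  rintro _ ⟨γ, hγ, rfl⟩
  exact (h γ hγ).divis

end Correction

namespace Frame

variable {V : Type*} [DecidableEq V] [Fintype V] {c : ℕ} {K A : Type*} [AddCommGroup A]
  [Fintype K] [DecidableEq K] [DecidableEq A] [Fintype A] (F : Frame V c K A)

open scoped Classical in
/-- Sparse gadgets that correct the degrees of sets of size `ρ`. -/
theorem exists_correction {q r ρ : ℕ} (hρ : ρ < r) (hrq : r < q) (hc : 2 * r + q ≤ c)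
    (hc' : 4 * r < c) (hdiv : ∀ n, 1 ≤ n → n ≤ r → ∀ a : A, ∃ t, n • t = a)
    {Y : Finset V} (hY : ∀ m g, F.vtx m g ∈ Y) {C C' D : ℕ}
    (hC : Fintype.card V ≤ C * Fintype.card (K → A)) (hD : Real.log (Fintype.card V) ≤ D)
    (hfib : F.FibreLE C') (hC' : 1 ≤ C') (hA : Fintype.card A ^ ρ ≤ D) :
    ∃ 𝒢 : Finset (Chain V × Finset V), (∀ γ ∈ 𝒢, Gadget q r Y (r + q) γ) ∧
      (∀ S : Finset V, S.card = r - 1 → (𝒢.filter fun γ => S ⊆ γ.2).card ≤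
        gadgetConst q r C * (2 ^ r * r ^ r * (C' ^ (2 * r) * (2 ^ Fintype.card K) ^ r)) * D) ∧
      ∀ φ ∈ divis q r, (∀ S : Finset V, S.card < ρ → deg S φ = 0) →
        ∃ γ ∈ Submodule.span ℤ ((fun γ => γ.1) '' (𝒢 : Set (Chain V × Finset V))),
          ∀ S : Finset V, S.card < ρ + 1 → deg S (φ - γ) = 0 := by
  set P : Finset (Fin ρ → V × V) := univ.filter fun p => (pts (List.ofFn p)).Nodup ∧
    ∀ i, F.lab (p i).1 - F.lab (p i).2 ∈ univ.filter fun g => wt g ≤ 1 with hP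
  set lam := 2 ^ r * r ^ r * (C' ^ (2 * r) * (2 ^ Fintype.card K) ^ r) with hlam
  have hr : 1 ≤ r := by omega
  have hlampos : 1 ≤ lam := Nat.mul_pos (Nat.mul_pos (by positivity) (by positivity))
    (Nat.mul_pos (by positivity) (by positivity))
  -- With only ρ < r pairs, a ρ-set already fixes one label per pair, so no control of the label sum
  -- is needed. One-coordinate differences give O(|A|^ρ) patterns.
  have hload : ∀ S : Finset V, S.card = min ρ (r - 1) → load P S ≤ lam * D := by
    intro S hS
    rw [min_eq_left (by omega)] at hS
    refine (F.load_le_of_diff hfib (P := P) (fun p hp => (Finset.mem_filter.1 hp).2.2) hS).trans ?_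
    have h1 := card_ball_le (K := K) (A := A) 1
    rw [pow_one] at h1
    have h3 : ρ ^ ρ ≤ r ^ r :=
      (Nat.pow_le_pow_left hρ.le _).trans (Nat.pow_le_pow_right (by omega) hρ.le)
    calc 2 ^ ρ * ρ ^ ρ * (C' ^ (2 * ρ) * (univ.filter fun g : K → A => wt g ≤ 1).card ^ ρ)
        ≤ 2 ^ r * r ^ r * (C' ^ (2 * r) * ((2 ^ Fintype.card K) ^ r * D)) := by
          refine Nat.mul_le_mul (Nat.mul_le_mul (Nat.pow_le_pow_right (by omega) hρ.le) h3)
            (Nat.mul_le_mul (Nat.pow_le_pow_right hC' (by omega)) ?_)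
          refine (Nat.pow_le_pow_left h1 _).trans ?_
          rw [mul_pow]
          exact Nat.mul_le_mul (Nat.pow_le_pow_right (by positivity) hρ.le) hA
      _ = lam * D := by rw [hlam]; ring
  obtain ⟨𝒢, h𝒢, hdeg, hspan⟩ := F.exists_gadgets hr hρ.le hrq hc hY hC (D := lam * D)
    (hD.trans (by exact_mod_cast Nat.le_mul_of_pos_left _ hlampos)) P
    (fun p hp => (Finset.mem_filter.1 hp).2.1) hload (fun h => by omega)
  refine ⟨𝒢, h𝒢, fun S hS => (hdeg S hS).trans (le_of_eq ?_), fun φ hφ h0 => ?_⟩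
  · rw [gadgetConst]
    ring
  · obtain ⟨ψ, hψ, hψφ⟩ := exists_null_of_divis hρ hrq.le hφ h0
    -- Neither a restriction on label sums nor a typed pair is required below uniformity `r`, so `Z`
    -- is everything and all `ρ` vertices may be ambiguous.
    have h1 := F.mem_span_shift hdiv hρ.le hc' (Z := Set.univ) (fun _ _ _ _ => trivial) ρ (by omega)
      le_rfl ψ hψ (by
        refine supp_mono ?_ hψ.1
        intro e he
        exact ⟨(Finset.card_le_card (F.amb_subset e)).trans (le_of_eq he), trivial⟩)
    have h2 : ψ ∈ Submodule.span ℤ ((fun p => oct (List.ofFn p)) '' (P : Set (Fin ρ → V × V))) := by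
      refine Submodule.span_mono ?_ h1
      rintro _ ⟨L, hL, rfl⟩
      have hLlen : L.length = ρ := by rcases hL with hL | hL <;> exact hL.length
      obtain ⟨p, rfl⟩ := exists_ofFn hLlen
      refine ⟨p, ?_, rfl⟩
      simp only [hP, Finset.coe_filter, Finset.mem_univ, true_and, Set.mem_ofPred_eq,
        Finset.mem_filter]
      refine ⟨by rcases hL with hL | hL <;> exact hL.nodup, fun i => ?_⟩
      have hi : p i ∈ List.ofFn p := by simp
      rcases hL with hL | hL
      · obtain ⟨k, hk⟩ := hL.shift _ hi
        rw [hk, sub_sub_cancel]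
        exact wt_le_one (k := k) fun j hj => Pi.single_eq_of_ne hj _
      · exact hL.diff _ hi
    -- Replacing each octahedron in the expression of `ψ` by its product with a clique gives a chain
    -- whose `ρ`-degrees are the wanted multiples of `ψ` and whose smaller degrees vanish.
    have h3 : ∃ γ ∈ Submodule.span ℤ ((fun γ => γ.1) '' (𝒢 : Set (Chain V × Finset V))),
        (∀ S : Finset V, S.card < ρ → deg S γ = 0) ∧
        ∀ S : Finset V, S.card = ρ → deg S γ = ψ S * (q - ρ).choose (r - ρ) := by
      refine Submodule.span_induction ?_ ?_ ?_ ?_ h2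
      · rintro _ ⟨p, hp, rfl⟩
        have hnd : (pts (List.ofFn p)).Nodup := (Finset.mem_filter.1 hp).2.1
        obtain ⟨B, hB, hd, hmem⟩ := hspan p hp
        refine ⟨_, hmem, fun S hS => ?_, fun S hS => ?_⟩
        · exact deg_octOn_of_card_lt hnd (fun v hv => avoids_clique (hd v hv)) (by simpa using hS)
        · exact deg_octOn_clique (by simp) hnd hB hd hS
      · exact ⟨0, Submodule.zero_mem _, by simp, by simp⟩
      · rintro ψ₁ ψ₂ - - ⟨γ₁, h1, h2, h3⟩ ⟨γ₂, h4, h5, h6⟩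
        refine ⟨γ₁ + γ₂, Submodule.add_mem _ h1 h4, fun S hS => ?_, fun S hS => ?_⟩
        · rw [map_add, h2 S hS, h5 S hS, add_zero]
        · rw [map_add, h3 S hS, h6 S hS, Pi.add_apply, add_mul]
      · rintro a ψ₁ - ⟨γ₁, h1, h2, h3⟩
        refine ⟨a • γ₁, Submodule.smul_mem _ _ h1, fun S hS => ?_, fun S hS => ?_⟩
        · rw [map_smul, h2 S hS, smul_zero]
        · rw [map_smul, h3 S hS, Pi.smul_apply, smul_eq_mul, smul_eq_mul, mul_assoc]
    obtain ⟨γ, hγ, hγ1, hγ2⟩ := h3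
    refine ⟨γ, hγ, fun S hS => ?_⟩
    rw [map_sub]
    rcases Nat.lt_or_ge S.card ρ with h | h
    · rw [h0 S h, hγ1 S h, sub_zero]
    · have hS' : S.card = ρ := by omega
      rw [hψφ S hS', hγ2 S hS', sub_self]

open scoped Classical in
/-- Sparse gadgets that turn divisible chains into null chains. -/
theorem exists_corrections {q r : ℕ} (hr : 1 ≤ r) (hrq : r < q) (hc : 2 * r + q ≤ c)
    (hc' : 4 * r < c) (hdiv : ∀ n, 1 ≤ n → n ≤ r → ∀ a : A, ∃ t, n • t = a)
    {Y : Finset V} (hY : ∀ m g, F.vtx m g ∈ Y) {C C' D : ℕ}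
    (hC : Fintype.card V ≤ C * Fintype.card (K → A)) (hD : Real.log (Fintype.card V) ≤ D)
    (hfib : F.FibreLE C') (hC' : 1 ≤ C') (hA : Fintype.card A ^ (r - 1) ≤ D) :
    ∃ 𝒢 : Finset (Chain V × Finset V), (∀ γ ∈ 𝒢, Gadget q r Y (r + q) γ) ∧
      (∀ S : Finset V, S.card = r - 1 → (𝒢.filter fun γ => S ⊆ γ.2).card ≤
        r * (gadgetConst q r C * (2 ^ r * r ^ r * (C' ^ (2 * r) * (2 ^ Fintype.card K) ^ r))) * D) ∧
      ∀ φ ∈ divis q r,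
        ∃ γ ∈ Submodule.span ℤ ((fun γ => γ.1) '' (𝒢 : Set (Chain V × Finset V))), φ - γ ∈ null r := by
  have h1 := fun (ρ : Fin r) => F.exists_correction (ρ := ρ) ρ.2 hrq hc hc' hdiv hY hC hD hfib hC'
    ((Nat.pow_le_pow_right Fintype.card_pos (by omega)).trans hA)
  choose 𝒢 h𝒢 hdeg hspan using h1
  set 𝒰 : Finset (Chain V × Finset V) := univ.biUnion 𝒢 with h𝒰
  have h𝒰g : ∀ γ ∈ 𝒰, Gadget q r Y (r + q) γ := by
    intro γ hγ
    obtain ⟨ρ, -, hρ⟩ := Finset.mem_biUnion.1 hγ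
    exact h𝒢 ρ γ hρ
  refine ⟨𝒰, h𝒰g, fun S hS => ?_, fun φ hφ => ?_⟩
  · rw [h𝒰, Finset.filter_biUnion]
    refine Finset.card_biUnion_le.trans ((Finset.sum_le_card_nsmul _ _ _ fun ρ _ => hdeg ρ S hS).trans
      (le_of_eq ?_))
    rw [Finset.card_univ, Fintype.card_fin, smul_eq_mul]
    ring
  · have key : ∀ ρ ≤ r, ∃ γ ∈ Submodule.span ℤ ((fun γ => γ.1) '' (𝒰 : Set (Chain V × Finset V))),
        ∀ S : Finset V, S.card < ρ → deg S (φ - γ) = 0 := by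
      intro ρ hρ
      induction ρ with
      | zero => exact ⟨0, Submodule.zero_mem _, fun S hS => by omega⟩
      | succ ρ ih =>
        obtain ⟨γ, hγ, h0⟩ := ih (by omega)
        obtain ⟨γ', hγ', h0'⟩ := hspan ⟨ρ, hρ⟩ (φ - γ)
          (Submodule.sub_mem _ hφ (span_gadgets_le h𝒰g hγ)) h0
        refine ⟨γ + γ', Submodule.add_mem _ hγ (Submodule.span_mono (Set.image_mono ?_) hγ'), ?_⟩
        · intro x hx
          exact Finset.mem_biUnion.2 ⟨⟨ρ, hρ⟩, by simp, hx⟩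
        · intro S hS
          rw [← sub_sub]
          exact h0' S hS
    obtain ⟨γ, hγ, h0⟩ := key r le_rfl
    exact ⟨γ, hγ, (Submodule.sub_mem _ hφ.1 (span_gadgets_le h𝒰g hγ).1), h0⟩

end Frame

/-! ### Choosing the label group and the frame -/

-- Take the largest `N` of the form `r! * j + 1` with `c * N ^ k ≤ y`. Being 1 modulo each `n ≤ r`,
-- it is coprime to `n`; the next candidate is at most `(r! + 1) * N`, which gives the upper bound
-- on `y`.
open scoped Nat in
theorem exists_modulus (r k c y : ℕ) (hc : 1 ≤ c) (hk : 1 ≤ k) (hy : c ≤ y) :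
    ∃ N : ℕ, 1 ≤ N ∧ (∀ n, 1 ≤ n → n ≤ r → n.Coprime N) ∧ c * N ^ k ≤ y ∧
      y ≤ c * (r ! + 1) ^ k * N ^ k := by
  classical
  have hex : ∃ j, y < c * (r ! * j + 1) ^ k := by
    refine ⟨y, ?_⟩
    calc y < r ! * y + 1 := Nat.lt_succ_of_le (Nat.le_mul_of_pos_left _ (Nat.factorial_pos r))
      _ ≤ (r ! * y + 1) ^ k := Nat.le_self_pow (by omega) _
      _ ≤ c * (r ! * y + 1) ^ k := Nat.le_mul_of_pos_left _ hc
  have h0 : Nat.find hex ≠ 0 := by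
    intro h
    have := Nat.find_spec hex
    rw [h] at this
    simp at this
    omega
  obtain ⟨j, hj⟩ := Nat.exists_eq_succ_of_ne_zero h0
  have h1 := Nat.find_spec hex
  have h2 := Nat.find_min hex (m := j) (by omega)
  rw [hj] at h1
  refine ⟨r ! * j + 1, by omega, fun n hn hnr => ?_, by omega, h1.le.trans ?_⟩
  · have hd : n ∣ r ! * j := (Nat.dvd_factorial hn hnr).mul_right _
    obtain ⟨t, ht⟩ := hd
    rw [ht]
    simp
  · rw [mul_assoc, ← mul_pow]
    refine Nat.mul_le_mul_left _ (Nat.pow_le_pow_left ?_ _)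
    have : r ! * (j + 1) + 1 = (r ! * j + 1) + r ! := by ring
    rw [Nat.succ_eq_add_one, this]
    nlinarith [Nat.zero_le (r ! * (r ! * j))]

theorem ZMod_exists_nsmul {N n : ℕ} (h : n.Coprime N) (a : ZMod N) : ∃ t, n • t = a :=
  ⟨(n : ZMod N)⁻¹ * a, by
    rw [nsmul_eq_mul, ← mul_assoc, ZMod.coe_mul_inv_eq_one n h, one_mul]⟩

/-- Every large set of vertices supports a frame with small fibres. -/
theorem exists_frame {V : Type*} [Fintype V] [DecidableEq V] {c C : ℕ} {K A : Type*} [AddCommGroup A]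
    [Fintype K] [DecidableEq K] [Fintype A] [DecidableEq A] {Y : Finset V}
    (hc : c * Fintype.card (K → A) ≤ Y.card) (hC : Fintype.card V ≤ C * Fintype.card (K → A)) :
    ∃ F : Frame V c K A, (∀ m g, F.vtx m g ∈ Y) ∧ F.FibreLE (c + C) := by
  classical
  obtain ⟨e⟩ : Nonempty (Fin c × (K → A) ↪ Y) :=
    Function.Embedding.nonempty_of_card_le (by simpa [Fintype.card_prod] using hc)
  obtain ⟨l⟩ : Nonempty (V ↪ Fin C × (K → A)) :=
    Function.Embedding.nonempty_of_card_le (by simpa [Fintype.card_prod] using hC)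
  set f : Fin c × (K → A) → V := fun p => e p with hf
  have hfi : Function.Injective f := Subtype.val_injective.comp e.injective
  have hpi := hfi.isPartialInv
  have h1 : ∀ p, Function.partialInv f (f p) = some p := fun p => (hpi p (f p)).2 rfl
  -- Untyped vertices take their labels from the second embedding, whose only purpose is to bound
  -- the fibres: a label occurs at most `c` times on typed and `C` times on untyped vertices.
  refine ⟨⟨fun m g => f (m, g), fun v => (Function.partialInv f v).map Prod.fst,
    fun v => (Function.partialInv f v).elim (l v).2 Prod.snd, fun m g => ?_, fun m g => ?_,
    fun m v h => ?_⟩, fun m g => (e (m, g)).2, fun g => ?_⟩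
  · simp [h1]
  · simp [h1]
  · obtain ⟨p, hp, rfl⟩ := Option.map_eq_some_iff.1 h
    simp only [hp, Option.elim_some]
    exact (hpi p v).1 hp
  · refine (Finset.card_le_card (t := (univ.image fun m : Fin c => f (m, g)) ∪
      univ.filter fun v => (l v).2 = g) ?_).trans ((Finset.card_union_le _ _).trans
      (Nat.add_le_add ?_ ?_))
    · intro v hv
      simp only [Finset.mem_filter, Finset.mem_univ, true_and] at hv
      rw [Finset.mem_union]
      cases hp : Function.partialInv f v with
      | none => right; simpa [hp] using hv
      | some p =>
        left
        rw [hp, Option.elim_some] at hv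
        refine Finset.mem_image.2 ⟨p.1, Finset.mem_univ _, ?_⟩
        rw [← hv]
        exact (hpi p v).1 hp
    · exact Finset.card_image_le.trans (by simp)
    · refine (Finset.card_le_card_of_injOn (t := (univ : Finset (Fin C))) (fun v => (l v).1) (by simp)
        ?_).trans (by simp)
      intro v hv v' hv' h
      simp only [Finset.coe_filter, Finset.mem_univ, true_and, Set.mem_ofPred_eq] at hv hv'
      exact l.injective (Prod.ext h (hv.trans hv'.symm))

open scoped Classical in
/-- The sets `x ε` can be moved, by sparse divisible chains `O ε`, to sets that meet `Y`, in such a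
way that the resulting divisible sums are spanned by sparse gadgets. -/
def Refinable {V ι : Type*} [DecidableEq V] [Fintype V] [Fintype ι] (q r : ℕ) (Y : Finset V)
    (x : ι → Finset V) (C D : ℕ) : Prop :=
  ∃ (O : ι → Chain V) (W : ι → Finset V) (𝒢 : Finset (Chain V × Finset V)),
    (∀ ε, O ε ∈ divis q r ∧ O ε ∈ supp {e | e ⊆ W ε} ∧ (W ε).card ≤ C ∧
      O ε - sing (x ε) ∈ supp {e | (e ∩ Y).Nonempty ∧ e ≠ x ε}) ∧
    (∀ γ ∈ 𝒢, Gadget q r Y C γ) ∧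
    (∀ S : Finset V, S.card = r - 1 →
      (univ.filter fun ε => S ⊆ W ε).card + (𝒢.filter fun γ => S ⊆ γ.2).card ≤ D) ∧
    ∀ L : Finset ι, ∑ ε ∈ L, sing (x ε) ∈ divis q r →
      ∑ ε ∈ L, (sing (x ε) - O ε) ∈
        Submodule.span ℤ ((fun γ => γ.1) '' (𝒢 : Set (Chain V × Finset V)))

theorem card_filter_sum {α β : Type*} [Fintype α] [Fintype β] (P : α ⊕ β → Prop) [DecidablePred P] :
    (univ.filter P).card =
      (univ.filter fun a => P (Sum.inl a)).card + (univ.filter fun b => P (Sum.inr b)).card := by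
  simp only [Finset.card_filter, Fintype.sum_sum_type]

theorem eq_sum_subtype {V : Type*} [DecidableEq V] {E : Finset V → Prop} [Fintype {e // E e}]
    {φ : Chain V} (h : φ ∈ supp {e | E e}) : φ = ∑ e : {e // E e}, φ e • sing e.1 := by
  ext f
  rw [Finset.sum_apply]
  simp only [Pi.smul_apply, sing_apply, smul_eq_mul]
  by_cases hf : E f
  · rw [Finset.sum_eq_single ⟨f, hf⟩ (fun e _ he => ?_) (by simp)]
    · simp
    · rw [if_neg fun hfe => he (Subtype.ext hfe.symm), mul_zero]
  · rw [h f hf, Finset.sum_eq_zero]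
    rintro ⟨e, he⟩ -
    rw [if_neg (by rintro rfl; exact hf he), mul_zero]

/-! ### Assembling moves, corrections and spanning gadgets -/

namespace Frame

variable {V : Type*} [DecidableEq V] [Fintype V] {c : ℕ} {A : Type*} [AddCommGroup A]
  [DecidableEq A] [Fintype A]

open scoped Classical in
/-- The possible pairs of the label sum and the label differences of shift octahedra and local
octahedra. -/
theorem card_shapes_le {r κ h : ℕ} {D : ℕ} (hκ : h + r ≤ κ * (r - 1))
    (hA : Fintype.card A ^ (κ * (r - 1)) ≤ D) :
    ∃ 𝒟 : Finset ((Fin r × Fin κ → A) × (Fin r → Fin r × Fin κ → A)),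
      (∀ s ∈ zeroRow r κ A, ∀ k : Fin r → Fin r × Fin κ, (s, fun i => Pi.single (k i) (s (k i))) ∈ 𝒟) ∧
      (∀ s d, wt s ≤ h → (∀ i, wt (d i) ≤ 1) → (s, d) ∈ 𝒟) ∧
      𝒟.card ≤ (r * (r * κ) ^ r + 2 ^ (r * κ) * (2 ^ (r * κ)) ^ r) * D := by
  refine ⟨((univ.filter fun s : Fin r × Fin κ → A => s ∈ zeroRow r κ A) ×ˢ
      (univ : Finset (Fin r → Fin r × Fin κ))).image (fun x => (x.1, fun i =>
        Pi.single (x.2 i) (x.1 (x.2 i)))) ∪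
    (univ.filter fun g : Fin r × Fin κ → A => wt g ≤ h) ×ˢ
      Fintype.piFinset fun _ : Fin r => univ.filter fun g : Fin r × Fin κ → A => wt g ≤ 1, ?_, ?_, ?_⟩
  · intro s hs k
    refine Finset.mem_union_left _ (Finset.mem_image.2 ⟨(s, k), ?_, rfl⟩)
    simpa using hs
  · intro s d hs hd
    refine Finset.mem_union_right _ (Finset.mem_product.2 ⟨by simpa using hs, ?_⟩)
    rw [Fintype.mem_piFinset]
    intro i
    simpa using hd i
  · have h1 := card_zeroRow_le (A := A) r κ
    have h2 := card_ball_le (K := Fin r × Fin κ) (A := A) h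
    have h3 := card_ball_le (K := Fin r × Fin κ) (A := A) 1
    rw [Fintype.card_prod, Fintype.card_fin, Fintype.card_fin] at h2 h3
    rw [pow_one] at h3
    refine (Finset.card_union_le _ _).trans ?_
    rw [add_mul]
    refine Nat.add_le_add (Finset.card_image_le.trans ?_) ?_
    · rw [Finset.card_product, Finset.card_univ, Fintype.card_fun, Fintype.card_prod,
        Fintype.card_fin, Fintype.card_fin]
      refine (Nat.mul_le_mul_right _ (h1.trans (Nat.mul_le_mul_left _ hA))).trans (le_of_eq ?_)
      ring
    · rw [Finset.card_product, Fintype.card_piFinset_const]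
      refine (Nat.mul_le_mul h2 (Nat.pow_le_pow_left h3 _)).trans ?_
      -- Local shapes cost `h` coordinates for the sum and one for each of the `r` differences; κ is
      -- chosen large enough that `h + r` stays below the exponent of the zero-row count.
      rw [mul_pow, mul_mul_mul_comm, ← pow_add]
      refine Nat.mul_le_mul_left _ (le_trans ?_ hA)
      rcases Nat.eq_zero_or_pos (h + r) with h0 | h0
      · rw [h0, pow_zero]
        exact Nat.one_le_pow _ _ Fintype.card_pos
      · exact Nat.pow_le_pow_right Fintype.card_pos hκ

end Frame

end Chain

namespace Chain
namespace Frame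

variable {V : Type*} [DecidableEq V] [Fintype V] {c r κ : ℕ} {A : Type*} [AddCommGroup A]
  [DecidableEq A] [Fintype A] (F : Frame V c (Fin r × Fin κ) A)

open scoped Classical in
/-- Sparse gadgets that span a sparse family of octahedra and all null chains that can be left over. -/
theorem exists_spanning_gadgets {q : ℕ} (hr : 2 ≤ r) (hrq : r < q) (hc : 2 * r + q ≤ c)
    (hc' : 4 * r < c) (hdiv : ∀ n, 1 ≤ n → n ≤ r → ∀ a : A, ∃ t, n • t = a)
    (hκ : r + 2 * r * r + r ≤ κ)
    {Y : Finset V} (hY : ∀ m g, F.vtx m g ∈ Y) {C C' D ν : ℕ}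
    (hC : Fintype.card V ≤ C * Fintype.card (Fin r × Fin κ → A)) (hD : Real.log (Fintype.card V) ≤ D)
    (hfib : F.FibreLE C') (hC' : 1 ≤ C') (hA : Fintype.card A ^ (κ * (r - 1)) ≤ D)
    (P : Finset (Fin r → V × V))
    (hP : ∀ p ∈ P, (pts (List.ofFn p)).Nodup ∧ ∃ i, F.typ (p i).1 ≠ none ∧ F.typ (p i).2 ≠ none)
    (hload : ∀ S : Finset V, S.card = r - 1 → load P S ≤ ν * D) :
    ∃ 𝒢 : Finset (Chain V × Finset V), (∀ γ ∈ 𝒢, Gadget q r Y (r + q) γ) ∧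
      (∀ S : Finset V, S.card = r - 1 → (𝒢.filter fun γ => S ⊆ γ.2).card ≤
        gadgetConst q r C * (ν + 2 ^ r * r ^ r * (C' ^ (2 * r) *
          (r * (r * κ) ^ r + 2 ^ (r * κ) * (2 ^ (r * κ)) ^ r))) * D) ∧
      Submodule.span ℤ ((fun p => oct (List.ofFn p)) '' (P : Set (Fin r → V × V))) ≤
        Submodule.span ℤ ((fun γ => γ.1) '' (𝒢 : Set (Chain V × Finset V))) ∧
      null r ⊓ supp {e | (F.amb e).card ≤ r - 1 ∧ F.slab e ∈ zeroRow r κ A} ≤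
        Submodule.span ℤ ((fun γ => γ.1) '' (𝒢 : Set (Chain V × Finset V))) := by
  -- The weight `r + 2 * r * r` is the bound for local octahedra in `mem_span_shift` with `r - 1`
  -- ambiguous vertices.
  obtain ⟨𝒟, h𝒟1, h𝒟2, h𝒟⟩ := card_shapes_le (r := r) (κ := κ) (h := r + 2 * r * r) (A := A) (D := D)
    (hκ.trans (Nat.le_mul_of_pos_right _ (by omega))) hA
  obtain ⟨Q, hQ⟩ : ∃ Q : Finset (Fin r → V × V), ∀ p, p ∈ Q ↔ (pts (List.ofFn p)).Nodup ∧
      (∃ i, F.typ (p i).1 ≠ none ∧ F.typ (p i).2 ≠ none) ∧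
      (∑ i, F.lab (p i).1, fun i => F.lab (p i).1 - F.lab (p i).2) ∈ 𝒟 :=
    ⟨univ.filter _, fun p => Finset.mem_filter.trans (and_iff_right (Finset.mem_univ _))⟩
  set β := 2 ^ r * r ^ r * (C' ^ (2 * r) * (r * (r * κ) ^ r + 2 ^ (r * κ) * (2 ^ (r * κ)) ^ r)) with hβ
  have hβpos : 1 ≤ β := Nat.mul_pos (Nat.mul_pos (by positivity) (by positivity))
    (Nat.mul_pos (by positivity) (by positivity))
  obtain ⟨𝒢, h𝒢, hdeg, hspan⟩ := F.exists_gadgets (by omega) le_rfl hrq hc hY hC (D := (ν + β) * D)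
    (hD.trans (by exact_mod_cast Nat.le_mul_of_pos_left _ (by omega))) (P ∪ Q)
    (fun p hp => (Finset.mem_union.1 hp).elim (fun h => (hP p h).1) fun h => ((hQ p).1 h).1)
    (fun S hS => by
      rw [min_eq_right (by omega)] at hS
      refine (load_union_le P Q S).trans ?_
      rw [add_mul]
      refine Nat.add_le_add (hload S hS) ((F.load_le_of_sum hfib
        (fun p hp => ((hQ p).1 hp).2.2) (by omega)).trans ?_)
      exact (Nat.mul_le_mul_left _ (Nat.mul_le_mul_left _ h𝒟)).trans (le_of_eq (by rw [hβ]; ring)))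
    (fun _ p hp => (Finset.mem_union.1 hp).elim (fun h => (hP p h).2) fun h => ((hQ p).1 h).2.1)
  have hoct : ∀ p ∈ P ∪ Q, oct (List.ofFn p) ∈
      Submodule.span ℤ ((fun γ => γ.1) '' (𝒢 : Set (Chain V × Finset V))) := by
    intro p hp
    obtain ⟨B, -, -, h⟩ := hspan p hp
    rw [Nat.sub_self, clique_zero] at h
    exact h
  refine ⟨𝒢, h𝒢, fun S hS => (hdeg S hS).trans (le_of_eq ?_), ?_, ?_⟩
  · rw [gadgetConst, mul_assoc _ (ν + β)]
  · rw [Submodule.span_le]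
    rintro _ ⟨p, hp, rfl⟩
    exact hoct p (Finset.mem_union_left _ hp)
  · rintro φ ⟨hφ, hE⟩
    have h1 := F.mem_span_shift hdiv le_rfl hc' (Z := zeroRow r κ A) (by
      rintro s ⟨l, hl⟩ s' h
      refine ⟨l, fun k => ?_⟩
      rcases h (l, k) with h | h
      · exact h
      · rw [h, hl]) (r - 1) (by omega) (by omega) φ hφ hE
    refine Submodule.span_le.2 ?_ h1
    rintro _ ⟨L, hL, rfl⟩
    have hlen : L.length = r := by rcases hL with hL | hL <;> exact hL.length
    obtain ⟨p, rfl⟩ := exists_ofFn hlen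
    have hmem : ∀ i, p i ∈ List.ofFn p := fun i => by simp
    refine hoct p (Finset.mem_union_right _ ((hQ p).2 ⟨?_, ?_, ?_⟩))
    · rcases hL with hL | hL <;> exact hL.nodup
    · obtain ⟨v, hv, h⟩ : ∃ v ∈ List.ofFn p, F.typ v.1 ≠ none ∧ F.typ v.2 ≠ none := by
        rcases hL with hL | hL <;> exact hL.typed (by omega)
      obtain ⟨i, rfl⟩ := (List.mem_ofFn' p v).1 hv
      exact ⟨i, h⟩
    · rcases hL with hL | hL
      · choose k hk using fun i => hL.shift _ (hmem i)
        have h2 := h𝒟1 _ hL.sum k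
        rw [F.lsum_ofFn] at h2 hk
        convert h2 using 3 with i
        rw [hk, sub_sub_cancel]
      · refine h𝒟2 _ _ ?_ fun i => hL.diff _ (hmem i)
        have h2 := hL.sum
        rw [F.lsum_ofFn, Nat.sub_add_cancel (by omega)] at h2
        exact h2

end Frame

/-- The sparsity constant for the moves. -/
def moveConst (r C C' : ℕ) : ℕ :=
  2 ^ r * 2 ^ r * (2 * (2 ^ r * (r + 1) ^ r * (C + 1) ^ r +
    2 ^ r * 2 ^ r * (r ^ r * (C' ^ r * (C + 1) ^ r)) + r))

/-- The sparsity constant for the gadgets that correct degrees. -/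
def correctConst (q r κ C C' : ℕ) : ℕ :=
  r * (gadgetConst q r C * (2 ^ r * r ^ r * (C' ^ (2 * r) * (2 ^ (r * κ)) ^ r)))

/-- The sparsity constant for the moves of the given sets and of the sets in correcting gadgets. -/
def totalMoveConst (q r κ C C' : ℕ) : ℕ :=
  moveConst r C C' * (1 + 2 ^ (r + q) * correctConst q r κ C C')

/-- The sparsity constant for all gadgets. -/
def refineConst (q r κ C C' : ℕ) : ℕ :=
  totalMoveConst q r κ C C' + correctConst q r κ C C' +
    gadgetConst q r C * (totalMoveConst q r κ C C' + 2 ^ r * r ^ r * (C' ^ (2 * r) *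
      (r * (r * κ) ^ r + 2 ^ (r * κ) * (2 ^ (r * κ)) ^ r)))

open scoped Classical in
theorem card_support_le {V : Type*} [DecidableEq V] [Fintype V] {q r : ℕ} {Y : Finset V} {C : ℕ}
    {𝒢 : Finset (Chain V × Finset V)} (h𝒢 : ∀ γ ∈ 𝒢, Gadget q r Y C γ) (S : Finset V) :
    (univ.filter fun e : {e : Finset V // ∃ γ ∈ 𝒢, γ.1 e ≠ 0} => S ⊆ e.1).card ≤
      2 ^ C * (𝒢.filter fun γ => S ⊆ γ.2).card := by
  rw [← Finset.card_map (Function.Embedding.subtype _)]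
  refine (Finset.card_le_card (t := (𝒢.filter fun γ => S ⊆ γ.2).biUnion fun γ => γ.2.powerset)
    ?_).trans (Finset.card_biUnion_le.trans ((Finset.sum_le_card_nsmul _ _ (2 ^ C) ?_).trans ?_))
  · intro e he
    obtain ⟨⟨e, γ, hγ, h⟩, he', rfl⟩ := Finset.mem_map.1 he
    have hSe : S ⊆ e := (Finset.mem_filter.1 he').2
    have heγ : e ⊆ γ.2 := by
      by_contra hcon
      exact h ((h𝒢 γ hγ).supp e hcon)
    exact Finset.mem_biUnion.2 ⟨γ, Finset.mem_filter.2 ⟨hγ, hSe.trans heγ⟩,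
      Finset.mem_powerset.2 heγ⟩
  · intro γ hγ
    rw [Finset.card_powerset]
    exact Nat.pow_le_pow_right (by omega) (h𝒢 γ (Finset.mem_filter.1 hγ).1).card
  · rw [smul_eq_mul, mul_comm]

namespace Frame

variable {V : Type*} [DecidableEq V] [Fintype V] {c r κ : ℕ} {A : Type*} [AddCommGroup A]
  [DecidableEq A] [Fintype A] (F : Frame V c (Fin r × Fin κ) A)

/-- After a correction γ the sum over `L` is null, but its label sums are arbitrary. So both the
given sets and all sets occurring in correcting gadgets are moved; what remains is null, and lies on
zero-row sets modulo the clearing octahedra, so it is spanned by sparse gadgets. The moves of the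
correcting sets become gadgets themselves. The number of sets to be moved stays sparse because
correcting gadgets are bounded and sparse. -/
theorem refinable {ι : Type*} [Fintype ι] {q : ℕ} (hr : 2 ≤ r) (hrq : r < q) (hc : 4 * r + q < c)
    (hdiv : ∀ n, 1 ≤ n → n ≤ r → ∀ a : A, ∃ t, n • t = a) (hκ : r + 2 * r * r + r ≤ κ)
    {Y : Finset V} (hY : ∀ m g, F.vtx m g ∈ Y) (x : ι → Finset V) (hx : ∀ ε, (x ε).card = r)
    {C C' D : ℕ}
    (hdeg : ∀ S : Finset V, S.card = r - 1 → (univ.filter fun ε => S ⊆ x ε).card ≤ D)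
    (hC : Fintype.card V ≤ C * Fintype.card (Fin r × Fin κ → A)) (hD : Real.log (Fintype.card V) ≤ D)
    (hfib : F.FibreLE C') (hC' : 1 ≤ C') (hA : Fintype.card A ^ (κ * (r - 1)) ≤ D) :
    Refinable q r Y x (r + q) (refineConst q r κ C C' * D) := by
  classical
  have hA' : Fintype.card A ^ (r - 1) ≤ D :=
    (Nat.pow_le_pow_right Fintype.card_pos (Nat.le_mul_of_pos_left _ (by omega))).trans hA
  obtain ⟨𝓛, h𝓛, h𝓛deg, h𝓛span⟩ := F.exists_corrections (by omega) hrq (by omega) (by omega) hdiv hY hC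
    hD hfib hC' hA'
  have hκ1 : Fintype.card (Fin r × Fin κ) = r * κ := by simp
  rw [hκ1] at h𝓛deg
  change ∀ S : Finset V, S.card = r - 1 → (𝓛.filter fun γ => S ⊆ γ.2).card ≤
    correctConst q r κ C C' * D at h𝓛deg
  set E : Type _ := {e : Finset V // ∃ γ ∈ 𝓛, γ.1 e ≠ 0} with hE
  have hEr : ∀ e : E, e.1.card = r := by
    rintro ⟨e, γ, hγ, h⟩
    by_contra hcon
    exact h ((h𝓛 γ hγ).divis.1 e hcon)
  have hEY : ∀ e : E, (e.1 ∩ Y).Nonempty := by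
    rintro ⟨e, γ, hγ, h⟩
    exact (h𝓛 γ hγ).flat e h
  obtain ⟨O, W, P, hO, hP, hcount⟩ := F.exists_moves (ι := ι ⊕ E)
    (D := (1 + 2 ^ (r + q) * correctConst q r κ C C') * D) (by omega) (by omega) hY
    (Sum.elim x Subtype.val)
    (by rintro (ε | e); exacts [hx ε, hEr e]) (fun S hS => by
      rw [card_filter_sum, add_mul, one_mul]
      refine Nat.add_le_add (hdeg S hS) ((card_support_le h𝓛 S).trans ?_)
      rw [mul_assoc]
      exact Nat.mul_le_mul_left _ (h𝓛deg S hS)) hC hfib hC'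
    (hD.trans (by exact_mod_cast Nat.le_mul_of_pos_left _ (by omega)))
  have hcount' : ∀ S : Finset V, S.card = r - 1 →
      (univ.filter fun i => S ⊆ W i).card ≤ totalMoveConst q r κ C C' * D ∧
        load P S ≤ totalMoveConst q r κ C C' * D := by
    intro S hS
    have h := hcount S hS
    rw [← mul_assoc] at h
    exact h
  obtain ⟨ℋ, hℋ, hℋdeg, hℋP, hℋspan⟩ := F.exists_spanning_gadgets hr hrq (by omega) (by omega) hdiv hκ
    hY hC hD hfib hC' hA P hP fun S hS => (hcount' S hS).2
  obtain ⟨𝒢, h𝒢⟩ : ∃ 𝒢, 𝒢 = 𝓛 ∪ ℋ ∪ univ.image fun e : E => (O (Sum.inr e), W (Sum.inr e)) := ⟨_, rfl⟩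
  have hspan𝓛 : Submodule.span ℤ ((fun γ => γ.1) '' (𝓛 : Set (Chain V × Finset V))) ≤
      Submodule.span ℤ ((fun γ => γ.1) '' (𝒢 : Set (Chain V × Finset V))) := by
    refine Submodule.span_mono (Set.image_mono ?_)
    rw [h𝒢]
    exact_mod_cast Finset.subset_union_left.trans Finset.subset_union_left
  have hspanℋ : Submodule.span ℤ ((fun γ => γ.1) '' (ℋ : Set (Chain V × Finset V))) ≤
      Submodule.span ℤ ((fun γ => γ.1) '' (𝒢 : Set (Chain V × Finset V))) := by
    refine Submodule.span_mono (Set.image_mono ?_)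
    rw [h𝒢]
    exact_mod_cast Finset.subset_union_right.trans Finset.subset_union_left
  refine ⟨fun ε => O (Sum.inl ε), fun ε => W (Sum.inl ε), 𝒢, fun ε => ?_, fun γ hγ => ?_,
    fun S hS => ?_, fun L hL => ?_⟩
  · obtain ⟨h1, h2, h3, h4, -⟩ := hO (Sum.inl ε)
    exact ⟨null_le_divis q r h1, h2, h3.trans (by omega), h4⟩
  · rw [h𝒢] at hγ
    rcases Finset.mem_union.1 hγ with hγ | hγ
    · exact (Finset.mem_union.1 hγ).elim (h𝓛 γ) (hℋ γ)
    · obtain ⟨e, -, rfl⟩ := Finset.mem_image.1 hγ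
      obtain ⟨h1, h2, h3, h4, -⟩ := hO (Sum.inr e)
      refine ⟨h2, null_le_divis q r h1, h3.trans (by omega), fun f hf => ?_⟩
      by_cases hfe : f = e
      · rw [hfe]
        exact hEY e
      · by_contra hcon
        have h5 := h4 f fun h => hcon h.1
        rw [Pi.sub_apply, sing_apply, if_neg (by exact hfe), sub_zero] at h5
        exact hf h5
  · have h1 : (univ.filter fun ε => S ⊆ W (Sum.inl ε)).card + ((univ.image fun e : E =>
        (O (Sum.inr e), W (Sum.inr e))).filter fun γ => S ⊆ γ.2).card ≤
        totalMoveConst q r κ C C' * D := by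
      refine le_trans ?_ (hcount' S hS).1
      rw [card_filter_sum, Finset.filter_image]
      exact Nat.add_le_add_left Finset.card_image_le _
    have h2 : (𝒢.filter fun γ => S ⊆ γ.2).card ≤ (𝓛.filter fun γ => S ⊆ γ.2).card +
        (ℋ.filter fun γ => S ⊆ γ.2).card + ((univ.image fun e : E =>
        (O (Sum.inr e), W (Sum.inr e))).filter fun γ => S ⊆ γ.2).card := by
      rw [h𝒢, Finset.filter_union, Finset.filter_union]
      exact (Finset.card_union_le _ _).trans (Nat.add_le_add_right (Finset.card_union_le _ _) _)
    have h3 := h𝓛deg S hS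
    have h4 := hℋdeg S hS
    rw [refineConst, add_mul, add_mul]
    refine (Nat.add_le_add_left h2 _).trans (le_trans (le_of_eq ?_)
      (Nat.add_le_add (Nat.add_le_add h1 h3) h4))
    ring
  · obtain ⟨γ, hγ, hnull⟩ := h𝓛span _ hL
    have hγE : γ ∈ supp {e | ∃ γ ∈ 𝓛, γ.1 e ≠ 0} := by
      refine Submodule.span_le.2 ?_ hγ
      rintro _ ⟨γ', hγ', rfl⟩ e he
      by_contra hcon
      exact he ⟨γ', hγ', hcon⟩
    have hγsum : ∑ e : E, γ e • sing e.1 = γ := (eq_sum_subtype hγE).symm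
    -- θ is the moved version of the null chain `∑ sing (x ε) - γ`. It is null because the moves are
    -- octahedra, and each of its terms is a combination of clearing octahedra and zero-row sets.
    set θ : Chain V := ∑ ε ∈ L, (sing (x ε) - O (Sum.inl ε)) -
      ∑ e : E, γ e • (sing e.1 - O (Sum.inr e)) with hθ
    have hθnull : θ ∈ null r := by
      have : θ = (∑ ε ∈ L, sing (x ε) - γ) - (∑ ε ∈ L, O (Sum.inl ε) -
          ∑ e : E, γ e • O (Sum.inr e)) := by
        rw [hθ]
        simp only [smul_sub, Finset.sum_sub_distrib, hγsum]
        abel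
      rw [this]
      exact Submodule.sub_mem _ hnull (Submodule.sub_mem _ (Submodule.sum_mem _ fun ε _ => (hO _).1)
        (Submodule.sum_mem _ fun e _ => Submodule.smul_mem _ _ (hO _).1))
    have hθmem : θ ∈ Submodule.span ℤ ((fun γ => γ.1) '' (ℋ : Set (Chain V × Finset V))) := by
      refine mem_of_mem_sup_supp hθnull ?_ hℋP ?_ hℋspan
      · rw [Submodule.span_le]
        rintro _ ⟨p, hp, rfl⟩
        have := oct_mem_null (hP p hp).1
        rwa [List.length_ofFn] at this
      · exact Submodule.sub_mem _ (Submodule.sum_mem _ fun ε _ => (hO (Sum.inl ε)).2.2.2.2)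
          (Submodule.sum_mem _ fun e _ => Submodule.smul_mem _ _ (hO (Sum.inr e)).2.2.2.2)
    have hfin : ∑ ε ∈ L, (sing (x ε) - O (Sum.inl ε)) = θ + (γ - ∑ e : E, γ e • O (Sum.inr e)) := by
      rw [hθ]
      simp only [smul_sub, Finset.sum_sub_distrib, hγsum]
      abel
    rw [hfin]
    refine Submodule.add_mem _ (hspanℋ hθmem) (Submodule.sub_mem _ (hspan𝓛 hγ)
      (Submodule.sum_mem _ fun e _ => Submodule.smul_mem _ _ (Submodule.subset_span
        ⟨(O (Sum.inr e), W (Sum.inr e)), ?_, rfl⟩)))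
    rw [h𝒢]
    exact Finset.mem_union_right _ (Finset.mem_image_of_mem _ (Finset.mem_univ e))

end Frame

section

variable {V ι : Type*} [DecidableEq V] [Fintype V] [Fintype ι]

theorem Refinable.mono {q r : ℕ} {Y : Finset V} {x : ι → Finset V} {C C' D D' : ℕ}
    (h : Refinable q r Y x C D) (hC : C ≤ C') (hD : D ≤ D') : Refinable q r Y x C' D' := by
  obtain ⟨O, W, 𝒢, h1, h2, h3, h4⟩ := h
  exact ⟨O, W, 𝒢, fun ε => ⟨(h1 ε).1, (h1 ε).2.1, (h1 ε).2.2.1.trans hC, (h1 ε).2.2.2⟩,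
    fun γ hγ => (h2 γ hγ).mono hC, fun S hS => (h3 S hS).trans hD, h4⟩

theorem mem_divis_one {q : ℕ} {φ : Chain V} (h : φ ∈ supp {e | e.card = 1}) (hd : (q : ℤ) ∣ deg ∅ φ) :
    φ ∈ divis q 1 := by
  refine ⟨h, fun S hS => ?_⟩
  rw [Finset.card_eq_zero.1 (Nat.lt_one_iff.1 hS)]
  simpa using hd

/-- For uniformity 1 the whole edge set has size at most the scale, so each edge can be moved to one
of two fixed vertices of `Y`, the two gadgets being the difference of these vertices and `q` times
one of them. Two vertices are needed so that each edge has a target different from itself. -/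
theorem refinable_one {q : ℕ} {Y : Finset V} (hY : 1 < Y.card) (x : ι → Finset V)
    (hx : ∀ ε, (x ε).card = 1) {D : ℕ} (hD : Fintype.card ι + 2 ≤ D) : Refinable q 1 Y x 2 D := by
  classical
  obtain ⟨y₁, hy₁, y₂, hy₂, hne⟩ := Finset.one_lt_card.1 hY
  have hy : ∀ ε, ∃ y, (y = y₁ ∨ y = y₂) ∧ {y} ≠ x ε := by
    intro ε
    by_cases h : {y₁} = x ε
    · refine ⟨y₂, Or.inr rfl, fun h' => hne ?_⟩
      rw [← h, Finset.singleton_inj] at h'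
      exact h'.symm
    · exact ⟨y₁, Or.inl rfl, h⟩
  choose y hy hyx using hy
  have hyY : ∀ ε, y ε ∈ Y := by
    intro ε
    rcases hy ε with h | h <;> rw [h] <;> assumption
  have hsing : ∀ v : V, sing {v} ∈ supp {e : Finset V | e.card = 1} :=
    fun v => sing_mem_supp (Finset.card_singleton v)
  have hdeg : ∀ e : Finset V, deg ∅ (sing e) = 1 := by simp [deg_sing]
  have hmeet : ∀ v ∈ Y, ({v} ∩ Y).Nonempty := fun v hv => ⟨v, by simpa using hv⟩
  refine ⟨fun ε => sing (x ε) - sing {y ε}, fun ε => x ε ∪ {y ε},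
    {(sing {y₁} - sing {y₂}, {y₁, y₂}), ((q : ℤ) • sing {y₂}, {y₂})}, fun ε => ⟨?_, ?_, ?_, ?_⟩,
    ?_, fun S hS => ?_, fun L hL => ?_⟩
  · refine mem_divis_one (Submodule.sub_mem _ (sing_mem_supp (hx ε)) (hsing _)) ?_
    rw [map_sub, hdeg, hdeg, sub_self]
    exact dvd_zero _
  · exact Submodule.sub_mem _ (sing_mem_supp Finset.subset_union_left)
      (sing_mem_supp Finset.subset_union_right)
  · exact (Finset.card_union_le _ _).trans (by rw [hx, Finset.card_singleton])
  · rw [sub_sub_cancel_left]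
    exact Submodule.neg_mem _ (sing_mem_supp ⟨hmeet _ (hyY ε), hyx ε⟩)
  · simp only [Finset.mem_insert, Finset.mem_singleton, forall_eq_or_imp, forall_eq]
    constructor
    · refine ⟨Submodule.sub_mem _ (sing_mem_supp ?_) (sing_mem_supp ?_),
        mem_divis_one (Submodule.sub_mem _ (hsing _) (hsing _)) ?_, Finset.card_le_two,
        fun e he => ?_⟩
      · simp
      · simp
      · rw [map_sub, hdeg, hdeg, sub_self]
        exact dvd_zero _
      · change (sing {y₁} - sing {y₂} : Chain V) e ≠ 0 at he
        rw [Pi.sub_apply, sing_apply, sing_apply] at he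
        by_cases h1 : e = {y₁}
        · rw [h1]
          exact hmeet _ hy₁
        · by_cases h2 : e = {y₂}
          · rw [h2]
            exact hmeet _ hy₂
          · simp [h1, h2] at he
    · refine ⟨Submodule.smul_mem _ _ (sing_mem_supp ?_),
        mem_divis_one (Submodule.smul_mem _ _ (hsing _)) ?_, by simp, fun e he => ?_⟩
      · simp
      · rw [map_smul, hdeg, smul_eq_mul, mul_one]
      · change ((q : ℤ) • sing {y₂} : Chain V) e ≠ 0 at he
        rw [Pi.smul_apply, sing_apply] at he
        by_cases h2 : e = {y₂}
        · rw [h2]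
          exact hmeet _ hy₂
        · simp [h2] at he
  · exact (Nat.add_le_add (Finset.card_le_univ _) ((Finset.card_filter_le _ _).trans
      Finset.card_le_two)).trans hD
  · have hdvd := hL.2 ∅ (by simp)
    rw [map_sum, Finset.sum_congr rfl fun ε _ => hdeg (x ε), Finset.sum_const, nsmul_eq_mul, mul_one,
      Finset.card_empty, Nat.sub_zero, Nat.sub_zero, Nat.choose_one_right] at hdvd
    obtain ⟨t, ht⟩ := hdvd
    have h1 : ∑ ε ∈ L, (sing (x ε) - (sing (x ε) - sing {y ε})) =
        ∑ ε ∈ L, (sing {y ε} - sing {y₂}) + t • (q : ℤ) • sing {y₂} := by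
      rw [Finset.sum_congr rfl fun ε _ => sub_sub_cancel (sing (x ε)) (sing {y ε}),
        Finset.sum_sub_distrib, Finset.sum_const, ← natCast_zsmul, ht, smul_smul, mul_comm t,
        sub_add_cancel]
    rw [h1]
    refine Submodule.add_mem _ (Submodule.sum_mem _ fun ε _ => ?_) (Submodule.smul_mem _ _
      (Submodule.subset_span ⟨((q : ℤ) • sing {y₂}, {y₂}), by simp, rfl⟩))
    rcases hy ε with h | h
    · rw [h]
      exact Submodule.subset_span ⟨(sing {y₁} - sing {y₂}, {y₁, y₂}), by simp, rfl⟩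
    · rw [h, sub_self]
      exact Submodule.zero_mem _

end

open scoped Nat in
theorem exists_refinable {q r : ℕ} (hr : 1 ≤ r) (hrq : r < q) : ∃ C : ℕ, 1 ≤ C ∧
    ∀ {V : Type*} [Fintype V] [DecidableEq V] {ι : Type*} [Fintype ι] (Y : Finset V)
      (x : ι → Finset V) (D : ℕ), C ≤ Fintype.card V → Fintype.card V ≤ 3 * Y.card →
      (∀ ε, (x ε).card = r) →
      (∀ S : Finset V, S.card = r - 1 → (univ.filter fun ε => S ⊆ x ε).card ≤ D) →
      Real.log (Fintype.card V) ≤ D → (∀ M : ℕ, M ^ r ≤ Fintype.card V → M ^ (r - 1) ≤ D) →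
      Refinable q r Y x C (C * D) := by
  rcases Nat.lt_or_ge 1 r with hr2 | hr1
  · set κ := r + 2 * r * r + r with hκ
    set c := 4 * r + q + 1 with hc
    set C₁ := 3 * (c * (r ! + 1) ^ (r * κ)) with hC₁
    refine ⟨3 * c + (r + q) + refineConst q r κ C₁ (c + C₁), by omega, ?_⟩
    intro V _ _ ι _ Y x D hV hY hx hdeg hlog hpow
    obtain ⟨N, hN, hcop, hN1, hN2⟩ := exists_modulus r (r * κ) c Y.card (by omega)
      (Nat.mul_pos (by omega) (by omega)) (by omega)
    have : NeZero N := ⟨by omega⟩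
    have hcard : Fintype.card (Fin r × Fin κ → ZMod N) = N ^ (r * κ) := by simp
    have hVC : Fintype.card V ≤ C₁ * Fintype.card (Fin r × Fin κ → ZMod N) := by
      rw [hcard, hC₁, mul_assoc]
      exact hY.trans (Nat.mul_le_mul_left _ hN2)
    obtain ⟨F, hFY, hFC⟩ := exists_frame (c := c) (Y := Y) (hcard ▸ hN1) hVC
    refine (F.refinable hr2 hrq (by omega) (fun n hn hnr a => ZMod_exists_nsmul (hcop n hn hnr) a)
      hκ.symm.le hFY x hx hdeg hVC hlog hFC (by omega) ?_).mono (by omega)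
      (Nat.mul_le_mul_right _ (by omega))
    -- `hpow` is used with `M = N ^ κ`: since `N ^ (r * κ)` is at most the number of vertices, `N ^
    -- (κ * (r - 1))` is at most `D`. Here the term v^(1 - 1/r) of the scale is used.
    rw [ZMod.card, pow_mul]
    refine hpow _ ?_
    rw [← pow_mul, mul_comm κ r]
    exact (Nat.le_mul_of_pos_left _ (by omega)).trans (hN1.trans (Finset.card_le_univ Y))
  · obtain rfl : r = 1 := by omega
    refine ⟨4, by omega, ?_⟩
    intro V _ _ ι _ Y x D hV hY hx hdeg hlog hpow
    have hD : 1 ≤ D := by simpa using hpow 1 (by rw [one_pow]; omega)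
    have h1 : Fintype.card ι ≤ D := by simpa using hdeg ∅ rfl
    exact (refinable_one (by omega) x hx (D := 4 * D) (by omega)).mono (by omega) le_rfl

/-! ### Carries along cyclic permutations -/

section Carry

/-- Arrange `T` in a cycle and let κ be minus the partial sum of τ; it closes up since the total is
zero. The permutation is chosen before τ, which is essential because `R` must not depend on `L`. -/
theorem exists_carry (T G : Type*) [Fintype T] [AddCommGroup G] :
    ∃ π : Equiv.Perm T, ∀ τ : T → G, ∑ s, τ s = 0 → ∃ κ : T → G, ∀ s, κ s = κ (π s) + τ s := by
  obtain ⟨k, ⟨ϕ⟩⟩ : ∃ k, Nonempty (T ≃ Fin k) := ⟨_, ⟨Fintype.equivFin T⟩⟩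
  cases k with
  | zero => exact ⟨1, fun τ _ => ⟨0, fun s => (ϕ s).elim0⟩⟩
  | succ k =>
    refine ⟨(ϕ.trans (finRotate (k + 1))).trans ϕ.symm, fun τ hτ => ?_⟩
    obtain ⟨t, ht⟩ : ∃ t : ℕ → G, ∀ i : Fin (k + 1), t i = τ (ϕ.symm i) :=
      ⟨fun j => if h : j < k + 1 then τ (ϕ.symm ⟨j, h⟩) else 0, fun i => dif_pos i.2⟩
    have hsum : ∑ j ∈ range (k + 1), t j = 0 := by
      rw [← Fin.sum_univ_eq_sum_range, ← hτ, ← Equiv.sum_comp ϕ.symm]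
      exact Finset.sum_congr rfl fun i _ => ht i
    refine ⟨fun s => -∑ j ∈ range (ϕ s), t j, fun s => ?_⟩
    have hs : τ s = t (ϕ s) := by rw [ht, Equiv.symm_apply_apply]
    simp only [Equiv.trans_apply, Equiv.apply_symm_apply, coe_finRotate, hs]
    split_ifs with h
    · rw [Finset.sum_range_succ] at hsum
      rw [h, Fin.val_last, Finset.range_zero, Finset.sum_empty, neg_zero, zero_add]
      exact neg_eq_of_add_eq_zero_right hsum
    · rw [Finset.sum_range_succ, neg_add, neg_add_cancel_right]

/-- A permutation preserving `e` along which every function with vanishing sums over the fibres of `e`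
is a coboundary. -/
theorem exists_carry_fiber {S α : Type*} [Fintype S] [DecidableEq α] (e : S → α) (G : Type*)
    [AddCommGroup G] :
    ∃ π : Equiv.Perm S, (∀ s, e (π s) = e s) ∧ ∀ τ : S → G,
      (∀ a, ∑ s with e s = a, τ s = 0) → ∃ κ : S → G, ∀ s, κ s = κ (π s) + τ s := by
  choose ϖ hϖ using fun a => exists_carry {s // e s = a} G
  refine ⟨Equiv.ofFiberEquiv ϖ, Equiv.ofFiberEquiv_map ϖ, fun τ hτ => ?_⟩
  have h1 : ∀ a, ∑ s : {s // e s = a}, τ s = 0 := by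
    intro a
    rw [← hτ a]
    exact (Finset.sum_subtype _ (by simp) _).symm
  choose κ hκ using fun a => hϖ a (fun s => τ s) (h1 a)
  refine ⟨fun s => κ (e s) ⟨s, rfl⟩, fun s => ?_⟩
  have h2 : ∀ (a : α) (s' : {s // e s = a}), κ (e s') ⟨s', rfl⟩ = κ a s' := by
    rintro _ ⟨s', rfl⟩
    rfl
  exact (hκ (e s) ⟨s, rfl⟩).trans (congrArg (· + τ s) (h2 _ (ϖ (e s) ⟨s, rfl⟩)).symm)

theorem card_filter_le_val {M a : ℕ} (h : a ≤ M) :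
    (univ.filter fun t : Fin M => a ≤ t.val).card + a = M := by
  have h1 := Finset.card_filter_add_card_filter_not (s := (univ : Finset (Fin M))) fun t => t.val < a
  simp only [not_lt] at h1
  rw [Fin.card_filter_val_lt, min_eq_right h, Finset.card_univ, Fintype.card_fin] at h1
  omega

end Carry

end Chain

/-! ### Realizing chains by pools of parallel edges -/

namespace MultiHypergraph

variable {V : Type u} [DecidableEq V]

/-- The multi-hypergraph with `2 * M` copies of each of the sets `e s`, in two pools. -/
def pooled {m : ℕ} (M : ℕ) (e : Fin m → Finset V) : MultiHypergraph.{u, v} V where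
  Edge := ULift.{v} (Fin m × Bool × Fin M)
  edgeFintype := inferInstance
  ends a := e a.down.1

variable (X : MultiHypergraph.{u, v} V) {m M : ℕ} (e : Fin m → Finset V)

/-- The subgraph with given edges whose vertex set is `W`, extended by all ends of edges. -/
def part (B : Finset X.Edge) (T : Finset (Fin m × Bool × Fin M)) (W : Finset V) :
    (X.union (pooled.{u, v} M e)).Subgraph where
  verts := W ∪ (B.biUnion X.ends ∪ T.biUnion fun a => e a.1)
  edges := B.disjSum (T.map Equiv.ulift.symm.toEmbedding)
  ends_subset := by
    rintro (ε | a) h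
    · exact (Finset.subset_biUnion_of_mem X.ends (Finset.inl_mem_disjSum.1 h)).trans
        (Finset.subset_union_left.trans Finset.subset_union_right)
    · obtain ⟨b, hb, rfl⟩ := Finset.mem_map.1 (Finset.inr_mem_disjSum.1 h)
      exact (Finset.subset_biUnion_of_mem (fun a => e a.1) hb).trans
        (Finset.subset_union_right.trans Finset.subset_union_right)

variable {X e} {B : Finset X.Edge} {T : Finset (Fin m × Bool × Fin M)} {W : Finset V}

theorem inl_mem_part {ε : X.Edge} :
    (Sum.inl ε : X.Edge ⊕ (pooled.{u, v} M e).Edge) ∈ (part X e B T W).edges ↔ ε ∈ B :=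
  Finset.inl_mem_disjSum

theorem inr_mem_part {a : (pooled.{u, v} M e).Edge} :
    (Sum.inr a : X.Edge ⊕ (pooled.{u, v} M e).Edge) ∈ (part X e B T W).edges ↔ a.down ∈ T := by
  refine Finset.inr_mem_disjSum.trans (Finset.mem_map.trans ⟨?_, fun h => ⟨_, h, rfl⟩⟩)
  rintro ⟨b, hb, rfl⟩
  exact hb

theorem part_verts_subset (hB : ∀ ε ∈ B, X.ends ε ⊆ W) (hT : ∀ a ∈ T, e a.1 ⊆ W) :
    (part.{u, v} X e B T W).verts ⊆ W :=
  Finset.union_subset Finset.Subset.rfl (Finset.union_subset (Finset.biUnion_subset.2 hB)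
    (Finset.biUnion_subset.2 hT))

theorem card_part_edges : (part.{u, v} X e B T W).edges.card = B.card + T.card :=
  (Finset.card_disjSum _ _).trans (congrArg (B.card + ·) (Finset.card_map _))

theorem filter_isLeft_part_le :
    ((part.{u, v} X e B T W).edges.filter fun a => Sum.isLeft a = true).card ≤ B.card := by
  classical
  refine (Finset.card_le_card (t := B.map Function.Embedding.inl) ?_).trans (Finset.card_map _).le
  rintro (ε | a) h
  · exact Finset.mem_map.2 ⟨ε, inl_mem_part.1 (Finset.mem_filter.1 h).1, rfl⟩
  · exact absurd (Finset.mem_filter.1 h).2 (by simp)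

theorem degree_part (S : Finset V) :
    (part.{u, v} X e B T W).degree S =
      (B.filter fun ε => S ⊆ X.ends ε).card + (T.filter fun a => S ⊆ e a.1).card := by
  classical
  have h2 := (Finset.card_disjSum (B.filter fun ε => S ⊆ X.ends ε)
    ((T.filter fun a => S ⊆ e a.1).map Equiv.ulift.{v}.symm.toEmbedding))
  rw [Finset.card_map] at h2
  have hf : ∀ (d : DecidablePred fun a => S ⊆ (X.union (pooled.{u, v} M e)).ends a) a,
      a ∈ @Finset.filter _ _ d (part.{u, v} X e B T W).edges ↔
        a ∈ (part.{u, v} X e B T W).edges ∧ S ⊆ (X.union (pooled.{u, v} M e)).ends a :=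
    fun d a => Finset.mem_filter
  refine Eq.trans (congrArg Finset.card (Finset.ext ?_)) h2
  rintro (ε | a)
  · refine (hf _ _).trans ((and_congr_left' inl_mem_part).trans (Iff.trans ?_
      Finset.inl_mem_disjSum.symm))
    exact (Finset.mem_filter (s := B) (p := fun ε => S ⊆ X.ends ε)).symm
  · refine (hf _ _).trans ((and_congr_left' inr_mem_part).trans (Iff.trans ?_
      Finset.inr_mem_disjSum.symm))
    constructor
    · rintro ⟨h1, h2⟩
      exact Finset.mem_map.2 ⟨a.down, Finset.mem_filter.2 ⟨h1, h2⟩, rfl⟩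
    · intro h
      obtain ⟨b, hb, rfl⟩ := Finset.mem_map.1 h
      exact Finset.mem_filter.1 hb

end MultiHypergraph

namespace Chain

variable {V I : Type*} [DecidableEq V] {m M : ℕ} [NeZero M]

/-- The pairs `(g s, e s)` enumerate the pairs `(i, a)` with `f i a ≠ 0`. -/
structure Slots (f : I → Chain V) (g : Fin m → I) (e : Fin m → Finset V) : Prop where
  inj : ∀ s s', g s = g s' → e s = e s' → s = s'
  ne_zero : ∀ s, f (g s) (e s) ≠ 0
  exists_eq : ∀ i a, f i a ≠ 0 → ∃ s, g s = i ∧ e s = a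

theorem exists_slots [Fintype V] [Fintype I] (f : I → Chain V) :
    ∃ (m : ℕ) (g : Fin m → I) (e : Fin m → Finset V), Slots f g e := by
  classical
  let σ := (Fintype.equivFin {p : I × Finset V // f p.1 p.2 ≠ 0}).symm
  refine ⟨_, fun s => (σ s).1.1, fun s => (σ s).1.2, fun s s' h h' => ?_, fun s => (σ s).2,
    fun i a h => ?_⟩
  · exact σ.injective (Subtype.ext (Prod.ext h h'))
  · exact ⟨σ.symm ⟨(i, a), h⟩, by simp, by simp⟩

theorem Slots.sum_eq [Fintype V] [Fintype I] {f : I → Chain V} {g : Fin m → I} {e : Fin m → Finset V}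
    (h : Slots f g e) {G : Type*} [AddCommMonoid G] (F : I → Finset V → G)
    (hF : ∀ i a, f i a = 0 → F i a = 0) : ∑ s, F (g s) (e s) = ∑ i, ∑ a, F i a := by
  rw [← Fintype.sum_prod_type']
  refine Fintype.sum_of_injective (fun s => (g s, e s)) (fun s s' hs => ?_) _ _ (fun p hp => ?_)
    fun s => rfl
  · rw [Prod.mk.injEq] at hs
    exact h.inj s s' hs.1 hs.2
  · by_contra hcon
    obtain ⟨s, h1, h2⟩ := h.exists_eq p.1 p.2 fun h0 => hcon (hF _ _ h0)
    exact hp ⟨s, Prod.ext h1 h2⟩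

/-- The edges in the first pools of a multiple of the chain `f i`. -/
def multiple [DecidableEq I] (f : I → Chain V) (g : Fin m → I) (e : Fin m → Finset V) (i : I)
    (c : ZMod M) : Finset (Fin m × Bool × Fin M) :=
  univ.filter fun a => g a.1 = i ∧ a.2.1 = false ∧ a.2.2.val < (c * (f i (e a.1) : ZMod M)).val

/-- A slot contributes the least nonnegative residue of `c` times its coefficient, so negative
coefficients are allowed and the count is linear modulo `M`. That suffices, since all divisors in
question divide M(q,r). -/
theorem card_filter_multiple [Fintype V] [Fintype I] [DecidableEq I] {f : I → Chain V}
    {g : Fin m → I} {e : Fin m → Finset V} (h : Slots f g e) (i : I) (c : ZMod M) (S : Finset V) :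
    (((multiple f g e i c).filter fun a => S ⊆ e a.1).card : ZMod M) = c * (deg S (f i) : ZMod M) := by
  have h1 : ((multiple f g e i c).filter fun a => S ⊆ e a.1).card =
      ∑ s, if g s = i ∧ S ⊆ e s then (c * (f (g s) (e s) : ZMod M)).val else 0 := by
    rw [multiple, Finset.filter_filter, Finset.card_filter, Fintype.sum_prod_type]
    refine Finset.sum_congr rfl fun s _ => ?_
    rw [Fintype.sum_prod_type, Fintype.sum_bool]
    by_cases hs : g s = i ∧ S ⊆ e s
    · rw [if_pos hs]
      simp only [hs.1, hs.2, true_and, and_true, Bool.true_eq_false, false_and, if_false,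
        Finset.sum_const_zero, zero_add]
      rw [← Finset.card_filter, Fin.card_filter_val_lt, min_eq_right (ZMod.val_lt _).le]
    · rw [if_neg hs]
      have h2 : ∀ P : Prop, ¬ ((g s = i ∧ P) ∧ S ⊆ e s) := fun P hP => hs ⟨hP.1.1, hP.2⟩
      simp [h2]
  rw [h1, Nat.cast_sum, h.sum_eq (fun i' a => ((if i' = i ∧ S ⊆ a then
    (c * (f i' a : ZMod M)).val else 0 : ℕ) : ZMod M)) (by intro i' a h0; simp [h0]),
    Finset.sum_eq_single i (fun i' _ hi => by simp [hi]) (by simp), deg_apply, Int.cast_sum,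
    Finset.mul_sum]
  refine Finset.sum_congr rfl fun a _ => ?_
  by_cases ha : S ⊆ a <;> simp [ha]

/-- The remaining edges of the first pool of `s`, and some edges of the second pools of `s` and of its
predecessor. -/
def leftover (π : Equiv.Perm (Fin m)) (s : Fin m) (a b b' : ZMod M) : Finset (Fin m × Bool × Fin M) :=
  {s} ×ˢ {false} ×ˢ (univ.filter fun t => a.val ≤ t.val) ∪
    ({π s} ×ˢ {true} ×ˢ (univ.filter fun t => b.val ≤ t.val) ∪
      {s} ×ˢ {true} ×ˢ (univ.filter fun t => t.val < b'.val))

theorem mem_leftover {π : Equiv.Perm (Fin m)} {s : Fin m} {a b b' : ZMod M}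
    {x : Fin m × Bool × Fin M} : x ∈ leftover π s a b b' ↔
      (x.2.1 = false ∧ x.1 = s ∧ a.val ≤ x.2.2.val) ∨ (x.2.1 = true ∧
        ((x.1 = π s ∧ b.val ≤ x.2.2.val) ∨ (x.1 = s ∧ x.2.2.val < b'.val))) := by
  obtain ⟨s', c, t⟩ := x
  simp only [leftover, Finset.mem_union, Finset.mem_product, Finset.mem_singleton, Finset.mem_filter,
    Finset.mem_univ, true_and]
  tauto

/-- Modulo `M` the three parts have sizes -a, -b and b', with sum zero. At a fixed point of π both
second-pool parts come from the same pool, and `b = b'` keeps them disjoint. -/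
theorem card_leftover {π : Equiv.Perm (Fin m)} {s : Fin m} {a b b' : ZMod M} (h : b' = b + a)
    (hs : π s = s → b = b') : ((leftover π s a b b').card : ZMod M) = 0 := by
  rw [leftover, Finset.card_union_of_disjoint, Finset.card_union_of_disjoint]
  · simp only [Finset.card_product, Finset.card_singleton, one_mul]
    rw [Fin.card_filter_val_lt, min_eq_right (ZMod.val_lt _).le]
    have h1 := congrArg (Nat.cast (R := ZMod M)) (card_filter_le_val (ZMod.val_lt a).le)
    have h2 := congrArg (Nat.cast (R := ZMod M)) (card_filter_le_val (ZMod.val_lt b).le)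
    push_cast at h1 h2 ⊢
    rw [ZMod.natCast_zmod_val, ZMod.natCast_self] at h1 h2
    rw [eq_neg_of_add_eq_zero_left h1, eq_neg_of_add_eq_zero_left h2, ZMod.natCast_zmod_val, h]
    ring
  · rw [Finset.disjoint_left]
    rintro ⟨s', c, t⟩ h1 h2
    simp only [Finset.mem_product, Finset.mem_singleton, Finset.mem_filter, Finset.mem_univ,
      true_and] at h1 h2
    rw [hs (h1.1.symm.trans h2.1)] at h1
    omega
  · rw [Finset.disjoint_left]
    rintro ⟨s', c, t⟩ h1 h2
    simp only [Finset.mem_union, Finset.mem_product, Finset.mem_singleton, Finset.mem_filter,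
      Finset.mem_univ, true_and] at h1 h2
    rcases h2 with h2 | h2 <;> simp [h1.2.1] at h2

end Chain

namespace MultiHypergraph

open Chain

theorem choose_dvd_multiplicityBound {q r i : ℕ} (hi : i < r) :
    (q - i).choose (r - i) ∣ multiplicityBound q r :=
  Finset.dvd_lcm (f := fun i => (q - i).choose (r - i)) (Finset.mem_range.2 hi)

theorem multiplicityBound_pos {q r : ℕ} (hrq : r < q) : 0 < multiplicityBound q r := by
  refine Nat.pos_of_ne_zero fun h => ?_
  rw [multiplicityBound, Finset.lcm_eq_zero_iff] at h
  obtain ⟨i, hi, h⟩ := h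
  rw [Finset.mem_range] at hi
  exact (Nat.choose_pos (by omega)).ne' h

theorem dvd_of_cast_eq {b M n : ℕ} {z : ℤ} (hb : b ∣ M) (h : (n : ZMod M) = (z : ZMod M))
    (hz : (b : ℤ) ∣ z) : b ∣ n := by
  have h1 : ((z - n : ℤ) : ZMod M) = 0 := by
    push_cast
    rw [h, sub_self]
  rw [ZMod.intCast_zmod_eq_zero_iff_dvd] at h1
  have h2 : (b : ℤ) ∣ z - n := (Int.natCast_dvd_natCast.2 hb).trans h1
  have h3 := dvd_sub hz h2
  rw [sub_sub_cancel] at h3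
  exact_mod_cast h3

variable {V : Type u} [DecidableEq V] {X : MultiHypergraph.{u, v} V}

section Divisible

variable {I : Type*} [Fintype V] [Fintype I] [DecidableEq I] {m q r : ℕ}
  [NeZero (multiplicityBound q r)] {f : I → Chain V} {g : Fin m → I} {e : Fin m → Finset V}

theorem isDivisible_multiple (h : Slots f g e) {i : I} {c : ℤ} {B : Finset X.Edge} {W : Finset V}
    (hdiv : ∀ S : Finset V, S.card < r → ((q - S.card).choose (r - S.card) : ℤ) ∣
      (B.filter fun ε => S ⊆ X.ends ε).card + c * deg S (f i)) :
    (part X e B (multiple f g e i (c : ZMod (multiplicityBound q r))) W).IsDivisible q r := by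
  intro S _ hS
  rw [degree_part]
  refine dvd_of_cast_eq (choose_dvd_multiplicityBound hS) ?_ (hdiv S hS)
  rw [Nat.cast_add, card_filter_multiple h]
  push_cast
  rfl

/-- π preserves the underlying set, so all these edges are parallel, and their number is a multiple
of M(q,r). -/
theorem isDivisible_leftover {π : Equiv.Perm (Fin m)} (hπ : ∀ s, e (π s) = e s) {s : Fin m}
    {a b b' : ZMod (multiplicityBound q r)} (h : b' = b + a) (hs : π s = s → b = b') :
    (part X e ∅ (leftover π s a b b') ∅).IsDivisible q r := by
  have h1 : ∀ x ∈ leftover π s a b b', e x.1 = e s := by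
    intro x hx
    rw [mem_leftover] at hx
    rcases hx with ⟨-, hx, -⟩ | ⟨-, ⟨hx, -⟩ | ⟨hx, -⟩⟩ <;> rw [hx]
    exact hπ s
  intro S hSv hS
  rw [degree_part, Finset.filter_empty, Finset.card_empty, zero_add]
  have hcard := (ZMod.natCast_eq_zero_iff _ _).1 (card_leftover h hs)
  by_cases hSe : S ⊆ e s
  · rw [Finset.filter_true_of_mem fun x hx => by rw [h1 x hx]; exact hSe]
    exact (choose_dvd_multiplicityBound hS).trans hcard
  · rw [Finset.filter_false_of_mem fun x hx => by rw [h1 x hx]; exact hSe]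
    exact dvd_zero _

end Divisible

theorem card_filter_image_le {α β : Type*} [Fintype α] [DecidableEq β] (F : α → β) (P : β → Prop)
    (Q : α → Prop) [DecidablePred P] [DecidablePred Q] (h : ∀ a, P (F a) → Q a) :
    ((univ.image F).filter P).card ≤ (univ.filter Q).card := by
  rw [Finset.filter_image]
  exact Finset.card_image_le.trans (Finset.card_le_card fun a ha =>
    Finset.mem_filter.2 ⟨Finset.mem_univ _, h a (Finset.mem_filter.1 ha).2⟩)

/-! ### From refining chains to a multi-refiner -/

/-- A family of chains that refines `X`: the sets of a chain, together with the edges of `X` owned by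
it, form a subgraph, and each divisible subgraph of `X` can be completed to a vanishing sum. -/
structure RefiningChains {V : Type u} [DecidableEq V] [Fintype V] (X : MultiHypergraph.{u, v} V)
    (q r : ℕ) (Y : Finset V) (C D : ℕ) {I : Type*} [Fintype I] [DecidableEq I] (f : I → Chain V)
    (W : I → Finset V) (own : I → Finset X.Edge) : Prop where
  own_card : ∀ i, (own i).card ≤ 1
  own_inj : ∀ i i' ε, ε ∈ own i → ε ∈ own i' → i = i'
  own_subset : ∀ i, ∀ ε ∈ own i, X.ends ε ⊆ W i
  subset : ∀ i a, f i a ≠ 0 → a ⊆ W i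
  card : ∀ i, (W i).card ≤ C
  uniform : ∀ i a, f i a ≠ 0 → a.card = r
  flat : ∀ i a, f i a ≠ 0 → (a ∩ Y).Nonempty
  count : ∀ S : Finset V, S.card = r - 1 → (univ.filter fun i => S ⊆ W i).card ≤ D
  complete : ∀ L : X.Subgraph, L.IsDivisible q r → ∃ (J : Finset I) (c : I → ℤ),
    (∀ i, i ∉ J → c i = 0) ∧ (∀ ε, ε ∈ L.edges ↔ ∃ i ∈ J, ε ∈ own i) ∧
    (∀ a, ∑ i, c i * f i a = 0) ∧
    ∀ i ∈ J, ∀ S : Finset V, S.card < r → ((q - S.card).choose (r - S.card) : ℤ) ∣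
      ((own i).filter fun ε => S ⊆ X.ends ε).card + c i * deg S (f i)

variable {V : Type u} [DecidableEq V] [Fintype V] {X : MultiHypergraph.{u, v} V}
  {I : Type*} [Fintype I] [DecidableEq I] {m M q r C D : ℕ} {f : I → Chain V} {g : Fin m → I}
  {e : Fin m → Finset V} {W : I → Finset V} {own : I → Finset X.Edge} {Y : Finset V}

/-- The members made of an owned edge and a multiple of a chain. -/
def chainPart [NeZero M] (f : I → Chain V) (g : Fin m → I) (e : Fin m → Finset V) (W : I → Finset V)
    (own : I → Finset X.Edge) (p : I × ZMod M) : (X.union (pooled.{u, v} M e)).Subgraph :=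
  part X e (own p.1) (multiple f g e p.1 p.2) (W p.1)

/-- The members made of leftover edges. -/
def leftoverPart (X : MultiHypergraph.{u, v} V) [NeZero M] (e : Fin m → Finset V)
    (π : Equiv.Perm (Fin m)) (p : Fin m × ZMod M × ZMod M × ZMod M) :
    (X.union (pooled.{u, v} M e)).Subgraph :=
  part X e ∅ (leftover π p.1 p.2.1 p.2.2.1 p.2.2.2) ∅

open scoped Classical in
/-- The divisible members. -/
noncomputable def refineFamily [NeZero M] (q r : ℕ) (f : I → Chain V) (g : Fin m → I)
    (e : Fin m → Finset V) (W : I → Finset V) (own : I → Finset X.Edge) (π : Equiv.Perm (Fin m)) :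
    Finset (X.union (pooled.{u, v} M e)).Subgraph :=
  (univ.image (chainPart (M := M) f g e W own) ∪ univ.image (leftoverPart (M := M) X e π)).filter
    fun H => H.IsDivisible q r

theorem mem_refineFamily [NeZero M] {π : Equiv.Perm (Fin m)}
    {H : (X.union (pooled.{u, v} M e)).Subgraph} :
    H ∈ refineFamily q r f g e W own π ↔
      ((∃ p, chainPart f g e W own p = H) ∨ ∃ p, leftoverPart X e π p = H) ∧ H.IsDivisible q r := by
  classical
  simp [refineFamily]

theorem card_filter_refineFamily_le [NeZero M] {π : Equiv.Perm (Fin m)}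
    {P : (X.union (pooled.{u, v} M e)).Subgraph → Prop} {_ : DecidablePred P} {Q : I × ZMod M → Prop}
    [DecidablePred Q] {Q' : Fin m × ZMod M × ZMod M × ZMod M → Prop} [DecidablePred Q']
    (h : ∀ p, P (chainPart f g e W own p) → Q p) (h' : ∀ p, P (leftoverPart X e π p) → Q' p) :
    ((refineFamily q r f g e W own π).filter P).card ≤
      (univ.filter Q).card + (univ.filter Q').card := by
  classical
  rw [refineFamily, Finset.filter_filter, Finset.filter_union]
  refine (Finset.card_union_le _ _).trans (Nat.add_le_add ?_ ?_)
  · exact card_filter_image_le _ _ _ fun p hp => h p hp.2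
  · exact card_filter_image_le _ _ _ fun p hp => h' p hp.2

theorem chainPart_verts (hf : RefiningChains X q r Y C D f W own) (hs : Slots f g e) [NeZero M]
    (p : I × ZMod M) : (chainPart f g e W own p).verts ⊆ W p.1 := by
  refine part_verts_subset (hf.own_subset p.1) fun a ha => ?_
  rw [← (Finset.mem_filter.1 ha).2.1]
  exact hf.subset _ _ (hs.ne_zero _)

theorem leftoverPart_verts [NeZero M] {π : Equiv.Perm (Fin m)} (hπ : ∀ s, e (π s) = e s)
    (p : Fin m × ZMod M × ZMod M × ZMod M) : (leftoverPart X e π p).verts ⊆ e p.1 := by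
  refine Finset.union_subset (Finset.empty_subset _) (Finset.union_subset
    (Finset.biUnion_subset.2 (by simp)) (Finset.biUnion_subset.2 fun a ha => ?_))
  rcases mem_leftover.1 ha with ⟨-, ha, -⟩ | ⟨-, ⟨ha, -⟩ | ⟨ha, -⟩⟩ <;> rw [ha]
  exact (hπ _).le

theorem card_slots_le (hf : RefiningChains X q r Y C D f W own) (hs : Slots f g e) (i : I) :
    (univ.filter fun s => g s = i).card ≤ 2 ^ C := by
  refine (Finset.card_le_card_of_injOn (t := (W i).powerset) e (fun s h => ?_) fun s h s' h' hss =>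
    ?_).trans ?_
  · have h1 : g s = i := by simpa using h
    rw [← h1]
    exact Finset.mem_coe.2 (Finset.mem_powerset.2 (hf.subset _ _ (hs.ne_zero s)))
  · have h1 : g s = i := by simpa using h
    have h2 : g s' = i := by simpa using h'
    exact hs.inj s s' (h1.trans h2.symm) hss
  · rw [Finset.card_powerset]
    exact Nat.pow_le_pow_right (by omega) (hf.card i)

/-- An edge of `X` is owned by at most one chain, of which there are `M` multiples. A pooled edge of
slot `s` lies in multiples of the one chain `g s` and in leftovers of `s` and `π.symm s` only, each
with `M ^ 3` parameters. -/
theorem edgeCount_refineFamily_le (hf : RefiningChains X q r Y C D f W own) [NeZero M]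
    {π : Equiv.Perm (Fin m)} (a : (X.union (pooled.{u, v} M e)).Edge) :
    edgeCount (refineFamily q r f g e W own π) a ≤ M + 2 * M ^ 3 := by
  classical
  rw [edgeCount]
  rcases a with ε | x
  · refine (card_filter_refineFamily_le (Q := fun p => ε ∈ own p.1) (Q' := fun _ => False)
      (fun p hp => inl_mem_part.1 hp) fun p hp => by simpa using inl_mem_part.1 hp).trans
      (Nat.add_le_add ?_ (by simp))
    refine (Finset.card_le_card_of_injOn (t := (univ : Finset (ZMod M))) Prod.snd (by simp)
      fun p hp p' hp' h => Prod.ext ?_ h).trans (by simp [ZMod.card])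
    exact hf.own_inj _ _ ε (by simpa using hp) (by simpa using hp')
  · refine (card_filter_refineFamily_le (Q := fun p => p.1 = g x.down.1)
      (Q' := fun p => p ∈ ({x.down.1, π.symm x.down.1} : Finset (Fin m)) ×ˢ
        (univ : Finset (ZMod M × ZMod M × ZMod M)))
      (fun p hp => (Finset.mem_filter.1 (inr_mem_part.1 hp)).2.1.symm) fun p hp => ?_).trans
      (Nat.add_le_add ?_ ?_)
    · rw [Finset.mem_product, Finset.mem_insert, Finset.mem_singleton]
      refine ⟨?_, Finset.mem_univ _⟩
      rcases mem_leftover.1 (inr_mem_part.1 hp) with ⟨-, ha, -⟩ | ⟨-, ⟨ha, -⟩ | ⟨ha, -⟩⟩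
      · exact Or.inl ha.symm
      · rw [ha, Equiv.symm_apply_apply]
        exact Or.inr rfl
      · exact Or.inl ha.symm
    · refine (Finset.card_le_card_of_injOn (t := (univ : Finset (ZMod M))) Prod.snd (by simp)
        fun p hp p' hp' h => Prod.ext ?_ h).trans (by simp [ZMod.card])
      have h1 : p.1 = g x.down.1 := by simpa using hp
      have h2 : p'.1 = g x.down.1 := by simpa using hp'
      rw [h1, h2]
    · rw [Finset.filter_univ_mem, Finset.card_product]
      refine (Nat.mul_le_mul_right _ Finset.card_le_two).trans (le_of_eq ?_)
      rw [Finset.card_univ, Fintype.card_prod, Fintype.card_prod, ZMod.card]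
      ring

theorem size_le_of_mem_refineFamily (hf : RefiningChains X q r Y C D f W own) (hs : Slots f g e)
    [NeZero M] {π : Equiv.Perm (Fin m)} (hπ : ∀ s, e (π s) = e s)
    {H : (X.union (pooled.{u, v} M e)).Subgraph} (hH : H ∈ refineFamily q r f g e W own π) :
    max H.verts.card H.edges.card ≤ C + (1 + 2 ^ C * M) + 4 * M := by
  rcases (mem_refineFamily.1 hH).1 with ⟨p, rfl⟩ | ⟨p, rfl⟩
  · refine max_le ?_ ?_
    · have := (Finset.card_le_card (chainPart_verts hf hs p)).trans (hf.card p.1)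
      omega
    · have h1 : (multiple f g e p.1 p.2).card ≤ 2 ^ C * M := by
        refine (Finset.card_le_card (t := (univ.filter fun s => g s = p.1) ×ˢ ({false} ×ˢ univ))
          ?_).trans ?_
        · rintro ⟨s, b, t⟩ h
          have h2 := Finset.mem_filter.1 h
          simpa using ⟨h2.2.1, h2.2.2.1⟩
        · rw [Finset.card_product, Finset.card_product, Finset.card_singleton, one_mul,
            Finset.card_univ, Fintype.card_fin]
          exact Nat.mul_le_mul_right _ (card_slots_le hf hs p.1)
      have h2 : (chainPart f g e W own p).edges.card = _ := card_part_edges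
      have h3 := hf.own_card p.1
      omega
  · refine max_le ?_ ?_
    · have h1 := hf.subset _ _ (hs.ne_zero p.1)
      have := (Finset.card_le_card ((leftoverPart_verts (X := X) hπ p).trans h1)).trans (hf.card _)
      omega
    · have h1 : (leftover π p.1 p.2.1 p.2.2.1 p.2.2.2).card ≤ 4 * M := by
        refine (Finset.card_le_card (t := {p.1, π p.1} ×ˢ (univ : Finset (Bool × Fin M))) ?_).trans ?_
        · rintro x hx
          rw [Finset.mem_product, Finset.mem_insert, Finset.mem_singleton]
          refine ⟨?_, Finset.mem_univ _⟩
          rcases mem_leftover.1 hx with ⟨-, ha, -⟩ | ⟨-, ⟨ha, -⟩ | ⟨ha, -⟩⟩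
          exacts [Or.inl ha, Or.inr ha, Or.inl ha]
        · rw [Finset.card_product]
          refine (Nat.mul_le_mul_right _ Finset.card_le_two).trans (le_of_eq ?_)
          rw [Finset.card_univ, Fintype.card_prod, Fintype.card_bool, Fintype.card_fin]
          ring
      have h2 : (leftoverPart X e π p).edges.card = _ := card_part_edges
      rw [Finset.card_empty] at h2
      omega

theorem refinementDegree_refineFamily_le (hf : RefiningChains X q r Y C D f W own)
    (hs : Slots f g e) [NeZero M] {π : Equiv.Perm (Fin m)} (hπ : ∀ s, e (π s) = e s) {S : Finset V}
    (hS : S.card = r - 1) :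
    refinementDegree (refineFamily (M := M) q r f g e W own π) S ≤ (M + 2 ^ C * M ^ 3) * D := by
  classical
  rw [refinementDegree]
  refine (card_filter_refineFamily_le
    (Q := fun p => p ∈ (univ.filter fun i => S ⊆ W i) ×ˢ (univ : Finset (ZMod M)))
    (Q' := fun p => p ∈ (univ.filter fun s => S ⊆ W (g s)) ×ˢ
      (univ : Finset (ZMod M × ZMod M × ZMod M)))
    (fun p hp => ?_) fun p hp => ?_).trans ?_
  · have h1 := hp.trans (chainPart_verts hf hs p)
    simpa using h1
  · have h1 := (hp.trans (leftoverPart_verts hπ p)).trans (hf.subset _ _ (hs.ne_zero p.1))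
    simpa using h1
  · rw [Finset.filter_univ_mem, Finset.filter_univ_mem, Finset.card_product, Finset.card_product,
      Finset.card_univ, Finset.card_univ, Fintype.card_prod, Fintype.card_prod, ZMod.card, add_mul]
    have h1 := hf.count S hS
    have h2 : (univ.filter fun s => S ⊆ W (g s)).card ≤ D * 2 ^ C := by
      refine (Finset.card_le_card (t := (univ.filter fun i => S ⊆ W i).biUnion fun i =>
        univ.filter fun s => g s = i) ?_).trans (Finset.card_biUnion_le.trans
        ((Finset.sum_le_card_nsmul _ _ _ fun i _ => card_slots_le hf hs i).trans ?_))
      · intro s h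
        simpa using h
      · exact Nat.mul_le_mul_right _ h1
    refine Nat.add_le_add ((Nat.mul_le_mul_right _ h1).trans (mul_comm _ _).le)
      ((Nat.mul_le_mul_right _ h2).trans (le_of_eq (by ring)))

variable {V : Type u} [DecidableEq V] [Fintype V] {X : MultiHypergraph.{u, v} V}
  {I : Type*} [Fintype I] [DecidableEq I] {m q r C D : ℕ} {f : I → Chain V} {g : Fin m → I}
  {e : Fin m → Finset V} {W : I → Finset V} {own : I → Finset X.Edge} {Y : Finset V}

/-- The first pool of a slot is cut at τ between its chain and its own leftover; the second pool of
`s` is cut at `κ s` between the leftovers of `s` and of `π.symm s`. The cocycle equation for κ makes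
all leftovers divisible. -/
theorem decomposes_refineFamily (hf : RefiningChains X q r Y C D f W own) (hs : Slots f g e)
    [NeZero (multiplicityBound q r)] {π : Equiv.Perm (Fin m)} (hπ : ∀ s, e (π s) = e s)
    (hcarry : ∀ τ : Fin m → ZMod (multiplicityBound q r), (∀ a, ∑ s with e s = a, τ s = 0) →
      ∃ κ : Fin m → ZMod (multiplicityBound q r), ∀ s, κ s = κ (π s) + τ s) :
    Decomposes q r X (pooled (multiplicityBound q r) e) (refineFamily q r f g e W own π) := by
  classical
  refine ⟨fun H hH => ?_, fun L hL => ?_⟩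
  · rcases (mem_refineFamily.1 hH).1 with ⟨p, rfl⟩ | ⟨p, rfl⟩
    · exact filter_isLeft_part_le.trans (hf.own_card p.1)
    · exact filter_isLeft_part_le.trans (by simp)
  · obtain ⟨J, c, hJ, hLJ, hsum, hdiv⟩ := hf.complete L hL
    obtain ⟨τ, hτ⟩ : ∃ τ : Fin m → ZMod (multiplicityBound q r),
        ∀ s, τ s = (c (g s) : ZMod (multiplicityBound q r)) * (f (g s) (e s) : ℤ) := ⟨_, fun _ => rfl⟩
    obtain ⟨κ, hκ⟩ := hcarry τ fun a => by
      rw [Finset.sum_filter]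
      simp only [hτ]
      rw [hs.sum_eq (fun i a' => if a' = a then (c i : ZMod (multiplicityBound q r)) * (f i a' : ℤ)
        else 0) (by intro i a' h; simp [h])]
      simp only [Finset.sum_ite_eq', Finset.mem_univ, if_true]
      have := congrArg (Int.cast (R := ZMod (multiplicityBound q r))) (hsum a)
      push_cast at this
      exact this
    obtain ⟨mem, hmem⟩ : ∃ mem : I ⊕ Fin m → (X.union (pooled (multiplicityBound q r) e)).Subgraph,
        (∀ i, mem (Sum.inl i) = chainPart f g e W own (i, (c i : ZMod (multiplicityBound q r)))) ∧
        ∀ s, mem (Sum.inr s) = leftoverPart X e π (s, τ s, κ (π s), κ s) :=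
      ⟨Sum.elim _ _, fun _ => rfl, fun _ => rfl⟩
    have hinl : ∀ i ε, (Sum.inl ε : X.Edge ⊕ (pooled (multiplicityBound q r) e).Edge) ∈
        (mem (Sum.inl i)).edges ↔ ε ∈ own i := fun i ε => by rw [hmem.1]; exact inl_mem_part
    have hinl' : ∀ s ε, (Sum.inl ε : X.Edge ⊕ (pooled (multiplicityBound q r) e).Edge) ∉
        (mem (Sum.inr s)).edges := fun s ε => by
      rw [hmem.2]
      exact fun h => absurd (inl_mem_part.1 h) (Finset.notMem_empty _)
    have hinr : ∀ i x, (Sum.inr x : X.Edge ⊕ (pooled (multiplicityBound q r) e).Edge) ∈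
        (mem (Sum.inl i)).edges ↔
          g x.down.1 = i ∧ x.down.2.1 = false ∧ x.down.2.2.val < (τ x.down.1).val := fun i x => by
      rw [hmem.1]
      refine inr_mem_part.trans (Finset.mem_filter.trans ⟨?_, ?_⟩)
      · rintro ⟨-, rfl, h⟩
        rw [hτ]
        exact ⟨rfl, h⟩
      · rintro ⟨rfl, h⟩
        rw [hτ] at h
        exact ⟨Finset.mem_univ _, rfl, h⟩
    have hinr' : ∀ s x, (Sum.inr x : X.Edge ⊕ (pooled (multiplicityBound q r) e).Edge) ∈
        (mem (Sum.inr s)).edges ↔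
          (x.down.2.1 = false ∧ x.down.1 = s ∧ (τ s).val ≤ x.down.2.2.val) ∨ (x.down.2.1 = true ∧
          ((x.down.1 = π s ∧ (κ (π s)).val ≤ x.down.2.2.val) ∨
            (x.down.1 = s ∧ x.down.2.2.val < (κ s).val))) := fun s x => by
      rw [hmem.2]
      exact inr_mem_part.trans mem_leftover
    -- All leftover members are used, but only the chains in `J`: a chain outside `J` may own an
    -- edge that is not in `L`.
    set used : Finset (I ⊕ Fin m) := univ.filter fun j => ∀ i, j = Sum.inl i → i ∈ J with hused
    have hmem_used : ∀ s, Sum.inr s ∈ used := by simp [hused]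
    have hmem_used' : ∀ i, Sum.inl i ∈ used ↔ i ∈ J := by simp [hused]
    have hdisj : ∀ j j' a, a ∈ (mem j).edges → a ∈ (mem j').edges → j = j' := by
      rintro (i | s) (i' | s') (ε | x) h h'
      · rw [hf.own_inj i i' ε ((hinl _ _).1 h) ((hinl _ _).1 h')]
      · rw [← ((hinr _ _).1 h).1, ← ((hinr _ _).1 h').1]
      · exact absurd h' (hinl' _ _)
      · have h1 := ((hinr _ _).1 h).2
        rcases (hinr' _ _).1 h' with ⟨-, h2, h3⟩ | ⟨h2, -⟩
        · rw [h2] at h1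
          omega
        · rw [h1.1] at h2
          exact absurd h2 (by simp)
      · exact absurd h (hinl' _ _)
      · have h1 := ((hinr _ _).1 h').2
        rcases (hinr' _ _).1 h with ⟨-, h2, h3⟩ | ⟨h2, -⟩
        · rw [h2] at h1
          omega
        · rw [h1.1] at h2
          exact absurd h2 (by simp)
      · exact absurd h (hinl' _ _)
      · congr 1
        rcases (hinr' _ _).1 h with ⟨h1, h2, -⟩ | ⟨h1, ⟨h2, h3⟩ | ⟨h2, h3⟩⟩ <;>
          rcases (hinr' _ _).1 h' with ⟨h4, h5, -⟩ | ⟨h4, ⟨h5, h6⟩ | ⟨h5, h6⟩⟩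
        · exact h2.symm.trans h5
        · exact absurd (h1.symm.trans h4) (by simp)
        · exact absurd (h1.symm.trans h4) (by simp)
        · exact absurd (h1.symm.trans h4) (by simp)
        · exact π.injective (h2.symm.trans h5)
        · rw [← h2, h5] at h3
          omega
        · exact absurd (h1.symm.trans h4) (by simp)
        · rw [← h5, h2] at h6
          omega
        · exact h2.symm.trans h5
    refine ⟨used.image mem, fun H hH => ?_, ?_, fun ε => ?_, fun x => ?_⟩
    · obtain ⟨j, hj, rfl⟩ := Finset.mem_image.1 hH
      rw [mem_refineFamily]
      rcases j with i | s
      · rw [hmem.1]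
        exact ⟨Or.inl ⟨_, rfl⟩, isDivisible_multiple hs (hdiv i ((hmem_used' i).1 hj))⟩
      · rw [hmem.2]
        refine ⟨Or.inr ⟨_, rfl⟩, isDivisible_leftover hπ (hκ s) fun h => ?_⟩
        rw [h]
    · rintro H hH H' hH' hne
      obtain ⟨j, -, rfl⟩ := Finset.mem_image.1 hH
      obtain ⟨j', -, rfl⟩ := Finset.mem_image.1 hH'
      exact Finset.disjoint_left.2 fun a h h' => hne (congrArg mem (hdisj j j' a h h'))
    · rw [hLJ]
      constructor
      · rintro ⟨H, hH, h⟩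
        obtain ⟨i | s, hj, rfl⟩ := Finset.mem_image.1 hH
        · exact ⟨i, (hmem_used' i).1 hj, (hinl _ _).1 h⟩
        · exact absurd h (hinl' _ _)
      · rintro ⟨i, hi, h⟩
        exact ⟨_, Finset.mem_image_of_mem _ ((hmem_used' i).2 hi), (hinl _ _).2 h⟩
    · obtain ⟨⟨s, b, t⟩⟩ := x
      cases b with
      | false =>
        by_cases h : t.val < (τ s).val
        · refine ⟨_, Finset.mem_image_of_mem _ ((hmem_used' (g s)).2 ?_), (hinr _ _).2 ⟨rfl, rfl, h⟩⟩
          -- A chain outside `J` has coefficient zero, hence claims no copies.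
          by_contra hcon
          rw [hτ, hJ _ hcon, Int.cast_zero, zero_mul, ZMod.val_zero] at h
          exact Nat.not_lt_zero _ h
        · exact ⟨_, Finset.mem_image_of_mem _ (hmem_used s),
            (hinr' _ _).2 (Or.inl ⟨rfl, rfl, not_lt.1 h⟩)⟩
      | true =>
        by_cases h : t.val < (κ s).val
        · exact ⟨_, Finset.mem_image_of_mem _ (hmem_used s),
            (hinr' _ _).2 (Or.inr ⟨rfl, Or.inr ⟨rfl, h⟩⟩)⟩
        · refine ⟨_, Finset.mem_image_of_mem _ (hmem_used (π.symm s)),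
            (hinr' _ _).2 (Or.inr ⟨rfl, Or.inl ⟨?_, ?_⟩⟩)⟩
          · rw [Equiv.apply_symm_apply]
          · rw [Equiv.apply_symm_apply]
            exact not_lt.1 h

theorem RefiningChains.exists_refiner (hf : RefiningChains X q r Y C D f W own) (hrq : r < q) :
    ∃ (R : MultiHypergraph.{u, v} V) (ℋ : Finset (X.union R).Subgraph),
      IsMultiRefiner q r X R ℋ ∧
      (∀ a, edgeCount ℋ a ≤ multiplicityBound q r + 2 * multiplicityBound q r ^ 3) ∧
      (∀ H ∈ ℋ, max H.verts.card H.edges.card ≤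
        C + (1 + 2 ^ C * multiplicityBound q r) + 4 * multiplicityBound q r) ∧
      (∀ S : Finset V, S.card = r - 1 → refinementDegree ℋ S ≤
        (multiplicityBound q r + 2 ^ C * multiplicityBound q r ^ 3) * D) ∧
      R.IsFlat (r - 1) Y := by
  have : NeZero (multiplicityBound q r) := ⟨(multiplicityBound_pos hrq).ne'⟩
  obtain ⟨m, g, e, hs⟩ := exists_slots f
  obtain ⟨π, hπ, hcarry⟩ := exists_carry_fiber e (ZMod (multiplicityBound q r))
  have hunif : ∀ s, (e s).card = r := fun s => hf.uniform _ _ (hs.ne_zero s)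
  refine ⟨pooled (multiplicityBound q r) e, refineFamily q r f g e W own π, ⟨fun a => hunif _,
    fun H hH => (mem_refineFamily.1 hH).2, decomposes_refineFamily hf hs hπ hcarry⟩,
    edgeCount_refineFamily_le hf, fun H hH => size_le_of_mem_refineFamily hf hs hπ hH,
    fun S hS => refinementDegree_refineFamily_le hf hs hπ hS, fun a => ?_⟩
  classical
  obtain ⟨y, hy⟩ := hf.flat _ _ (hs.ne_zero a.down.1)
  rw [Finset.mem_inter] at hy
  have h1 : e a.down.1 \ Y ⊆ (e a.down.1).erase y := fun z hz => by
    rw [Finset.mem_sdiff] at hz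
    exact Finset.mem_erase.2 ⟨by rintro rfl; exact hz.2 hy.2, hz.1⟩
  have h2 := Finset.card_le_card h1
  rw [Finset.card_erase_of_mem hy.1, hunif] at h2
  convert h2
  rfl

open scoped Classical in
theorem sum_sing_mem_divis {V : Type u} [Fintype V] {X : MultiHypergraph.{u, v} V} {q r : ℕ} (hX : X.IsUniform r) {L : X.Subgraph} (hL : L.IsDivisible q r) :
    ∑ ε ∈ L.edges, sing (X.ends ε) ∈ divis q r := by
  refine ⟨Submodule.sum_mem _ fun ε _ => sing_mem_supp (hX ε), fun S hS => ?_⟩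
  have h1 : deg S (∑ ε ∈ L.edges, sing (X.ends ε)) = (L.degree S : ℤ) := by
    rw [map_sum, Finset.sum_congr rfl fun ε _ => deg_sing S (X.ends ε), Subgraph.degree,
      Finset.card_filter]
    push_cast
    refine Finset.sum_congr rfl fun ε _ => ?_
    congr
  rw [h1]
  by_cases hSv : S ⊆ L.verts
  · exact_mod_cast hL S hSv hS
  · rw [Subgraph.degree, Finset.card_eq_zero.2 (Finset.filter_eq_empty_iff.2 fun {ε} hε h =>
      hSv (h.trans (L.ends_subset ε hε)))]
    exact dvd_zero _

-- The edge ε owns the chain `O ε` minus its own set, so together they make the divisible chain `O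
-- ε`; gadgets own nothing. For given `L`, edges in `L` get coefficient 1, other edges 0, and
-- gadgets the coefficients expressing the sum of `x ε - O ε` over `L`, whence the total vanishes.
open scoped Classical in
theorem exists_refiningChains {V : Type u} [Fintype V] {X : MultiHypergraph.{u, v} V} {q r C D : ℕ}
    {Y : Finset V} (hX : X.IsUniform r) (h : Refinable q r Y X.ends C D) :
    ∃ (I : Type (max u v)) (_ : Fintype I) (_ : DecidableEq I) (f : I → Chain V) (W : I → Finset V)
      (own : I → Finset X.Edge), RefiningChains X q r Y C D f W own := by
  obtain ⟨O, W, 𝒢, hO, h𝒢, hcount, hspan⟩ := h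
  have hOx : ∀ ε, O ε (X.ends ε) = 1 := fun ε => by
    have h1 := (hO ε).2.2.2 (X.ends ε) fun h => h.2 rfl
    rw [Pi.sub_apply, sing_apply, if_pos rfl] at h1
    omega
  have hne : ∀ ε a, (O ε - sing (X.ends ε)) a ≠ 0 → O ε a ≠ 0 := fun ε a h h0 => by
    rw [Pi.sub_apply, sing_apply] at h
    by_cases ha : a = X.ends ε
    · rw [ha, hOx] at h0
      exact one_ne_zero h0
    · simp [ha, h0] at h
  refine ⟨X.Edge ⊕ 𝒢, inferInstance, inferInstance, Sum.elim (fun ε => O ε - sing (X.ends ε)) fun γ => γ.1.1,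
    Sum.elim W fun γ => γ.1.2, Sum.elim (fun ε => {ε}) fun _ => ∅, ⟨?_, ?_, ?_, ?_, ?_, ?_, ?_, ?_, ?_⟩⟩
  · rintro (ε | γ) <;> simp
  · rintro (ε | γ) (ε' | γ') x h h'
    · rw [← Finset.mem_singleton.1 h, ← Finset.mem_singleton.1 h']
    · exact absurd h' (Finset.notMem_empty _)
    · exact absurd h (Finset.notMem_empty _)
    · exact absurd h (Finset.notMem_empty _)
  · rintro (ε | γ) x h
    · obtain rfl := Finset.mem_singleton.1 h
      by_contra hcon
      exact one_ne_zero ((hOx x).symm.trans ((hO x).2.1 _ hcon))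
    · exact absurd h (Finset.notMem_empty _)
  · rintro (ε | γ) a h
    · by_contra hcon
      exact hne ε a h ((hO ε).2.1 _ hcon)
    · by_contra hcon
      exact h ((h𝒢 _ γ.2).supp _ hcon)
  · rintro (ε | γ)
    exacts [(hO ε).2.2.1, (h𝒢 _ γ.2).card]
  · rintro (ε | γ) a h
    · by_contra hcon
      exact hne ε a h ((hO ε).1.1 _ hcon)
    · by_contra hcon
      exact h ((h𝒢 _ γ.2).divis.1 _ hcon)
  · rintro (ε | γ) a h
    · by_contra hcon
      exact h ((hO ε).2.2.2 _ fun h' => hcon h'.1)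
    · exact (h𝒢 _ γ.2).flat a h
  · intro S hS
    refine le_trans ?_ (hcount S hS)
    rw [card_filter_sum]
    refine Nat.add_le_add_left ?_ _
    rw [← Finset.card_map (Function.Embedding.subtype _)]
    refine Finset.card_le_card fun γ hγ => ?_
    obtain ⟨γ', h, rfl⟩ := Finset.mem_map.1 hγ
    exact Finset.mem_filter.2 ⟨γ'.2, (Finset.mem_filter.1 h).2⟩
  · intro L hL
    obtain ⟨c, hc⟩ := (Submodule.mem_span_image_finset_iff_exists_fun ℤ).1
      (hspan L.edges (sum_sing_mem_divis hX hL))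
    refine ⟨univ.filter fun i => ∀ ε, i = Sum.inl ε → ε ∈ L.edges,
      Sum.elim (fun ε => if ε ∈ L.edges then 1 else 0) c, ?_, ?_, ?_, ?_⟩
    · rintro (ε | γ) h
      · exact if_neg fun h' => h (by simpa using h')
      · exact absurd (by simp) h
    · intro ε
      constructor
      · intro h
        exact ⟨Sum.inl ε, by simpa using h, Finset.mem_singleton_self _⟩
      · rintro ⟨ε' | γ, h1, h2⟩
        · obtain rfl := Finset.mem_singleton.1 h2
          exact (Finset.mem_filter.1 h1).2 _ rfl
        · exact absurd h2 (Finset.notMem_empty _)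
    · intro a
      have h1 := congrFun hc a
      rw [Finset.sum_apply, Finset.sum_apply] at h1
      rw [Fintype.sum_sum_type]
      simp only [Sum.elim_inl, Sum.elim_inr, ite_mul, one_mul, zero_mul, Finset.sum_ite_mem,
        Finset.univ_inter]
      simp only [Pi.smul_apply, smul_eq_mul] at h1
      rw [h1, ← Finset.sum_add_distrib]
      refine Finset.sum_eq_zero fun ε _ => ?_
      simp
    · rintro (ε | γ) h S hS
      · have h1 : ε ∈ L.edges := (Finset.mem_filter.1 h).2 ε rfl
        have h2 : (((({ε} : Finset X.Edge).filter fun ε => S ⊆ X.ends ε).card : ℕ) : ℤ) =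
            deg S (sing (X.ends ε)) := by
          rw [Finset.filter_singleton, deg_sing]
          split_ifs <;> simp
        have h3 := (hO ε).1.2 S hS
        simp only [Sum.elim_inl, if_pos h1, one_mul]
        rw [h2, map_sub, add_sub_cancel]
        exact h3
      · simp only [Sum.elim_inr, Finset.filter_empty, Finset.card_empty, Nat.cast_zero, zero_add]
        exact ((h𝒢 _ γ.2).divis.2 S hS).mul_left _

/-! ### Estimates for the degree scale -/

section Scale

variable {V : Type u} [Fintype V] (X : MultiHypergraph.{u, v} V) {r : ℕ}

theorem one_le_log_card (h3 : 3 ≤ Fintype.card V) : 1 ≤ Real.log (Fintype.card V) := by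
  rw [Real.le_log_iff_exp_le (by positivity)]
  have h3' : (3 : ℝ) ≤ Fintype.card V := by exact_mod_cast h3
  linarith [Real.exp_one_lt_d9]

theorem one_sub_inv_nonneg (hr : 1 ≤ r) : (0 : ℝ) ≤ 1 - 1 / (r : ℝ) := by
  have : 1 / (r : ℝ) ≤ 1 := by
    rw [div_le_one (by positivity)]
    exact_mod_cast hr
  linarith

theorem log_card_le_degreeScale (hr : 1 ≤ r) (h3 : 3 ≤ Fintype.card V) :
    Real.log (Fintype.card V) ≤ X.degreeScale r := by
  have h1 : (1 : ℝ) ≤ (Fintype.card V : ℝ) ^ (1 - 1 / (r : ℝ)) :=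
    Real.one_le_rpow (by exact_mod_cast (by omega : 1 ≤ Fintype.card V)) (one_sub_inv_nonneg hr)
  exact (le_mul_of_one_le_left (by linarith [one_le_log_card h3]) h1).trans (le_max_right _ _)

theorem pow_le_degreeScale (hr : 1 ≤ r) (h3 : 3 ≤ Fintype.card V) {M : ℕ}
    (hM : M ^ r ≤ Fintype.card V) : ((M ^ (r - 1) : ℕ) : ℝ) ≤ X.degreeScale r := by
  have h1 : ((M ^ (r - 1) : ℕ) : ℝ) = ((M ^ r : ℕ) : ℝ) ^ (1 - 1 / (r : ℝ)) := by
    push_cast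
    rw [← Real.rpow_natCast (M : ℝ) r, ← Real.rpow_mul (by positivity), ← Real.rpow_natCast,
      Nat.cast_sub hr]
    congr 1
    field_simp
    simp
  have h2 : ((M ^ r : ℕ) : ℝ) ^ (1 - 1 / (r : ℝ)) ≤ (Fintype.card V : ℝ) ^ (1 - 1 / (r : ℝ)) :=
    Real.rpow_le_rpow (by positivity) (by exact_mod_cast hM) (one_sub_inv_nonneg hr)
  rw [h1]
  exact (h2.trans (le_mul_of_one_le_right (by positivity) (one_le_log_card h3))).trans
    (le_max_right _ _)

theorem degree_le_degreeScale {S : Finset V} (hS : S.card = r - 1) :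
    (X.degree S : ℝ) ≤ X.degreeScale r := by
  refine le_trans ?_ (le_max_left _ _)
  exact_mod_cast Finset.le_sup (f := X.degree) (Finset.mem_powersetCard.2 ⟨Finset.subset_univ _, hS⟩)

end Scale

end MultiHypergraph

end

/-! ### The Multi-Refiner Theorem -/

open MultiHypergraph in
theorem theorem3p4 (q r : ℕ) (hr : 1 ≤ r) (hqr : r < q) :
    ∃ C : ℕ, 1 ≤ C ∧
      ((∀ r' : ℕ, 1 ≤ r' → r' < r → RefinedMultiOmniAbsorberTheorem.{u, v} r') →
        ∀ (V : Type u) [Fintype V] (X : MultiHypergraph.{u, v} V),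
          X.IsUniform r → X.MultiplicityLE r (multiplicityBound q r) → C ≤ Fintype.card V →
          ∀ Y : Finset V, (Fintype.card V : ℝ) / 3 ≤ Y.card →
            ∃ (R : MultiHypergraph.{u, v} V) (ℋ : Finset (X.union R).Subgraph),
              IsMultiRefiner q r X R ℋ ∧ IsRefinedFamily ℋ C ∧
              (maxRefinementDegree ℋ r : ℝ) ≤ C * X.degreeScale r ∧
              R.IsFlat (r - 1) Y) := by
  classical
  obtain ⟨C, hC, hcore⟩ := Chain.exists_refinable.{u, v} hr hqr
  obtain ⟨M, hM⟩ : ∃ M, M = multiplicityBound q r := ⟨_, rfl⟩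
  -- The summands cover, in order, the size needed for `hcore`, the members per edge, the size of
  -- members, the refinement degree (doubled for the rounding of the scale), and `v(X) ≥ 3`, which
  -- gives log v(X) ≥ 1.
  refine ⟨C + (M + 2 * M ^ 3) + (C + (1 + 2 ^ C * M) + 4 * M) + 2 * ((M + 2 ^ C * M ^ 3) * C) + 3,
    by omega, ?_⟩
  intro _ V _ X hX _ hV Y hY
  have h3 : 3 ≤ Fintype.card V := by omega
  have hY' : Fintype.card V ≤ 3 * Y.card := by
    have : (Fintype.card V : ℝ) ≤ 3 * Y.card := by linarith
    exact_mod_cast this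
  have hscale := (one_le_log_card h3).trans (log_card_le_degreeScale X hr h3)
  -- The scale is at least 1, so rounding it up at most doubles it.
  set D := ⌈X.degreeScale r⌉₊ with hD
  have hDle : X.degreeScale r ≤ D := Nat.le_ceil _
  have hDge : (D : ℝ) ≤ 2 * X.degreeScale r := by
    linarith [Nat.ceil_lt_add_one (show (0 : ℝ) ≤ X.degreeScale r by linarith)]
  have hdeg : ∀ S : Finset V, S.card = r - 1 →
      (Finset.univ.filter fun ε => S ⊆ X.ends ε).card ≤ D := by
    intro S hS
    have h1 := (degree_le_degreeScale X hS).trans hDle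
    have h2 : X.degree S ≤ D := by exact_mod_cast h1
    exact h2
  obtain ⟨I, _, _, f, W, own, hf⟩ := exists_refiningChains hX (hcore Y X.ends D (by omega) hY' hX
    hdeg ((log_card_le_degreeScale X hr h3).trans hDle)
    fun m hm => by exact_mod_cast (pow_le_degreeScale X hr h3 hm).trans hDle)
  obtain ⟨R, ℋ, href, hedge, hsize, hmax, hflat⟩ := hf.exists_refiner hqr
  rw [← hM] at hedge hsize hmax
  refine ⟨R, ℋ, href, ⟨fun a => ?_, fun H hH => ?_⟩, ?_, hflat⟩
  · exact_mod_cast (hedge a).trans (by omega)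
  · exact_mod_cast (hsize H hH).trans (by omega)
  · have h1 : maxRefinementDegree ℋ r ≤ (M + 2 ^ C * M ^ 3) * (C * D) :=
      Finset.sup_le fun S hS => hmax S (Finset.mem_powersetCard.1 hS).2
    have h2 : (maxRefinementDegree ℋ r : ℝ) ≤ ((M + 2 ^ C * M ^ 3) * C : ℕ) * (D : ℝ) := by
      rw [← mul_assoc] at h1
      exact_mod_cast h1
    refine h2.trans ((mul_le_mul_of_nonneg_left hDge (Nat.cast_nonneg _)).trans ?_)
    rw [← mul_assoc]
    refine mul_le_mul_of_nonneg_right ?_ (by linarith)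
    rw [mul_comm _ (2 : ℝ)]
    exact_mod_cast (by omega)
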